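/- Let $n\ge 2$ and $R=\mathbb Z[\delta]$. **Diagrams.** An $(n+2)$-diagram consists of finitely many disjoint planar curves in a rectangle with nodes $1,\dots,n+2$ on the north face and $1',\dots,(n+2)'$ on the south face, up to isotopy: edges, each joining two nodes, with every node the end of exactly one edge, and loops (closed curves). An edge joining the two faces is *propagating*. Let $a(d)$ be the number of non-propagating edges in the north face of $d$; $d$ is *undammed* if it has no propagating edge, and *dammed* otherwise. Edges and loops may carry finite sequences of decorations from $\Omega=\{\bullet,\blacktriangle,\circ,\vartriangle\}$ ($\bullet,\blacktriangle$ are *closed*, $\circ,\vartriangle$ *open*), read from left to right on non-propagating edges, from north to south on propagating ones, and up to rotation and reversal on loops. If $a(d)=0$ there are no decorations. If $a(d)=1$, the relative vertical position of the decorations on propagating edges is part of the data (they lie below the decorations on the north non-propagating edge and above those on the south one), and two consecutive decorations on a propagating edge belong to the same block only if no decoration on another propagating edge lies vertically between them; in all other cases consecutive decorations on an edge or loop belong to the same block. A diagram is *LR-decorated* if all closed decorations can be taken to the left wall and all open ones to the right wall simultaneously by deforming the decorated edges without crossings. Let $\widehat{\mathcal P}_n$ be the $R$-algebra spanned by the LR-decorated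 diagrams, with product $d'd$ given by putting $d'$ on top of $d$, modulo the relations $\bullet\bullet=\blacktriangle$, $\bullet\blacktriangle=\blacktriangle\bullet=2\bullet$, $\circ\circ=\vartriangle$, $\circ\vartriangle=\vartriangle\circ=2\circ$ for adjacent decorations of a block, and the relations that a loop which is undecorated, or carries exactly one $\blacktriangle$, or exactly one $\vartriangle$, may be removed at the cost of a factor $\delta$. Its unit is the diagram $d_e$ with all edges vertical and undecorated and no loops. **Simple diagrams.** For $1\le i\le n+1$ the simple diagram $d_i$ has non-propagating edges $\{i,i+1\}$ and $\{i',(i+1)'\}$, all other edges vertical, and no loops; the two non-propagating edges each carry a single $\bullet$ if $i=1$, a single $\circ$ if $i=n+1$, and nothing otherwise; nothing else is decorated. Let $\mathbb D_n$ be the unital $R$-subalgebra of $\widehat{\mathcal P}_n$ generated by $d_1,\dots,d_{n+1}$. **Admissible diagrams.** An LR-decorated diagram $d$ is *$\widetilde C$-admissible* if no block has two adjacent decorations of the same type (open or closed) and the following axioms hold, each together with its mirror image in which left and right, closed and open, and nodes $1,2,3,1',2',3'$ and $n+2,n+1,n,(n+2)',(n+1)',n'$ are exchanged. 1. Each loop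 carries exactly one $\blacktriangle$ and one $\vartriangle$. 2. If $d$ is undammed, the edges at $1$ and at $1'$ each carry exactly one $\bullet$, which is the first decoration on the edge, and there is no other $\bullet$ on $d$. 3. Suppose $d$ has exactly one propagating edge $e$. A non-propagating edge at $1$ or $1'$ carries a single $\bullet$ and nothing else, and no other non-propagating edge carries a $\bullet$. Either $e$ joins $1$ to $1'$ and is undecorated or carries a single $\blacktriangle$ (or the mirror image of this holds); or $e$ carries an alternating, possibly empty, sequence of $\blacktriangle$ and $\vartriangle$, preceded by a $\bullet$ if $e$ starts at $1$ and by a $\circ$ if $e$ starts at $n+2$, and followed by a $\bullet$ if $e$ ends at $1'$ and by a $\circ$ if $e$ ends at $(n+2)'$. 4. Suppose $a(d)>1$ and $d$ has more than one propagating edge. If an edge joins $1$ to $1'$, it is undecorated or carries a single $\blacktriangle$. Otherwise the edges at $1$ and at $1'$ each carry a single $\bullet$ and nothing else. There is no other $\bullet$ on $d$. 5. Suppose $a(d)=1$. A non-propagating edge at $1$ or $1'$ carries a single $\bullet$ and nothing else, and no other non-propagating edge carries a $\bullet$. Moreover one of the following holds, where "highest" and "lowest" refer to the decorations on all propagating edges: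 (i) an edge joins $1$ to $1'$ and carries only (possibly no) $\blacktriangle$'s; (ii) there are edges $\{1,2\}$, $\{1',2'\}$, $\{3,3'\}$, the last one is undecorated or carries a single $\blacktriangle$, and $d$ has no open decorations; (iii) there are edges $\{1,2\}$, $\{1',2'\}$, $\{3,3'\}$, and the last one carries a $\bullet$ in highest position, then possibly $\blacktriangle$'s, then a $\bullet$ in lowest position; (iv) there are edges $\{1,2\}$ and $\{3,1'\}$, and the latter carries a $\bullet$ in highest position followed by possibly $\blacktriangle$'s; (v) there are edges $\{1',2'\}$ and $\{1,3'\}$, and the latter carries possibly $\blacktriangle$'s followed by a $\bullet$ in lowest position. **Proposition.** In $\widehat{\mathcal P}_n$, every $\widetilde C$-admissible $(n+2)$-diagram is equal to a (possibly empty) product of simple diagrams. In particular, all $\widetilde C$-admissible $(n+2)$-diagrams lie in $\mathbb D_n$. -/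

import Mathlib

open Polynomial

namespace AffineCDiagram

/-! ## Decorations and words of decorations -/

/-- The decoration set `Ω`: `dot` is the closed circle, `tri` the closed triangle,
`odot` the open circle and `otri` the open triangle. -/
inductive Deco where
  | dot : Deco
  | tri : Deco
  | odot : Deco
  | otri : Deco
  deriving DecidableEq

/-- The closed decorations are the closed circle and the closed triangle. -/
def Deco.isClosed : Deco → Bool
  | .dot => true
  | .tri => true
  | .odot => false
  | .otri => false

/-- The open decorations are the open circle and the open triangle. -/
def Deco.isOpen (x : Deco) : Bool := !x.isClosed

/-- In the word `u`, every closed decoration precedes every open one. -/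
def ClosedBeforeOpen (u : List Deco) : Prop :=
  u.Pairwise fun x y => x.isOpen = true → y.isOpen = true

/-- No two adjacent letters of the word are of the same type (open or closed): the word is a basis
element of the decoration algebra. -/
def Alternating (u : List Deco) : Prop :=
  u.IsChain fun x y => x.isClosed ≠ y.isClosed

/-- Loop equivalence of words: equality up to cyclic permutation and reversal. -/
def loopSetoid : Setoid (List Deco) where
  r u v := u ~r v ∨ u ~r v.reverse
  iseqv :=
    { refl := fun u => Or.inl (List.IsRotated.refl u)
      symm := by
        rintro u v (h | h)
        · exact Or.inl h.symm
        · right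
          have := h.reverse
          rw [List.reverse_reverse] at this
          exact this.symm
      trans := by
        rintro u v w (h | h) (h' | h')
        · exact Or.inl (h.trans h')
        · exact Or.inr (h.trans h')
        · exact Or.inr (h.trans h'.reverse)
        · left
          have := h'.reverse
          rw [List.reverse_reverse] at this
          exact h.trans this }

/-- The decoration word of a loop. -/
def LoopWord : Type := Quotient loopSetoid

/-- The loop decorated by the (cyclically read) word `u`. -/
def loopOf (u : List Deco) : LoopWord := Quotient.mk loopSetoid u

/-! ## Nodes and decorated diagrams -/

/-- The `2 k` nodes of the standard `k`-box: `Sum.inl i` is the node `i + 1` of the north face and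
`Sum.inr i` the node `(i + 1)'` of the south face. -/
abbrev Node (k : ℕ) : Type := Fin k ⊕ Fin k

/-- Position of a node on the boundary of the box, clockwise, starting at the left wall. -/
def posL {k : ℕ} : Node k → ℕ
  | Sum.inl i => i
  | Sum.inr i => 2 * k - 1 - i

/-- Position of a node on the boundary of the box, counterclockwise, starting at the right wall. -/
def posR {k : ℕ} : Node k → ℕ
  | Sum.inl i => k - 1 - i
  | Sum.inr i => k + i

/-- The combinatorial data of a decorated pseudo `k`-diagram, up to equivalence.
* `partner p` is the other end of the edge at the node `p`;
* `word p` is the sequence of decorations on the edge at `p`, read from `p` on;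
* `loops` is the multiset of the words on the loops;
* `vert` is used for diagrams of `a`-value `1` only: it lists the decorations on all propagating
  edges by vertical position, from top to bottom. -/
structure PreDiagram (k : ℕ) where
  partner : Node k → Node k
  word : Node k → List Deco
  loops : Multiset LoopWord
  vert : List Deco

namespace PreDiagram

variable {k : ℕ}

/-- The edge at `p` is propagating, i.e. joins the two faces. -/
def IsProp (d : PreDiagram k) (p : Node k) : Prop := (d.partner p).isLeft ≠ p.isLeft

open Classical in
/-- The number of non-propagating edges in the north face (each counted at its left end). -/
noncomputable def aValue (d : PreDiagram k) : ℕ :=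
  (Finset.univ.filter fun i : Fin k => ∃ j, d.partner (Sum.inl i) = Sum.inl j ∧ i < j).card

open Classical in
/-- The number of propagating edges. -/
noncomputable def propCount (d : PreDiagram k) : ℕ :=
  (Finset.univ.filter fun i : Fin k => ∃ j, d.partner (Sum.inl i) = Sum.inr j).card

/-- The edge at `p` can be deformed to touch the wall from which `pos` counts without crossing
another edge: no edge separates it from that wall. -/
def Exposed (d : PreDiagram k) (pos : Node k → ℕ) (p : Node k) : Prop :=
  ∀ q, ¬ (pos q < pos p ∧ pos q < pos (d.partner p) ∧
    pos p < pos (d.partner q) ∧ pos (d.partner p) < pos (d.partner q))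

/-- The words on the non-propagating edges of the north face, each read from left to right,
listed by left end. -/
def northWord (d : PreDiagram k) : List Deco :=
  (List.finRange k).flatMap fun i =>
    match d.partner (Sum.inl i) with
    | Sum.inl j => if i < j then d.word (Sum.inl i) else []
    | Sum.inr _ => []

/-- The words on the non-propagating edges of the south face, each read from left to right,
listed by left end. -/
def southWord (d : PreDiagram k) : List Deco :=
  (List.finRange k).flatMap fun i =>
    match d.partner (Sum.inr i) with
    | Sum.inr j => if i < j then d.word (Sum.inr i) else []
    | Sum.inl _ => []

/-- `d` is an LR-decorated diagram: a planar diagram whose closed (open) decorations are on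
L-exposed (R-exposed) edges, such that all closed decorations can be taken to the left wall and all
open ones to the right wall simultaneously. In an undammed diagram the latter means that, in each
face and on each loop, the closed decorations come before the open ones; in a dammed diagram it only
says, beyond exposure, that no loop carries both types. Loops are recorded without their position:
the type of the decorations on a decorated loop determines its region, and undecorated loops are
scalars in the quotient algebra.
If the `a`-value is `1` (and `k ≥ 4`), the closed (open) decorations on propagating edges are those
on the leftmost (rightmost) one, so that `vert` records their relative vertical position. If the
`a`-value is `0`, there are no decorations. -/
structure IsLR (d : PreDiagram k) : Prop where
  partner_partner : ∀ p, d.partner (d.partner p) = p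
  partner_ne : ∀ p, d.partner p ≠ p
  planar : ∀ p q, ¬ (posL p < posL q ∧ posL q < posL (d.partner p) ∧
    posL (d.partner p) < posL (d.partner q))
  word_partner : ∀ p, d.word (d.partner p) = (d.word p).reverse
  closed_exposed : ∀ p, ∀ x ∈ d.word p, x.isClosed = true → d.Exposed posL p
  open_exposed : ∀ p, ∀ x ∈ d.word p, x.isOpen = true → d.Exposed posR p
  north_sorted : d.propCount = 0 → ClosedBeforeOpen d.northWord
  south_sorted : d.propCount = 0 → ClosedBeforeOpen d.southWord
  loops_undammed : d.propCount = 0 → ∀ L ∈ d.loops, ∃ u, L = loopOf u ∧ ClosedBeforeOpen u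
  loops_dammed : d.propCount ≠ 0 → ∀ L ∈ d.loops, ∃ u, L = loopOf u ∧
    ((∀ x ∈ u, x.isClosed = true) ∨ (∀ x ∈ u, x.isOpen = true))
  vert_nil : d.aValue ≠ 1 → d.vert = []
  vert_left : d.aValue = 1 → ∀ i j, d.partner (Sum.inl i) = Sum.inr j →
    d.Exposed posL (Sum.inl i) → d.word (Sum.inl i) = d.vert.filter Deco.isClosed
  vert_right : d.aValue = 1 → ∀ i j, d.partner (Sum.inl i) = Sum.inr j →
    d.Exposed posR (Sum.inl i) → d.word (Sum.inl i) = d.vert.filter Deco.isOpen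
  undecorated : d.aValue = 0 → (∀ p, d.word p = []) ∧ ∀ L ∈ d.loops, L = loopOf []

/-! ## Concatenation -/

/-- Put `a` on top of `b`. `Trace a b s q w`: following the edges of the stack from `s` (`Sum.inl p`
enters an edge of `a` at its node `p`, `Sum.inr p` an edge of `b` at its node `p`), one ends at the
outer node `q` after reading the word `w`. -/
inductive Trace (a b : PreDiagram k) : Node k ⊕ Node k → Node k → List Deco → Prop
  | top {p : Node k} {i : Fin k} (h : a.partner p = Sum.inl i) :
      Trace a b (Sum.inl p) (Sum.inl i) (a.word p)
  | down {p q : Node k} {j : Fin k} {w : List Deco} (h : a.partner p = Sum.inr j)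
      (t : Trace a b (Sum.inr (Sum.inl j)) q w) : Trace a b (Sum.inl p) q (a.word p ++ w)
  | bottom {p : Node k} {j : Fin k} (h : b.partner p = Sum.inr j) :
      Trace a b (Sum.inr p) (Sum.inr j) (b.word p)
  | up {p q : Node k} {i : Fin k} {w : List Deco} (h : b.partner p = Sum.inl i)
      (t : Trace a b (Sum.inl (Sum.inr i)) q w) : Trace a b (Sum.inr p) q (b.word p ++ w)

/-- Put `a` on top of `b`. `LoopTrace a b m x w`: starting at the node `m` of the common face into
`a` and following the edges, staying at nodes `≥ m` of the common face and not passing `m` again,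
one comes back to the common face from `b` at `x`, having read the word `w`. -/
inductive LoopTrace (a b : PreDiagram k) (m : Fin k) : Fin k → List Deco → Prop
  | start {j l : Fin k} (ha : a.partner (Sum.inr m) = Sum.inr j)
      (hb : b.partner (Sum.inl j) = Sum.inl l) (hj : m ≤ j) (hl : m ≤ l) :
      LoopTrace a b m l (a.word (Sum.inr m) ++ b.word (Sum.inl j))
  | step {x j l : Fin k} {w : List Deco} (t : LoopTrace a b m x w) (hx : x ≠ m)
      (ha : a.partner (Sum.inr x) = Sum.inr j)
      (hb : b.partner (Sum.inl j) = Sum.inl l) (hj : m ≤ j) (hl : m ≤ l) :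
      LoopTrace a b m l (w ++ (a.word (Sum.inr x) ++ b.word (Sum.inl j)))

/-- `c` is obtained by placing `a` on top of `b`. The new loops are indexed by the smallest node of
the common face that they pass. If `c` has `a`-value `1`, then on the propagating edges the
decorations of `a` are above and those of `b` are below all others. -/
structure IsConcat (a b c : PreDiagram k) : Prop where
  north : ∀ i, Trace a b (Sum.inl (Sum.inl i)) (c.partner (Sum.inl i)) (c.word (Sum.inl i))
  south : ∀ i, Trace a b (Sum.inr (Sum.inr i)) (c.partner (Sum.inr i)) (c.word (Sum.inr i))
  loops : ∃ (S : Finset (Fin k)) (u : Fin k → List Deco),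
    (∀ m, m ∈ S ↔ ∃ w, LoopTrace a b m m w) ∧ (∀ m ∈ S, LoopTrace a b m m (u m)) ∧
    c.loops = a.loops + b.loops + S.val.map fun m => loopOf (u m)
  vert : c.aValue = 1 → ∃ w, c.vert = a.vert ++ w ++ b.vert

end PreDiagram

/-! ## The quotient algebra of LR-decorated diagrams -/

/-- The LR-decorated `(n + 2)`-diagrams. -/
def LRDiagram (n : ℕ) : Type := {d : PreDiagram (n + 2) // d.IsLR}

/-- The defining relations `s = c t` of the decoration algebra. -/
inductive LocalRule : List Deco → ℤ[X] → List Deco → Prop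
  | dot_dot : LocalRule [.dot, .dot] 1 [.tri]
  | odot_odot : LocalRule [.odot, .odot] 1 [.otri]
  | dot_tri : LocalRule [.dot, .tri] 2 [.dot]
  | tri_dot : LocalRule [.tri, .dot] 2 [.dot]
  | odot_otri : LocalRule [.odot, .otri] 2 [.odot]
  | otri_odot : LocalRule [.otri, .odot] 2 [.odot]

/-- The word `v` with coefficient `c` results from `u` by a local rule applied to adjacent
letters. -/
def Reduces (u : List Deco) (c : ℤ[X]) (v : List Deco) : Prop :=
  ∃ x y s t, LocalRule s c t ∧ u = x ++ s ++ y ∧ v = x ++ t ++ y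

namespace PreDiagram

variable {k : ℕ}

/-- A local rule applied to one edge that is not a loop, within one block. In the case of a
propagating edge of a diagram of `a`-value `1`, adjacent decorations are in the same block if and
only if they are adjacent in vertical position among the decorations on all propagating edges. -/
inductive EdgeReduces (d : PreDiagram k) (c : ℤ[X]) (e : PreDiagram k) : Prop
  | edge (p : Node k) (hp : ¬ (d.aValue = 1 ∧ d.IsProp p)) (hw : Reduces (d.word p) c (e.word p))
      (ho : ∀ q, q ≠ p → q ≠ d.partner p → e.word q = d.word q)
      (hs : e.partner = d.partner) (hl : e.loops = d.loops) (hv : e.vert = d.vert)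
  | vert (ha : d.aValue = 1) (hw : Reduces d.vert c e.vert)
      (ho : ∀ q, ¬ d.IsProp q → e.word q = d.word q)
      (hs : e.partner = d.partner) (hl : e.loops = d.loops)

/-- `d` and `e` differ at most in their loops. -/
def SameButLoops (d e : PreDiagram k) : Prop :=
  e.partner = d.partner ∧ e.word = d.word ∧ e.vert = d.vert

/-- A local rule applied to one loop. -/
def LoopReduces (d : PreDiagram k) (c : ℤ[X]) (e : PreDiagram k) : Prop :=
  SameButLoops d e ∧ ∃ u v M, Reduces u c v ∧ d.loops = loopOf u ::ₘ M ∧ e.loops = loopOf v ::ₘ M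

/-- `e` results from `d` by removing one loop that is undecorated or carries a single triangle. -/
def LoopRemoval (d e : PreDiagram k) : Prop :=
  SameButLoops d e ∧ ∃ u, (u = [] ∨ u = [Deco.tri] ∨ u = [Deco.otri]) ∧
    d.loops = loopOf u ::ₘ e.loops

/-- The diagram with vertical propagating edges only, without decorations and loops. -/
def identity (k : ℕ) : PreDiagram k where
  partner := Sum.swap
  word _ := []
  loops := 0
  vert := []

/-- The underlying data of the simple diagram `d_{i+1}`. -/
def simple {n : ℕ} (i : Fin (n + 1)) : PreDiagram (n + 2) where
  partner
    | Sum.inl x => if x = i.castSucc then Sum.inl i.succ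
        else if x = i.succ then Sum.inl i.castSucc else Sum.inr x
    | Sum.inr x => if x = i.castSucc then Sum.inr i.succ
        else if x = i.succ then Sum.inr i.castSucc else Sum.inl x
  word p :=
    if p.elim id id = i.castSucc ∨ p.elim id id = i.succ then
      if i = 0 then [.dot] else if i = Fin.last n then [.odot] else []
    else []
  loops := 0
  vert := []

end PreDiagram

namespace PreDiagram

theorem closedBeforeOpen_of_uniform {u : List Deco} {c : Bool} (h : ∀ x ∈ u, x.isClosed = c) :
    ClosedBeforeOpen u := by
  rw [ClosedBeforeOpen, List.pairwise_iff_forall_sublist]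
  intro x y hxy hx
  have h1 := h x (hxy.subset (by simp))
  have h2 := h y (hxy.subset (by simp))
  simp only [Deco.isOpen] at *
  rw [h2, ← h1]
  exact hx

theorem mem_northWord {k : ℕ} {d : PreDiagram k} {x : Deco} (h : x ∈ d.northWord) :
    ∃ p, x ∈ d.word p := by
  simp only [northWord, List.mem_flatMap] at h
  obtain ⟨i, -, hi⟩ := h
  refine ⟨Sum.inl i, ?_⟩
  split at hi
  · split at hi
    · exact hi
    · simp at hi
  · simp at hi

theorem mem_southWord {k : ℕ} {d : PreDiagram k} {x : Deco} (h : x ∈ d.southWord) :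
    ∃ p, x ∈ d.word p := by
  simp only [southWord, List.mem_flatMap] at h
  obtain ⟨i, -, hi⟩ := h
  refine ⟨Sum.inr i, ?_⟩
  split at hi
  · split at hi
    · exact hi
    · simp at hi
  · simp at hi

theorem identity_isLR (k : ℕ) : (identity k).IsLR where
  partner_partner p := by simp [identity]
  partner_ne p := by rcases p with p | p <;> simp [identity]
  planar p q := by
    rcases p with p | p <;> rcases q with q | q <;>
      simp only [identity, Sum.swap_inl, Sum.swap_inr, posL] <;> omega
  word_partner p := by simp [identity]
  closed_exposed p x hx := by simp [identity] at hx
  open_exposed p x hx := by simp [identity] at hx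
  north_sorted _ := closedBeforeOpen_of_uniform (c := true) fun x hx => by
    obtain ⟨p, hp⟩ := mem_northWord hx
    simp [identity] at hp
  south_sorted _ := closedBeforeOpen_of_uniform (c := true) fun x hx => by
    obtain ⟨p, hp⟩ := mem_southWord hx
    simp [identity] at hp
  loops_undammed _ L hL := by simp [identity] at hL
  loops_dammed _ L hL := by simp [identity] at hL
  vert_nil _ := rfl
  vert_left _ i j _ _ := by simp [identity]
  vert_right _ i j _ _ := by simp [identity]
  undecorated _ := ⟨fun _ => rfl, fun L hL => by simp [identity] at hL⟩

theorem simple_mem_word {n : ℕ} {i : Fin (n + 1)} {p : Node (n + 2)} {x : Deco}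
    (h : x ∈ (simple i).word p) :
    (p.elim id id = i.castSucc ∨ p.elim id id = i.succ) ∧
      ((i.val = 0 ∧ x = .dot) ∨ (i.val ≠ 0 ∧ i.val = n ∧ x = .odot)) := by
  simp only [simple] at h
  split at h
  · rename_i hp
    refine ⟨hp, ?_⟩
    split at h
    · rename_i h0
      subst h0
      simp_all
    · split at h
      · rename_i h0 hl
        right
        refine ⟨fun h => h0 (Fin.ext h), by simp [hl], by simpa using h⟩
      · simp at h
  · simp at h

theorem simple_uniform {n : ℕ} {i : Fin (n + 1)} {p : Node (n + 2)} {x : Deco}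
    (h : x ∈ (simple i).word p) : x.isClosed = decide (i.val = 0) := by
  obtain ⟨-, ⟨h0, rfl⟩ | ⟨h0, -, rfl⟩⟩ := simple_mem_word h <;> simp [h0, Deco.isClosed]

theorem simple_aValue_ne {n : ℕ} (i : Fin (n + 1)) : (simple i).aValue ≠ 0 := by
  classical
  rw [aValue, ← Nat.pos_iff_ne_zero, Finset.card_pos]
  exact ⟨i.castSucc, Finset.mem_filter.2
    ⟨Finset.mem_univ _, i.succ, by simp [simple], Fin.castSucc_lt_succ⟩⟩

theorem simple_prop_word {n : ℕ} (i : Fin (n + 1)) {x y : Fin (n + 2)}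
    (h : (simple i).partner (Sum.inl x) = Sum.inr y) : (simple i).word (Sum.inl x) = [] := by
  simp only [simple] at h ⊢
  split at h
  · simp at h
  · split at h
    · simp at h
    · simp_all

theorem simple_partner_inl {n : ℕ} (i : Fin (n + 1)) (x : Fin (n + 2)) :
    (∃ y, (simple i).partner (Sum.inl x) = Sum.inl y ∧ x.val + y.val = 2 * i.val + 1 ∧
      (x.val = i.val ∨ x.val = i.val + 1)) ∨
    ((simple i).partner (Sum.inl x) = Sum.inr x ∧ x.val ≠ i.val ∧ x.val ≠ i.val + 1) := by
  by_cases h1 : x = i.castSucc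
  · subst h1
    exact Or.inl ⟨i.succ, by simp [simple], by simp; omega, by simp⟩
  · by_cases h2 : x = i.succ
    · subst h2
      exact Or.inl ⟨i.castSucc, by simp [simple, h1], by simp; omega, by simp⟩
    · exact Or.inr ⟨by simp [simple, h1, h2], fun h => h1 (Fin.ext h), fun h => h2 (Fin.ext h)⟩

theorem simple_partner_inr {n : ℕ} (i : Fin (n + 1)) (x : Fin (n + 2)) :
    (∃ y, (simple i).partner (Sum.inr x) = Sum.inr y ∧ x.val + y.val = 2 * i.val + 1 ∧
      (x.val = i.val ∨ x.val = i.val + 1)) ∨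
    ((simple i).partner (Sum.inr x) = Sum.inl x ∧ x.val ≠ i.val ∧ x.val ≠ i.val + 1) := by
  by_cases h1 : x = i.castSucc
  · subst h1
    exact Or.inl ⟨i.succ, by simp [simple], by simp; omega, by simp⟩
  · by_cases h2 : x = i.succ
    · subst h2
      exact Or.inl ⟨i.castSucc, by simp [simple, h1], by simp; omega, by simp⟩
    · exact Or.inr ⟨by simp [simple, h1, h2], fun h => h1 (Fin.ext h), fun h => h2 (Fin.ext h)⟩

theorem simple_partner_cases {n : ℕ} (i : Fin (n + 1)) (p : Node (n + 2)) :
    ((∃ x y, p = Sum.inl x ∧ (simple i).partner p = Sum.inl y ∧ x.val + y.val = 2 * i.val + 1 ∧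
      (x.val = i.val ∨ x.val = i.val + 1)) ∨
    (∃ x y, p = Sum.inr x ∧ (simple i).partner p = Sum.inr y ∧ x.val + y.val = 2 * i.val + 1 ∧
      (x.val = i.val ∨ x.val = i.val + 1))) ∨
    (∃ x, p = Sum.inl x ∧ (simple i).partner p = Sum.inr x ∧
      x.val ≠ i.val ∧ x.val ≠ i.val + 1) ∨
    (∃ x, p = Sum.inr x ∧ (simple i).partner p = Sum.inl x ∧
      x.val ≠ i.val ∧ x.val ≠ i.val + 1) := by
  rcases p with x | x
  · rcases simple_partner_inl i x with ⟨y, h⟩ | h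
    · exact Or.inl (Or.inl ⟨x, y, rfl, h⟩)
    · exact Or.inr (Or.inl ⟨x, rfl, h⟩)
  · rcases simple_partner_inr i x with ⟨y, h⟩ | h
    · exact Or.inl (Or.inr ⟨x, y, rfl, h⟩)
    · exact Or.inr (Or.inr ⟨x, rfl, h⟩)

theorem simple_isLR {n : ℕ} (i : Fin (n + 1)) : (simple i).IsLR where
  partner_partner p := by
    rcases p with p | p <;> simp only [simple] <;> split_ifs <;> simp_all [Fin.ext_iff]
  partner_ne p := by
    rcases p with p | p <;> simp only [simple] <;> split_ifs <;> simp_all [Fin.ext_iff]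
  planar p q := by
    rcases simple_partner_cases i p with
      (⟨xp, yp, rfl, hp, _, _⟩ | ⟨xp, yp, rfl, hp, _, _⟩) |
      ⟨xp, rfl, hp, _, _⟩ | ⟨xp, rfl, hp, _, _⟩ <;>
    rcases simple_partner_cases i q with
      (⟨xq, yq, rfl, hq, _, _⟩ | ⟨xq, yq, rfl, hq, _, _⟩) |
      ⟨xq, rfl, hq, _, _⟩ | ⟨xq, rfl, hq, _, _⟩ <;>
    simp only [hp, hq, posL] <;> omega
  word_partner p := by
    have key : ((simple i).partner p).elim id id = i.castSucc ∨
        ((simple i).partner p).elim id id = i.succ ↔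
        p.elim id id = i.castSucc ∨ p.elim id id = i.succ := by
      rcases simple_partner_cases i p with
        (⟨x, y, rfl, hp, _, _⟩ | ⟨x, y, rfl, hp, _, _⟩) | ⟨x, rfl, hp, _, _⟩ | ⟨x, rfl, hp, _, _⟩ <;>
      simp only [hp, Sum.elim_inl, Sum.elim_inr, id, Fin.ext_iff, Fin.val_castSucc,
        Fin.val_succ] <;>
      omega
    have h1 : (simple i).word ((simple i).partner p) = (simple i).word p := by
      show (if _ then _ else _) = (if _ then _ else _)
      simp only [key]
    rw [h1]
    simp only [simple]
    split_ifs <;> rfl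
  closed_exposed p x hx hc q := by
    obtain ⟨hp, ⟨h0, rfl⟩ | ⟨h0, h1, rfl⟩⟩ := simple_mem_word hx
    · clear hx hc
      rcases simple_partner_cases i p with
        (⟨xp, yp, rfl, hp', _, _⟩ | ⟨xp, yp, rfl, hp', _, _⟩) |
        ⟨xp, rfl, hp', _, _⟩ | ⟨xp, rfl, hp', _, _⟩ <;>
      rcases simple_partner_cases i q with
        (⟨xq, yq, rfl, hq, _, _⟩ | ⟨xq, yq, rfl, hq, _, _⟩) |
        ⟨xq, rfl, hq, _, _⟩ | ⟨xq, rfl, hq, _, _⟩ <;>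
      simp only [hp', hq, posL, Sum.elim_inl, Sum.elim_inr, id, Fin.ext_iff, Fin.val_castSucc,
        Fin.val_succ] at hp ⊢ <;>
      omega
    · simp [Deco.isClosed] at hc
  open_exposed p x hx hc q := by
    obtain ⟨hp, ⟨h0, rfl⟩ | ⟨h0, h1, rfl⟩⟩ := simple_mem_word hx
    · simp [Deco.isOpen, Deco.isClosed] at hc
    · clear hx hc
      rcases simple_partner_cases i p with
        (⟨xp, yp, rfl, hp', _, _⟩ | ⟨xp, yp, rfl, hp', _, _⟩) |
        ⟨xp, rfl, hp', _, _⟩ | ⟨xp, rfl, hp', _, _⟩ <;>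
      rcases simple_partner_cases i q with
        (⟨xq, yq, rfl, hq, _, _⟩ | ⟨xq, yq, rfl, hq, _, _⟩) |
        ⟨xq, rfl, hq, _, _⟩ | ⟨xq, rfl, hq, _, _⟩ <;>
      simp only [hp', hq, posR, Sum.elim_inl, Sum.elim_inr, id, Fin.ext_iff, Fin.val_castSucc,
        Fin.val_succ] at hp ⊢ <;>
      omega
  north_sorted _ := closedBeforeOpen_of_uniform fun x hx => by
    obtain ⟨p, hp⟩ := mem_northWord hx
    exact simple_uniform hp
  south_sorted _ := closedBeforeOpen_of_uniform fun x hx => by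
    obtain ⟨p, hp⟩ := mem_southWord hx
    exact simple_uniform hp
  loops_undammed _ L hL := by simp [simple] at hL
  loops_dammed _ L hL := by simp [simple] at hL
  vert_nil _ := rfl
  vert_left _ x y h _ := by rw [simple_prop_word i h]; rfl
  vert_right _ x y h _ := by rw [simple_prop_word i h]; rfl
  undecorated h := absurd h (simple_aValue_ne i)

end PreDiagram

/-- The identity diagram as an LR-decorated diagram. -/
def LRDiagram.identity (n : ℕ) : LRDiagram n :=
  ⟨PreDiagram.identity (n + 2), PreDiagram.identity_isLR (n + 2)⟩

/-- The simple diagram `d_{i+1}`, for `0 ≤ i ≤ n`, as an LR-decorated diagram: its non-propagating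
edges join the nodes `i + 1` and `i + 2` in both faces and carry one closed circle if `i = 0`, one
open circle if `i = n`, and nothing otherwise; all other edges are vertical and undecorated. -/
def LRDiagram.simple {n : ℕ} (i : Fin (n + 1)) : LRDiagram n :=
  ⟨PreDiagram.simple i, PreDiagram.simple_isLR i⟩

/-- The relations defining the quotient algebra: the product of two diagrams is their
concatenation, and the decoration and loop relations hold. -/
inductive Rel (n : ℕ) : FreeAlgebra ℤ[X] (LRDiagram n) → FreeAlgebra ℤ[X] (LRDiagram n) → Prop
  | concat (a b c : LRDiagram n) (h : PreDiagram.IsConcat a.1 b.1 c.1) :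
      Rel n (FreeAlgebra.ι ℤ[X] a * FreeAlgebra.ι ℤ[X] b) (FreeAlgebra.ι ℤ[X] c)
  | one : Rel n (FreeAlgebra.ι ℤ[X] (LRDiagram.identity n)) 1
  | edge (a b : LRDiagram n) (c : ℤ[X]) (h : PreDiagram.EdgeReduces a.1 c b.1) :
      Rel n (FreeAlgebra.ι ℤ[X] a) (c • FreeAlgebra.ι ℤ[X] b)
  | loop (a b : LRDiagram n) (c : ℤ[X]) (h : PreDiagram.LoopReduces a.1 c b.1) :
      Rel n (FreeAlgebra.ι ℤ[X] a) (c • FreeAlgebra.ι ℤ[X] b)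
  | removal (a b : LRDiagram n) (h : PreDiagram.LoopRemoval a.1 b.1) :
      Rel n (FreeAlgebra.ι ℤ[X] a) ((X : ℤ[X]) • FreeAlgebra.ι ℤ[X] b)

/-- The algebra of LR-decorated `(n + 2)`-diagrams over `ℤ[δ]` (`δ = X`) modulo the decoration and
loop relations. Since concatenation is an associative operation on LR-decorated diagrams, the free
algebra on these diagrams modulo the relations `concat` and `one` is the algebra with basis the
LR-decorated diagrams and multiplication given by concatenation. -/
abbrev QuotientAlgebra (n : ℕ) : Type := RingQuot (Rel n)

/-- The element of the quotient algebra given by an LR-decorated diagram. -/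
noncomputable def diagram {n : ℕ} (d : LRDiagram n) : QuotientAlgebra n :=
  RingQuot.mkAlgHom ℤ[X] (Rel n) (FreeAlgebra.ι ℤ[X] d)

/-- The diagram algebra `𝔻ₙ`: the unital subalgebra generated by the simple diagrams. -/
noncomputable def simpleAlgebra (n : ℕ) : Subalgebra ℤ[X] (QuotientAlgebra n) :=
  Algebra.adjoin ℤ[X] (Set.range fun i : Fin (n + 1) => diagram (LRDiagram.simple i))

/-! ## Admissible diagrams -/

namespace PreDiagram

variable {k n : ℕ}

/-- All maximal blocks of the edges that are not loops are basis elements of the decoration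
algebra. -/
def Reduced (d : PreDiagram k) : Prop :=
  (∀ p, ¬ (d.aValue = 1 ∧ d.IsProp p) → Alternating (d.word p)) ∧ Alternating d.vert

/-- The two ends of a diagram: `left` is decorated by closed symbols, `right` by open symbols. -/
inductive Side where
  | left : Side
  | right : Side

/-- The `(i+1)`-st node counted from the given end. -/
def Side.idx : Side → Fin (n + 2) → Fin (n + 2)
  | .left, i => i
  | .right, i => i.rev

/-- The circle of the given end. -/
def Side.circ : Side → Deco
  | .left => .dot
  | .right => .odot

/-- The triangle of the given end. -/
def Side.trig : Side → Deco
  | .left => .tri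
  | .right => .otri

/-- The nodes `1` and `1'` (`n + 2` and `(n + 2)'`). -/
def Corner (s : Side) (p : Node (n + 2)) : Prop :=
  p = Sum.inl (s.idx 0) ∨ p = Sum.inr (s.idx 0)

/-- The edge at `p` ends at the node `1` or `1'` (`n + 2` or `(n + 2)'`). -/
def AtCorner (d : PreDiagram (n + 2)) (s : Side) (p : Node (n + 2)) : Prop :=
  Corner s p ∨ Corner s (d.partner p)

/-- Axiom on loops: all loops carry exactly one closed and one open triangle. -/
def LoopAxiom (d : PreDiagram (n + 2)) : Prop := ∀ L ∈ d.loops, L = loopOf [.tri, .otri]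

/-- Axiom for undammed diagrams, at the end `s`. -/
def UndammedAxiom (d : PreDiagram (n + 2)) (s : Side) : Prop :=
  (∀ p, Corner s p → ∃ w, d.word p = s.circ :: w ∧ s.circ ∉ w) ∧
  ∀ p, ¬ d.AtCorner s p → s.circ ∉ d.word p

/-- Non-propagating edges carry a single circle if they end at a corner, and no circle otherwise. -/
def NonPropCondition (d : PreDiagram (n + 2)) (s : Side) : Prop :=
  (∀ p, Corner s p → ¬ d.IsProp p → d.word p = [s.circ]) ∧
  ∀ p, ¬ d.IsProp p → ¬ d.AtCorner s p → s.circ ∉ d.word p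

/-- The circle at the end of a propagating edge if this end is a corner. -/
def cornerMark (i : Fin (n + 2)) : List Deco :=
  if i = 0 then [.dot] else if i = Fin.last (n + 1) then [.odot] else []

/-- Axiom for diagrams with exactly one propagating edge. Apart from this edge being vertical
at a corner and undecorated or decorated by a single triangle, it carries a sequence of triangles,
extended by a circle at each end that is a corner. -/
def OnePropAxiom (d : PreDiagram (n + 2)) : Prop :=
  (∀ s, d.NonPropCondition s) ∧
  ∀ i j, d.partner (Sum.inl i) = Sum.inr j →
    (∃ m, d.word (Sum.inl i) = cornerMark i ++ m ++ cornerMark j ∧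
      ∀ x ∈ m, x = Deco.tri ∨ x = Deco.otri) ∨
    ∃ s : Side, i = s.idx 0 ∧ j = s.idx 0 ∧
      (d.word (Sum.inl i) = [] ∨ d.word (Sum.inl i) = [s.trig])

/-- Axiom for diagrams of `a`-value greater than `1` with more than one propagating edge, at
the end `s`. -/
def ManyPropAxiom (d : PreDiagram (n + 2)) (s : Side) : Prop :=
  (d.partner (Sum.inl (s.idx 0)) = Sum.inr (s.idx 0) →
    d.word (Sum.inl (s.idx 0)) = [] ∨ d.word (Sum.inl (s.idx 0)) = [s.trig]) ∧
  (d.partner (Sum.inl (s.idx 0)) ≠ Sum.inr (s.idx 0) →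
    d.word (Sum.inl (s.idx 0)) = [s.circ] ∧ d.word (Sum.inr (s.idx 0)) = [s.circ]) ∧
  ∀ p, ¬ d.AtCorner s p → s.circ ∉ d.word p

/-- Axiom for diagrams of `a`-value `1`, at the end `s`. In the comments the nodes are those
of the western end. -/
inductive OneCapAxiom (d : PreDiagram (n + 2)) (s : Side) : Prop
  /-- the edge from `1` to `1'` carries triangles only -/
  | vertical (h : d.partner (Sum.inl (s.idx 0)) = Sum.inr (s.idx 0))
      (hw : ∀ x ∈ d.word (Sum.inl (s.idx 0)), x = s.trig)
  /-- edges `1 - 2`, `1' - 2'`, `3 - 3'`; the last one has at most one triangle, and there are no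
  decorations of the other type on the diagram -/
  | plain (h : d.partner (Sum.inl (s.idx 0)) = Sum.inl (s.idx 1))
      (h' : d.partner (Sum.inr (s.idx 0)) = Sum.inr (s.idx 1))
      (hw : d.word (Sum.inl (s.idx 2)) = [] ∨ d.word (Sum.inl (s.idx 2)) = [s.trig])
      (ho : ∀ p, ∀ x ∈ d.word p, x.isClosed = s.circ.isClosed)
  /-- edges `1 - 2`, `1' - 2'`, `3 - 3'`; the last one carries a circle at the top and one at the
  bottom, and triangles in between -/
  | both (m : ℕ) (h : d.partner (Sum.inl (s.idx 0)) = Sum.inl (s.idx 1))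
      (h' : d.partner (Sum.inr (s.idx 0)) = Sum.inr (s.idx 1))
      (hw : d.word (Sum.inl (s.idx 2)) = s.circ :: List.replicate m s.trig ++ [s.circ])
      (ht : d.vert.head? = some s.circ) (hb : d.vert.getLast? = some s.circ)
  /-- edges `1 - 2` and `3 - 1'`; the latter carries a circle at the top, then triangles -/
  | top (m : ℕ) (h : d.partner (Sum.inl (s.idx 0)) = Sum.inl (s.idx 1))
      (h' : d.partner (Sum.inl (s.idx 2)) = Sum.inr (s.idx 0))
      (hw : d.word (Sum.inl (s.idx 2)) = s.circ :: List.replicate m s.trig)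
      (ht : d.vert.head? = some s.circ)
  /-- edges `1' - 2'` and `1 - 3'`; the latter carries triangles, then a circle at the bottom -/
  | bottom (m : ℕ) (h : d.partner (Sum.inr (s.idx 0)) = Sum.inr (s.idx 1))
      (h' : d.partner (Sum.inl (s.idx 0)) = Sum.inr (s.idx 2))
      (hw : d.word (Sum.inl (s.idx 0)) = List.replicate m s.trig ++ [s.circ])
      (hb : d.vert.getLast? = some s.circ)

end PreDiagram

/-- `d` is an admissible diagram: an LR-decorated diagram whose maximal blocks are basis elements of
the decoration algebra and which satisfies the axioms above. -/
structure IsAdmissible {n : ℕ} (d : LRDiagram n) : Prop where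
  reduced : d.1.Reduced
  loops : d.1.LoopAxiom
  undammed : d.1.propCount = 0 → ∀ s, d.1.UndammedAxiom s
  oneProp : d.1.propCount = 1 → d.1.OnePropAxiom
  manyProp : 1 < d.1.aValue → 1 < d.1.propCount → ∀ s, d.1.ManyPropAxiom s
  oneCap : d.1.aValue = 1 → ∀ s, d.1.NonPropCondition s ∧ d.1.OneCapAxiom s

end AffineCDiagram

/-!
Nodes are numbered from `0`, and only relations with coefficient `1` are needed, namely `•• = ▲` and
`∘∘ = △`. Every triangle may be replaced by two circles of its type, and a diagram may be replaced
by the one in which all triangles are split (`IsLR.exists_expands`). A word in circles is read as a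
walk: cut the box into the column at the left wall, the column at the right wall and the zone
between them, and let a closed circle stand for a passage between the left column and the middle
zone, an open circle for a passage between the middle zone and the right column. The axioms of
admissibility say that the word of an edge is a walk from the zone of its first node to the zone of
its last node, that a non-propagating edge touches each wall at most twice, and, for diagrams with a
single non-propagating edge in each face, that instead of the single propagating edges the
decorations on all of them together are a walk, between the positions of the two non-propagating
edges. Such diagrams are called `Taut`; `isProduct_of_isAdmissible` shows that the expansion of an
admissible diagram is taut.

The class of taut diagrams is stable under the following move (`Slide`): if `{i, i + 1}` is an edge
of the north face decorated as in a simple diagram `d`, and the edge at `i + 2` starts with a closed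
circle if `i = 0` and with an open one if `i + 2` is the last node, then the diagram is `d * a`,
where in `a` the edge `{i, i + 1}` has moved to `{i + 1, i + 2}` and the other edge has moved from
`i + 2` to `i`, losing that circle. No loop is formed and no relation is needed, so that `a` is
again LR-decorated (`Slide.isLR`) and taut (`Slide.taut`), and the diagram is a product of simple
diagrams if `a` is (`Slide.red`, `Red.isProduct`). With the mirror images of this move in the
vertical and the horizontal axis, both faces are flattened, that is, all non-propagating edges are
made to join neighbouring nodes (`Taut.exists_flat`). Then an edge with a surplus circle is pulled
to the wall in question, where it loses the circle (`Taut.exists_excess_lt`). When there is no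
surplus left, the propagating edges are undecorated, and the non-propagating edges are decorated as
in simple diagrams (`Taut.exists_reduced`, `Taut.clean`).

A diagram of this kind without loops is a product of simple diagrams (`Clean.isProduct`): the
rightmost non-propagating edges of both faces are moved on top of each other, and the pair is the
product of a simple diagram and a pair of vertical edges; this is repeated to the left. A loop
carries one triangle of each type, so it exists in undammed diagrams only. It splits off at the left
wall: a loop with the word `••∘∘` next to an edge `{0, 1}` carrying `•` is what the first simple
diagram makes of an edge `{0, 1}` carrying `•∘∘` (`splitLoop_isConcat`). The latter diagram is taut
and has one loop less, so induction applies (`Taut.isProduct`).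
-/

namespace AffineCDiagram

/-! ### Circle words as walks between the two walls -/

/-- The three zones of the box met by a curve: the column at the left wall, the column at the right
wall, and everything between them. -/
inductive Zone where
  | L : Zone
  | M : Zone
  | R : Zone
  deriving DecidableEq

/-- `Walk s w t`: the word `w` of circles leads from the zone `s` to the zone `t`, where a closed
circle is a passage between the left column and the middle, and an open circle is a passage between
the middle and the right column. In particular `w` contains no triangles. -/
inductive Walk : Zone → List Deco → Zone → Prop
  | nil (s : Zone) : Walk s [] s
  | dotL {w : List Deco} {s : Zone} (h : Walk .M w s) : Walk .L (.dot :: w) s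
  | dotM {w : List Deco} {s : Zone} (h : Walk .L w s) : Walk .M (.dot :: w) s
  | odotM {w : List Deco} {s : Zone} (h : Walk .R w s) : Walk .M (.odot :: w) s
  | odotR {w : List Deco} {s : Zone} (h : Walk .M w s) : Walk .R (.odot :: w) s

namespace Walk

theorem nil_iff {s t : Zone} : Walk s [] t ↔ s = t :=
  ⟨fun h => by cases h; rfl, fun h => h ▸ .nil s⟩

theorem append {s t r : Zone} {u v : List Deco} (h : Walk s u t) (h' : Walk t v r) :
    Walk s (u ++ v) r := by
  induction h with
  | nil => exact h'
  | dotL _ ih => exact .dotL (ih h')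
  | dotM _ ih => exact .dotM (ih h')
  | odotM _ ih => exact .odotM (ih h')
  | odotR _ ih => exact .odotR (ih h')

theorem reverse {s t : Zone} {u : List Deco} (h : Walk s u t) : Walk t u.reverse s := by
  induction h with
  | nil => exact .nil _
  | dotL _ ih => rw [List.reverse_cons]; exact ih.append (.dotM (.nil _))
  | dotM _ ih => rw [List.reverse_cons]; exact ih.append (.dotL (.nil _))
  | odotM _ ih => rw [List.reverse_cons]; exact ih.append (.odotR (.nil _))
  | odotR _ ih => rw [List.reverse_cons]; exact ih.append (.odotM (.nil _))

/-- The parity of the number of closed circles tells whether exactly one end is in the left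
column. -/
theorem count_dot {s t : Zone} {u : List Deco} (h : Walk s u t) :
    Even (u.count .dot) ↔ (s = .L ↔ t = .L) := by
  induction h with
  | nil => simp
  | dotL _ ih => simp [Nat.even_add_one, ih]
  | dotM _ ih => simp [Nat.even_add_one, ih]
  | odotM _ ih => simp [ih]
  | odotR _ ih => simp [ih]

theorem count_odot {s t : Zone} {u : List Deco} (h : Walk s u t) :
    Even (u.count .odot) ↔ (s = .R ↔ t = .R) := by
  induction h with
  | nil => simp
  | dotL _ ih => simp [ih]
  | dotM _ ih => simp [ih]
  | odotM _ ih => simp [Nat.even_add_one, ih]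
  | odotR _ ih => simp [Nat.even_add_one, ih]

theorem eq_nil_of_count {s t : Zone} {u : List Deco} (h : Walk s u t) (h1 : u.count .dot = 0)
    (h2 : u.count .odot = 0) : u = [] := by
  cases h <;> simp at h1 h2 ⊢

theorem mem {s t : Zone} {u : List Deco} (h : Walk s u t) :
    ∀ x ∈ u, x = Deco.dot ∨ x = Deco.odot := by
  induction h <;> simp_all

theorem dot_cons {t : Zone} {s : Zone} {u : List Deco} (h : Walk s (.dot :: u) t) :
    (s = .L ∧ Walk .M u t) ∨ (s = .M ∧ Walk .L u t) := by
  cases h <;> simp_all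

theorem odot_cons {t : Zone} {s : Zone} {u : List Deco} (h : Walk s (.odot :: u) t) :
    (s = .R ∧ Walk .M u t) ∨ (s = .M ∧ Walk .R u t) := by
  cases h <;> simp_all

end Walk

namespace PreDiagram

/-! ### Positions on the boundary -/

section positions

variable {k : ℕ}

theorem posL_lt (p : Node k) : posL p < 2 * k := by
  rcases p with ⟨x, hx⟩ | ⟨x, hx⟩ <;> simp only [posL] <;> omega

theorem posL_inj {p q : Node k} (h : posL p = posL q) : p = q := by
  rcases p with ⟨x, hx⟩ | ⟨x, hx⟩ <;> rcases q with ⟨y, hy⟩ | ⟨y, hy⟩ <;>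
    simp only [posL] at h <;> simp <;> omega

theorem posL_ne {p q : Node k} (h : p ≠ q) : posL p ≠ posL q := fun e => h (posL_inj e)

theorem posR_eq (p : Node k) :
    (posL p < k ∧ posR p + posL p + 1 = k) ∨ (k ≤ posL p ∧ posR p + posL p + 1 = 3 * k) := by
  rcases p with ⟨x, hx⟩ | ⟨x, hx⟩ <;> simp only [posL, posR] <;> omega

end positions

/-! ### The number of propagating edges -/

section counts

variable {k : ℕ} {d : PreDiagram k}

theorem isProp_inl {x : Fin k} : d.IsProp (Sum.inl x) ↔ ∃ j, d.partner (Sum.inl x) = Sum.inr j := by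
  rw [IsProp]
  rcases h : d.partner (Sum.inl x) <;> simp

theorem isProp_inr {x : Fin k} : d.IsProp (Sum.inr x) ↔ ∃ j, d.partner (Sum.inr x) = Sum.inl j := by
  rw [IsProp]
  rcases h : d.partner (Sum.inr x) <;> simp

theorem not_isProp_inl {x : Fin k} :
    ¬ d.IsProp (Sum.inl x) ↔ ∃ j, d.partner (Sum.inl x) = Sum.inl j := by
  rw [IsProp]
  rcases h : d.partner (Sum.inl x) <;> simp

theorem not_isProp_inr {x : Fin k} :
    ¬ d.IsProp (Sum.inr x) ↔ ∃ j, d.partner (Sum.inr x) = Sum.inr j := by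
  rw [IsProp]
  rcases h : d.partner (Sum.inr x) <;> simp

theorem isProp_partner (h : ∀ p, d.partner (d.partner p) = p) (p : Node k) :
    d.IsProp (d.partner p) ↔ d.IsProp p := by
  rw [IsProp, IsProp, h, ne_comm]

open Classical in
theorem propCount_eq : d.propCount = (Finset.univ.filter fun i => d.IsProp (Sum.inl i)).card := by
  simp only [propCount, isProp_inl]

open Classical in
theorem propCount_eq_south (h : ∀ p, d.partner (d.partner p) = p) :
    d.propCount = (Finset.univ.filter fun i => d.IsProp (Sum.inr i)).card := by
  rw [propCount_eq]
  refine Finset.card_bij' (fun i _ => (d.partner (Sum.inl i)).elim id id)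
    (fun i _ => (d.partner (Sum.inr i)).elim id id) ?_ ?_ ?_ ?_
  all_goals
    intro i hi
    simp only [Finset.mem_filter, Finset.mem_univ, true_and] at hi ⊢
  · obtain ⟨j, hj⟩ := isProp_inl.1 hi
    rw [hj]
    exact isProp_inr.2 ⟨i, by rw [Sum.elim_inr, id, ← hj, h]⟩
  · obtain ⟨j, hj⟩ := isProp_inr.1 hi
    rw [hj]
    exact isProp_inl.2 ⟨i, by rw [Sum.elim_inl, id, ← hj, h]⟩
  · obtain ⟨j, hj⟩ := isProp_inl.1 hi
    have := h (Sum.inl i)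
    rw [hj] at this
    simp [hj, this]
  · obtain ⟨j, hj⟩ := isProp_inr.1 hi
    have := h (Sum.inr i)
    rw [hj] at this
    simp [hj, this]

theorem propCount_eq_zero : d.propCount = 0 ↔ ∀ x, ¬ d.IsProp (Sum.inl x) := by
  classical
  rw [propCount_eq, Finset.card_eq_zero, Finset.filter_eq_empty_iff]
  simp

theorem not_isProp_of_propCount (h : ∀ p, d.partner (d.partner p) = p) (h0 : d.propCount = 0)
    (p : Node k) : ¬ d.IsProp p := by
  rcases p with x | x
  · exact propCount_eq_zero.1 h0 x
  · intro hx
    obtain ⟨j, hj⟩ := isProp_inr.1 hx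
    have := (isProp_partner h (Sum.inr x)).2 hx
    rw [hj] at this
    exact propCount_eq_zero.1 h0 j this

/-- Every north node is a left end or a right end of a non-propagating edge, or it propagates. -/
theorem two_mul_aValue_add (h : ∀ p, d.partner (d.partner p) = p) (hne : ∀ p, d.partner p ≠ p) :
    2 * d.aValue + d.propCount = k := by
  classical
  set A := Finset.univ.filter fun i : Fin k => ∃ j, d.partner (Sum.inl i) = Sum.inl j ∧ i < j
  set B := Finset.univ.filter fun i : Fin k => ∃ j, d.partner (Sum.inl i) = Sum.inl j ∧ j < i
  set C := Finset.univ.filter fun i : Fin k => ∃ j, d.partner (Sum.inl i) = Sum.inr j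
  have hA : d.aValue = A.card := by
    rw [aValue]
  have hC : d.propCount = C.card := by
    rw [propCount]
  have hAB : A.card = B.card := by
    refine Finset.card_bij' (fun i _ => (d.partner (Sum.inl i)).elim id id)
      (fun i _ => (d.partner (Sum.inl i)).elim id id) ?_ ?_ ?_ ?_ <;>
    · intro i hi
      simp only [A, B, Finset.mem_filter, Finset.mem_univ, true_and] at hi ⊢
      obtain ⟨j, hj, hl⟩ := hi
      have h2 := h (Sum.inl i)
      rw [hj] at h2
      simp [hj, h2, hl]
  have hABd : Disjoint A B := by
    rw [Finset.disjoint_left]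
    intro i hi hi'
    simp only [A, B, Finset.mem_filter, Finset.mem_univ, true_and] at hi hi'
    obtain ⟨j, hj, hl⟩ := hi
    obtain ⟨j', hj', hl'⟩ := hi'
    rw [hj] at hj'
    cases hj'
    exact absurd hl (by omega)
  have hABCd : Disjoint (A ∪ B) C := by
    rw [Finset.disjoint_left]
    intro i hi hi'
    simp only [A, B, C, Finset.mem_union, Finset.mem_filter, Finset.mem_univ, true_and] at hi hi'
    obtain ⟨j', hj'⟩ := hi'
    rcases hi with ⟨j, hj, _⟩ | ⟨j, hj, _⟩ <;> simp [hj] at hj'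
  have hU : A ∪ B ∪ C = Finset.univ := by
    ext i
    simp only [A, B, C, Finset.mem_union, Finset.mem_filter, Finset.mem_univ, true_and, iff_true]
    rcases hi : d.partner (Sum.inl i) with j | j
    · left
      have : i ≠ j := fun e => hne (Sum.inl i) (by rw [hi, e])
      rcases lt_or_gt_of_ne this with hl | hl
      · exact Or.inl ⟨j, rfl, hl⟩
      · exact Or.inr ⟨j, rfl, hl⟩
    · exact Or.inr ⟨j, rfl⟩
  have := congrArg Finset.card hU
  rw [Finset.card_union_of_disjoint hABCd, Finset.card_union_of_disjoint hABd,
    Finset.card_univ, Fintype.card_fin] at this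
  omega

/-- Two north edges that do not propagate force the `a`-value to be at least `2`. -/
theorem aValue_ne_one_of_two {x y x' y' : Fin k} (h : d.partner (Sum.inl x) = Sum.inl x')
    (h' : d.partner (Sum.inl y) = Sum.inl y') (hx : x < x') (hy : y < y') (hxy : x ≠ y) :
    d.aValue ≠ 1 := by
  classical
  intro ha
  rw [aValue, Finset.card_eq_one] at ha
  obtain ⟨z, hz⟩ := ha
  have h1 : x ∈ ({z} : Finset (Fin k)) := by
    rw [← hz]; simp only [Finset.mem_filter, Finset.mem_univ, true_and]; exact ⟨x', h, hx⟩
  have h2 : y ∈ ({z} : Finset (Fin k)) := by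
    rw [← hz]; simp only [Finset.mem_filter, Finset.mem_univ, true_and]; exact ⟨y', h', hy⟩
  rw [Finset.mem_singleton] at h1 h2
  exact hxy (h1.trans h2.symm)

end counts

/-! ### Sorted faces -/

section sorted

variable {k : ℕ}

theorem closedBeforeOpen_flatMap_finRange {f : Fin k → List Deco} :
    ClosedBeforeOpen ((List.finRange k).flatMap f) ↔
      (∀ i, ClosedBeforeOpen (f i)) ∧
        ∀ i j, i < j → ∀ x ∈ f i, ∀ y ∈ f j, x.isOpen = true → y.isOpen = true := by
  rw [ClosedBeforeOpen, List.pairwise_flatMap]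
  refine and_congr (by simp [ClosedBeforeOpen]) ?_
  rw [List.pairwise_iff_getElem]
  constructor
  · intro h i j hij
    have := h i j (by simp) (by simp) hij
    simpa using this
  · intro h i j hi hj hij
    exact h _ _ (by simpa using hij)

/-- The word of the non-propagating edge of the north face with left end `i`, if there is one. -/
def leftWord (d : PreDiagram k) (i : Fin k) : List Deco :=
  match d.partner (Sum.inl i) with
  | Sum.inl j => if i < j then d.word (Sum.inl i) else []
  | Sum.inr _ => []

theorem mem_leftWord {d : PreDiagram k} {i : Fin k} {x : Deco} :
    x ∈ d.leftWord i ↔ ∃ j, d.partner (Sum.inl i) = Sum.inl j ∧ i < j ∧ x ∈ d.word (Sum.inl i) := by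
  rw [leftWord]
  split
  · rename_i j hj
    split_ifs with h
    · exact ⟨fun hx => ⟨j, hj, h, hx⟩, fun ⟨_, _, _, hx⟩ => hx⟩
    · refine ⟨fun hx => by simp at hx, fun ⟨j', hj', hl, _⟩ => ?_⟩
      rw [hj] at hj'
      cases hj'
      exact absurd hl h
  · rename_i j hj
    simp [hj]

theorem northWord_sorted_iff {d : PreDiagram k} : ClosedBeforeOpen d.northWord ↔
    (∀ i j, d.partner (Sum.inl i) = Sum.inl j → i < j → ClosedBeforeOpen (d.word (Sum.inl i))) ∧
    ∀ i i' j j', d.partner (Sum.inl i) = Sum.inl i' → d.partner (Sum.inl j) = Sum.inl j' →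
      i < i' → j < j' → i < j → ∀ x ∈ d.word (Sum.inl i), ∀ y ∈ d.word (Sum.inl j),
      x.isOpen = true → y.isOpen = true := by
  have h0 : d.northWord = (List.finRange k).flatMap d.leftWord := rfl
  rw [h0, closedBeforeOpen_flatMap_finRange]
  constructor
  · rintro ⟨h1, h2⟩
    refine ⟨fun i j hij hl => ?_, fun i i' j j' hi hj hii hjj hij x hx y hy => ?_⟩
    · have := h1 i
      rw [leftWord, hij] at this
      simpa [hl] using this
    · exact h2 i j hij x (mem_leftWord.2 ⟨i', hi, hii, hx⟩) y (mem_leftWord.2 ⟨j', hj, hjj, hy⟩)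
  · rintro ⟨h1, h2⟩
    refine ⟨fun i => ?_, fun i j hij x hx y hy => ?_⟩
    · rw [leftWord]
      split
      · rename_i j hj
        split_ifs with h
        · exact h1 i j hj h
        · exact List.Pairwise.nil
      · exact List.Pairwise.nil
    · obtain ⟨i', hi, hii, hx⟩ := mem_leftWord.1 hx
      obtain ⟨j', hj, hjj, hy⟩ := mem_leftWord.1 hy
      exact h2 i i' j j' hi hj hii hjj hij x hx y hy

end sorted

/-! ### Products with a simple diagram -/

/-- The edges of `c` are those of the stack of `a` on top of `b`, and `c` has no other loops than
those of `a` and `b`. -/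
structure PlainConcat {k : ℕ} (a b c : PreDiagram k) : Prop where
  north : ∀ i, Trace a b (Sum.inl (Sum.inl i)) (c.partner (Sum.inl i)) (c.word (Sum.inl i))
  south : ∀ i, Trace a b (Sum.inr (Sum.inr i)) (c.partner (Sum.inr i)) (c.word (Sum.inr i))
  loops : c.loops = a.loops + b.loops
  vert : c.aValue = 1 → ∃ w, c.vert = a.vert ++ w ++ b.vert

theorem PlainConcat.isConcat {k : ℕ} {a b c : PreDiagram k} (h : PlainConcat a b c)
    (noLoop : ∀ m w, ¬ LoopTrace a b m m w) : IsConcat a b c where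
  north := h.north
  south := h.south
  loops := ⟨∅, fun _ => [], fun m => by simpa using noLoop m, by simp, by simp [h.loops]⟩
  vert := h.vert

/-- The decorations on the two non-propagating edges of the `(i + 1)`-st simple diagram. -/
def mark (n i : ℕ) : List Deco := if i = 0 then [.dot] else if i = n then [.odot] else []

theorem mark_reverse (n i : ℕ) : (mark n i).reverse = mark n i := by
  unfold mark; split_ifs <;> rfl

section simple

variable {n : ℕ} {i : ℕ} (hi : i < n + 1)

theorem simple_inl_left : (simple ⟨i, hi⟩ : PreDiagram (n + 2)).partner (Sum.inl ⟨i, by omega⟩) =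
    Sum.inl ⟨i + 1, by omega⟩ := by
  simp [simple]

theorem simple_inl_right : (simple ⟨i, hi⟩ : PreDiagram (n + 2)).partner
    (Sum.inl ⟨i + 1, by omega⟩) = Sum.inl ⟨i, by omega⟩ := by
  simp [simple]

theorem simple_inr_left : (simple ⟨i, hi⟩ : PreDiagram (n + 2)).partner (Sum.inr ⟨i, by omega⟩) =
    Sum.inr ⟨i + 1, by omega⟩ := by
  simp [simple]

theorem simple_inr_right : (simple ⟨i, hi⟩ : PreDiagram (n + 2)).partner
    (Sum.inr ⟨i + 1, by omega⟩) = Sum.inr ⟨i, by omega⟩ := by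
  simp [simple]

theorem simple_inl_of_ne {x : Fin (n + 2)} (h : x.val ≠ i) (h' : x.val ≠ i + 1) :
    (simple ⟨i, hi⟩ : PreDiagram (n + 2)).partner (Sum.inl x) = Sum.inr x := by
  simp [simple, Fin.ext_iff, h, h']

theorem simple_inr_of_ne {x : Fin (n + 2)} (h : x.val ≠ i) (h' : x.val ≠ i + 1) :
    (simple ⟨i, hi⟩ : PreDiagram (n + 2)).partner (Sum.inr x) = Sum.inl x := by
  simp [simple, Fin.ext_iff, h, h']

theorem simple_word_of_mem {p : Node (n + 2)}
    (h : (p.elim id id).val = i ∨ (p.elim id id).val = i + 1) :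
    (simple ⟨i, hi⟩ : PreDiagram (n + 2)).word p = mark n i := by
  simp only [simple, Fin.ext_iff, Fin.val_castSucc, Fin.val_succ, if_pos h, mark, Fin.val_zero,
    Fin.val_last]

theorem simple_word_of_ne {p : Node (n + 2)} (h : (p.elim id id).val ≠ i)
    (h' : (p.elim id id).val ≠ i + 1) :
    (simple ⟨i, hi⟩ : PreDiagram (n + 2)).word p = [] := by
  have : ¬ ((p.elim id id).val = i ∨ (p.elim id id).val = i + 1) := by omega
  simp only [simple, Fin.ext_iff, Fin.val_castSucc, Fin.val_succ, if_neg this]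

theorem simple_inl_pair {x y : Fin (n + 2)}
    (hxy : (x.val = i ∧ y.val = i + 1) ∨ (x.val = i + 1 ∧ y.val = i)) :
    (simple ⟨i, hi⟩ : PreDiagram (n + 2)).partner (Sum.inl x) = Sum.inl y := by
  obtain ⟨x, hx⟩ := x
  obtain ⟨y, hy⟩ := y
  rcases hxy with ⟨h1, h2⟩ | ⟨h1, h2⟩ <;> simp only at h1 h2 <;> subst h1 h2
  · exact simple_inl_left hi
  · exact simple_inl_right hi

theorem simple_inr_pair {x y : Fin (n + 2)}
    (hxy : (x.val = i ∧ y.val = i + 1) ∨ (x.val = i + 1 ∧ y.val = i)) :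
    (simple ⟨i, hi⟩ : PreDiagram (n + 2)).partner (Sum.inr x) = Sum.inr y := by
  obtain ⟨x, hx⟩ := x
  obtain ⟨y, hy⟩ := y
  rcases hxy with ⟨h1, h2⟩ | ⟨h1, h2⟩ <;> simp only at h1 h2 <;> subst h1 h2
  · exact simple_inr_left hi
  · exact simple_inr_right hi

/-- The end of an edge of `a`, continued through the simple diagram on top of `a`. -/
theorem trace_of_partner {a : PreDiagram (n + 2)} {p q : Node (n + 2)}
    (h : a.partner p = q)
    (hq : ∀ x, q = Sum.inl x → x.val ≠ i ∧ x.val ≠ i + 1) :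
    Trace (simple ⟨i, hi⟩) a (Sum.inr p) q (a.word p) := by
  rcases q with x | x
  · obtain ⟨h1, h2⟩ := hq x rfl
    have := Trace.up (b := a) h (Trace.top (simple_inr_of_ne hi h1 h2))
    rwa [simple_word_of_ne hi (by simpa using h1) (by simpa using h2), List.append_nil] at this
  · exact Trace.bottom h

/-- An edge of the stack that passes the south edge of the simple diagram on top of `a`, from its
end `x` to its end `y`. -/
theorem trace_through {a : PreDiagram (n + 2)} {p q : Node (n + 2)} {x y : Fin (n + 2)}
    (hxy : (x.val = i ∧ y.val = i + 1) ∨ (x.val = i + 1 ∧ y.val = i))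
    (h : a.partner p = Sum.inl x) (h' : a.partner (Sum.inl y) = q)
    (hq : ∀ x, q = Sum.inl x → x.val ≠ i ∧ x.val ≠ i + 1) :
    Trace (simple ⟨i, hi⟩) a (Sum.inr p) q (a.word p ++ mark n i ++ a.word (Sum.inl y)) := by
  have hs := simple_inr_pair hi hxy
  have := Trace.up (b := a) h (Trace.down hs (trace_of_partner hi h' hq))
  rwa [simple_word_of_mem hi (by simp; omega), ← List.append_assoc] at this

/-- Cutting an edge: `c` has the north edge of the simple diagram, and another edge `{u, v}` of `c`
is cut into the edges from `u` to `x` and from `y` to `v` of `a`, where `x` and `y` are the two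
nodes of that north edge. Then `c` is the simple diagram on top of `a`. -/
theorem plainConcat_cut {a c : PreDiagram (n + 2)} {u v : Node (n + 2)} {x y : Fin (n + 2)}
    {w : List Deco}
    (hxy : (x.val = i ∧ y.val = i + 1) ∨ (x.val = i + 1 ∧ y.val = i))
    (hcx : c.partner (Sum.inl x) = Sum.inl y) (hcy : c.partner (Sum.inl y) = Sum.inl x)
    (hwx : c.word (Sum.inl x) = mark n i) (hwy : c.word (Sum.inl y) = mark n i)
    (hcu : c.partner u = v) (hcv : c.partner v = u)
    (hux : u ≠ Sum.inl x) (huy : u ≠ Sum.inl y) (hvx : v ≠ Sum.inl x) (hvy : v ≠ Sum.inl y)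
    (hau : a.partner u = Sum.inl x) (hax : a.partner (Sum.inl x) = u)
    (hav : a.partner v = Sum.inl y) (hay : a.partner (Sum.inl y) = v)
    (hwu : c.word u = a.word u ++ mark n i ++ a.word (Sum.inl y))
    (hwv : c.word v = a.word v ++ mark n i ++ a.word (Sum.inl x))
    (hp : ∀ p, p ≠ u → p ≠ v → p ≠ Sum.inl x → p ≠ Sum.inl y →
      a.partner p = c.partner p ∧ a.word p = c.word p)
    (hcp : ∀ p, p ≠ Sum.inl x → p ≠ Sum.inl y → c.partner p ≠ Sum.inl x ∧ c.partner p ≠ Sum.inl y)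
    (hl : c.loops = a.loops) (hv : c.aValue = 1 → c.vert = w ++ a.vert) :
    PlainConcat (simple ⟨i, hi⟩) a c := by
  have hne : ∀ q : Node (n + 2), q ≠ Sum.inl x → q ≠ Sum.inl y →
      ∀ z, q = Sum.inl z → z.val ≠ i ∧ z.val ≠ i + 1 := by
    rintro q h1 h2 z rfl
    have h1 : z ≠ x := fun e => h1 (by rw [e])
    have h2 : z ≠ y := fun e => h2 (by rw [e])
    have := Fin.val_ne_of_ne h1
    have := Fin.val_ne_of_ne h2
    omega
  -- the curve of the stack that enters `a` at `p`
  have key : ∀ p, p ≠ Sum.inl x → p ≠ Sum.inl y →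
      Trace (simple ⟨i, hi⟩) a (Sum.inr p) (c.partner p) (c.word p) := by
    intro p hpx hpy
    by_cases hpu : p = u
    · subst hpu
      rw [hcu, hwu]
      exact trace_through hi hxy hau hay (hne _ hvx hvy)
    by_cases hpv : p = v
    · subst hpv
      rw [hcv, hwv]
      exact trace_through hi (by omega) hav hax (hne _ hux huy)
    obtain ⟨h1, h2⟩ := hp p hpu hpv hpx hpy
    rw [← h2]
    exact trace_of_partner hi h1 (hne _ (hcp p hpx hpy).1 (hcp p hpx hpy).2)
  refine ⟨fun z => ?_, fun z => key _ (by simp) (by simp), ?_, ?_⟩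
  · by_cases hz : Sum.inl z ≠ (Sum.inl x : Node (n + 2)) ∧ Sum.inl z ≠ (Sum.inl y : Node (n + 2))
    · obtain ⟨h1, h2⟩ := hne _ hz.1 hz.2 z rfl
      have := Trace.down (simple_inl_of_ne hi h1 h2) (key _ hz.1 hz.2)
      rwa [simple_word_of_ne hi (by simpa using h1) (by simpa using h2), List.nil_append] at this
    · have hs := simple_inl_pair hi hxy
      have hs' := simple_inl_pair hi (x := y) (y := x) (by omega)
      have hz : z = x ∨ z = y := by
        by_contra hcon
        push Not at hcon
        exact hz ⟨fun e => hcon.1 (Sum.inl_injective e), fun e => hcon.2 (Sum.inl_injective e)⟩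
      rcases hz with rfl | rfl
      · have := Trace.top (b := a) hs
        rwa [simple_word_of_mem hi (by simp; omega), ← hwx, ← hcx] at this
      · have := Trace.top (b := a) hs'
        rwa [simple_word_of_mem hi (by simp; omega), ← hwy, ← hcy] at this
  · simp [hl, simple]
  · intro h
    exact ⟨w, by simp [hv h, simple]⟩

theorem simple_inr_ends {z j : Fin (n + 2)}
    (h : (simple ⟨i, hi⟩ : PreDiagram (n + 2)).partner (Sum.inr z) = Sum.inr j) :
    (z.val = i ∧ j.val = i + 1) ∨ (z.val = i + 1 ∧ j.val = i) := by
  rcases simple_partner_inr (⟨i, hi⟩ : Fin (n + 1)) z with ⟨y, h1, h2, h3⟩ | ⟨h1, _⟩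
  · rw [h] at h1
    cases h1
    simp only at h2 h3
    omega
  · rw [h] at h1; simp at h1

theorem simple_inl_ends {z j : Fin (n + 2)}
    (h : (simple ⟨i, hi⟩ : PreDiagram (n + 2)).partner (Sum.inl z) = Sum.inl j) :
    (z.val = i ∧ j.val = i + 1) ∨ (z.val = i + 1 ∧ j.val = i) := by
  rcases simple_partner_inl (⟨i, hi⟩ : Fin (n + 1)) z with ⟨y, h1, h2, h3⟩ | ⟨h1, _⟩
  · rw [h] at h1
    cases h1
    simp only at h2 h3
    omega
  · rw [h] at h1; simp at h1

/-- A loop formed with a simple diagram on top of `a` passes the south edge of the simple diagram,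
so that it consists of this edge and an edge of `a`. -/
theorem no_loopTrace_top {a : PreDiagram (n + 2)} (ha : a.IsLR)
    (h : a.partner (Sum.inl ⟨i, by omega⟩) ≠ Sum.inl ⟨i + 1, by omega⟩) (m : Fin (n + 2))
    (w : List Deco) : ¬ LoopTrace (simple ⟨i, hi⟩) a m m w := by
  -- after the south edge of the simple diagram, the edge of `a` leads away from `i` and `i + 1`
  have hl : ∀ z j l, (simple ⟨i, hi⟩ : PreDiagram (n + 2)).partner (Sum.inr z) = Sum.inr j →
      a.partner (Sum.inl j) = Sum.inl l →
      (z.val = i ∨ z.val = i + 1) ∧ l.val ≠ i ∧ l.val ≠ i + 1 := by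
    intro z j l h1 h2
    have h3 := ha.partner_ne (Sum.inl j)
    have h4 := ha.partner_partner (Sum.inl j)
    rw [h2] at h3 h4
    have h3 := Fin.val_ne_of_ne fun e => h3 (congrArg Sum.inl e)
    rcases simple_inr_ends hi h1 with ⟨hz, hj⟩ | ⟨hz, hj⟩
    · refine ⟨Or.inl hz, fun e => h ?_, by omega⟩
      obtain ⟨j, _⟩ := j
      obtain ⟨l, _⟩ := l
      simp only at hj e
      subst hj e
      exact h4
    · refine ⟨Or.inr hz, by omega, fun e => h ?_⟩
      obtain ⟨j, _⟩ := j
      obtain ⟨l, _⟩ := l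
      simp only at hj e
      subst hj e
      exact h2
  have key : ∀ z v, LoopTrace (simple ⟨i, hi⟩) a m z v →
      (m.val = i ∨ m.val = i + 1) ∧ z.val ≠ i ∧ z.val ≠ i + 1 := by
    intro z v ht
    induction ht with
    | start h1 h2 => exact hl _ _ _ h1 h2
    | step _ _ h1 h2 _ _ ih => exact ⟨ih.1, (hl _ _ _ h1 h2).2⟩
  intro ht
  have := key m w ht
  omega

/-- A loop formed with a simple diagram below `a` consists of the north edge of the simple diagram
and an edge of `a`. -/
theorem no_loopTrace_bot {a : PreDiagram (n + 2)} (ha : a.IsLR)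
    (h : a.partner (Sum.inr ⟨i, by omega⟩) ≠ Sum.inr ⟨i + 1, by omega⟩) (m : Fin (n + 2))
    (w : List Deco) : ¬ LoopTrace a (simple ⟨i, hi⟩) m m w := by
  have hl : ∀ z j : Fin (n + 2), a.partner (Sum.inr z) = Sum.inr j →
      (j.val = i ∨ j.val = i + 1) → z.val ≠ i ∧ z.val ≠ i + 1 := by
    intro z j h1 hj
    have h3 := ha.partner_ne (Sum.inr z)
    have h4 := ha.partner_partner (Sum.inr z)
    rw [h1] at h3 h4
    have h3 := Fin.val_ne_of_ne fun e => h3 (congrArg Sum.inr e)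
    obtain ⟨j, _⟩ := j
    obtain ⟨z, _⟩ := z
    simp only at hj h3 ⊢
    rcases hj with hj | hj <;> subst hj
    · refine ⟨by omega, fun e => h ?_⟩
      subst e
      exact h4
    · refine ⟨fun e => h ?_, by omega⟩
      subst e
      exact h1
  have key : ∀ z v, LoopTrace a (simple ⟨i, hi⟩) m z v →
      (z.val = i ∨ z.val = i + 1) ∧ z.val ≠ m.val := by
    intro z v ht
    induction ht with
    | start h1 h2 =>
      have := simple_inl_ends hi h2
      have := hl _ _ h1 (by omega)
      omega
    | step _ _ h1 h2 _ _ ih =>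
      have := simple_inl_ends hi h2
      have := hl _ _ h1 (by omega)
      omega
  intro ht
  exact (key m w ht).2 rfl

end simple

/-! ### Reductions -/

section red

variable {n : ℕ}

/-- `c` is the product of `a` and a simple diagram in one of the two orders, and no loop is
formed. -/
def Step (c a : PreDiagram (n + 2)) : Prop :=
  c.IsLR ∧ a.IsLR ∧ ∃ i : Fin (n + 1),
    (PlainConcat (simple i) a c ∧ a.partner (Sum.inl i.castSucc) ≠ Sum.inl i.succ) ∨
    (PlainConcat a (simple i) c ∧ a.partner (Sum.inr i.castSucc) ≠ Sum.inr i.succ)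

/-- `c` is the product of some simple diagrams, `a`, and some simple diagrams, where no loops are
formed. -/
def Red : PreDiagram (n + 2) → PreDiagram (n + 2) → Prop := Relation.ReflTransGen Step

/-- The LR-decorated diagram `c` is a product of simple diagrams in the quotient algebra. -/
def IsProduct (c : PreDiagram (n + 2)) : Prop :=
  ∃ (h : c.IsLR) (l : List (Fin (n + 1))),
    diagram (⟨c, h⟩ : LRDiagram n) = (l.map fun i => diagram (LRDiagram.simple i)).prod

theorem diagram_mul {a b c : LRDiagram n} (h : IsConcat a.1 b.1 c.1) :
    diagram a * diagram b = diagram c := by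
  have := RingQuot.mkAlgHom_rel ℤ[X] (Rel.concat a b c h)
  rwa [map_mul] at this

theorem IsProduct.simple_mul {a c : PreDiagram (n + 2)} {i : Fin (n + 1)} (ha : a.IsProduct)
    (hc : c.IsLR) (h : IsConcat (simple i) a c) : c.IsProduct := by
  obtain ⟨ha', l, hl⟩ := ha
  refine ⟨hc, i :: l, ?_⟩
  rw [List.map_cons, List.prod_cons, ← hl]
  exact (diagram_mul (a := LRDiagram.simple i) (b := ⟨a, ha'⟩) (c := ⟨c, hc⟩) h).symm

theorem IsProduct.mul_simple {a c : PreDiagram (n + 2)} {i : Fin (n + 1)} (ha : a.IsProduct)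
    (hc : c.IsLR) (h : IsConcat a (simple i) c) : c.IsProduct := by
  obtain ⟨ha', l, hl⟩ := ha
  refine ⟨hc, l ++ [i], ?_⟩
  rw [List.map_append, List.prod_append, ← hl, List.map_singleton, List.prod_singleton]
  exact (diagram_mul (a := ⟨a, ha'⟩) (b := LRDiagram.simple i) (c := ⟨c, hc⟩) h).symm

theorem Red.isProduct {c a : PreDiagram (n + 2)} (h : Red c a) (ha : a.IsProduct) :
    c.IsProduct := by
  induction h using Relation.ReflTransGen.head_induction_on with
  | refl => exact ha
  | head h _ ih =>
    obtain ⟨hc, ha, ⟨i, hi⟩, ⟨h, h'⟩ | ⟨h, h'⟩⟩ := h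
    · exact ih.simple_mul hc (h.isConcat (no_loopTrace_top hi ha h'))
    · exact ih.mul_simple hc (h.isConcat (no_loopTrace_bot hi ha h'))

theorem identity_isProduct : (identity (n + 2)).IsProduct := by
  refine ⟨identity_isLR _, [], ?_⟩
  have := RingQuot.mkAlgHom_rel ℤ[X] (Rel.one (n := n))
  rw [map_one] at this
  exact this

end red

/-! ### Slides -/

section slide

variable {n : ℕ}

/-- The decorations that an edge loses in a slide: see `Slide`. -/
def shift (n i : ℕ) : List Deco := mark n (i + 1) ++ mark n i

/-- `c` has the north edge `{i, i + 1}` of a simple diagram, and `a` arises by moving this edge one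
step to the right to `{i + 1, i + 2}`, whereby the end `i + 2` of another edge moves to `i`. In
terms of the simple diagram `d` with the edge `{i, i + 1}`, one has `c = d * a`. If `{i, i + 1}` is
at the left wall, the moving edge loses a closed circle; if `{i + 1, i + 2}` is at the right wall,
it loses an open circle. -/
structure Slide (c a : PreDiagram (n + 2)) (i : ℕ) (hi : i + 2 < n + 2) (w : List Deco) : Prop where
  cup : c.partner (Sum.inl ⟨i, by omega⟩) = Sum.inl ⟨i + 1, by omega⟩
  cup_word : c.word (Sum.inl ⟨i, by omega⟩) = mark n i
  word : c.word (Sum.inl ⟨i + 2, hi⟩) = shift n i ++ w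
  partner_zero : a.partner (Sum.inl ⟨i, by omega⟩) = c.partner (Sum.inl ⟨i + 2, hi⟩)
  partner_far : a.partner (c.partner (Sum.inl ⟨i + 2, hi⟩)) = Sum.inl ⟨i, by omega⟩
  partner_one : a.partner (Sum.inl ⟨i + 1, by omega⟩) = Sum.inl ⟨i + 2, hi⟩
  partner_two : a.partner (Sum.inl ⟨i + 2, hi⟩) = Sum.inl ⟨i + 1, by omega⟩
  word_zero : a.word (Sum.inl ⟨i, by omega⟩) = w
  word_far : a.word (c.partner (Sum.inl ⟨i + 2, hi⟩)) = w.reverse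
  word_one : a.word (Sum.inl ⟨i + 1, by omega⟩) = mark n (i + 1)
  word_two : a.word (Sum.inl ⟨i + 2, hi⟩) = mark n (i + 1)
  other : ∀ p, p ≠ Sum.inl ⟨i, by omega⟩ → p ≠ Sum.inl ⟨i + 1, by omega⟩ →
    p ≠ Sum.inl ⟨i + 2, hi⟩ → p ≠ c.partner (Sum.inl ⟨i + 2, hi⟩) →
    a.partner p = c.partner p ∧ a.word p = c.word p
  loops : a.loops = c.loops
  vert : c.aValue = 1 → c.vert = shift n i ++ a.vert
  vert_nil : c.aValue ≠ 1 → a.vert = []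

theorem exists_slide {c : PreDiagram (n + 2)} {i : ℕ} {hi : i + 2 < n + 2} {w v : List Deco}
    (hc : c.IsLR)
    (cup : c.partner (Sum.inl ⟨i, by omega⟩) = Sum.inl ⟨i + 1, by omega⟩)
    (cup_word : c.word (Sum.inl ⟨i, by omega⟩) = mark n i)
    (word : c.word (Sum.inl ⟨i + 2, hi⟩) = shift n i ++ w)
    (vert : c.aValue = 1 → c.vert = shift n i ++ v) (vert_nil : c.aValue ≠ 1 → v = []) :
    ∃ a, Slide c a i hi w ∧ a.vert = v := by
  classical
  have h1 : c.partner (Sum.inl ⟨i + 2, hi⟩) ≠ Sum.inl ⟨i, by omega⟩ := fun e => by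
    have := hc.partner_partner (Sum.inl ⟨i + 2, hi⟩)
    rw [e, cup] at this
    simp at this
  have h2 : c.partner (Sum.inl ⟨i + 2, hi⟩) ≠ Sum.inl ⟨i + 1, by omega⟩ := fun e => by
    have h := hc.partner_partner (Sum.inl ⟨i + 2, hi⟩)
    have h' := hc.partner_partner (Sum.inl ⟨i, by omega⟩)
    rw [e] at h
    rw [cup, h] at h'
    simp at h'
  have h3 := hc.partner_ne (Sum.inl ⟨i + 2, hi⟩)
  refine ⟨{ partner := fun p =>
              if p = Sum.inl ⟨i, by omega⟩ then c.partner (Sum.inl ⟨i + 2, hi⟩)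
              else if p = Sum.inl ⟨i + 1, by omega⟩ then Sum.inl ⟨i + 2, hi⟩
              else if p = Sum.inl ⟨i + 2, hi⟩ then Sum.inl ⟨i + 1, by omega⟩
              else if p = c.partner (Sum.inl ⟨i + 2, hi⟩) then Sum.inl ⟨i, by omega⟩
              else c.partner p
            word := fun p =>
              if p = Sum.inl ⟨i, by omega⟩ then w
              else if p = Sum.inl ⟨i + 1, by omega⟩ then mark n (i + 1)
              else if p = Sum.inl ⟨i + 2, hi⟩ then mark n (i + 1)
              else if p = c.partner (Sum.inl ⟨i + 2, hi⟩) then w.reverse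
              else c.word p
            loops := c.loops
            vert := v }, ?_, rfl⟩
  constructor <;> try assumption
  all_goals (try simp [h1, h2, h3]; done)
  · intro p q1 q2 q3 q4
    simp [q1, q2, q3, q4]

/-- The four nodes whose edges are changed by a slide. -/
theorem slide_cases (c : PreDiagram (n + 2)) (i : ℕ) (hi : i + 2 < n + 2) (p : Node (n + 2)) :
    p = Sum.inl ⟨i, by omega⟩ ∨ p = Sum.inl ⟨i + 1, by omega⟩ ∨ p = Sum.inl ⟨i + 2, hi⟩ ∨
      p = c.partner (Sum.inl ⟨i + 2, hi⟩) ∨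
      (p ≠ Sum.inl ⟨i, by omega⟩ ∧ p ≠ Sum.inl ⟨i + 1, by omega⟩ ∧ p ≠ Sum.inl ⟨i + 2, hi⟩ ∧
        p ≠ c.partner (Sum.inl ⟨i + 2, hi⟩)) := by
  tauto

/-- A slide takes place at the left wall, away from the walls, or at the right wall; only for
`n = 1` can it touch both walls. -/
theorem shift_cases (n i : ℕ) (hi : i + 2 < n + 2) :
    (i = 0 ∧ i + 1 ≠ n ∧ shift n i = [.dot] ∧ mark n i = [.dot] ∧ mark n (i + 1) = []) ∨
    (i ≠ 0 ∧ i + 1 ≠ n ∧ shift n i = [] ∧ mark n i = [] ∧ mark n (i + 1) = []) ∨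
    (i ≠ 0 ∧ i + 1 = n ∧ shift n i = [.odot] ∧ mark n i = [] ∧ mark n (i + 1) = [.odot]) ∨
    (i = 0 ∧ n = 1) := by
  unfold shift mark
  by_cases h0 : i = 0 <;> by_cases h1 : i + 1 = n
  · right; right; right; omega
  · left; subst h0; simp at h1 ⊢; omega
  · right; right; left; refine ⟨h0, h1, ?_⟩; have : i ≠ n := by omega
    simp [h0, h1, this]; omega
  · right; left; refine ⟨h0, h1, ?_⟩; have : i ≠ n := by omega
    simp [h0, h1, this]

namespace Slide

variable {c a : PreDiagram (n + 2)} {i : ℕ} {hi : i + 2 < n + 2} {w : List Deco}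

theorem cup' (h : Slide c a i hi w) (hc : c.IsLR) :
    c.partner (Sum.inl ⟨i + 1, by omega⟩) = Sum.inl ⟨i, by omega⟩ := by
  rw [← h.cup, hc.partner_partner]

theorem cup_word' (h : Slide c a i hi w) (hc : c.IsLR) :
    c.word (Sum.inl ⟨i + 1, by omega⟩) = mark n i := by
  rw [← h.cup, hc.word_partner, h.cup_word, mark_reverse]

theorem far_ne (h : Slide c a i hi w) (hc : c.IsLR) :
    c.partner (Sum.inl ⟨i + 2, hi⟩) ≠ Sum.inl ⟨i, by omega⟩ ∧
    c.partner (Sum.inl ⟨i + 2, hi⟩) ≠ Sum.inl ⟨i + 1, by omega⟩ ∧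
    c.partner (Sum.inl ⟨i + 2, hi⟩) ≠ Sum.inl ⟨i + 2, hi⟩ := by
  refine ⟨fun e => ?_, fun e => ?_, hc.partner_ne _⟩
  · have := hc.partner_partner (Sum.inl ⟨i + 2, hi⟩)
    rw [e, h.cup] at this
    simp at this
  · have := hc.partner_partner (Sum.inl ⟨i + 2, hi⟩)
    rw [e, h.cup' hc] at this
    simp at this

/-- The other end of an edge not changed by the slide. -/
theorem other_partner (h : Slide c a i hi w) (hc : c.IsLR) {p : Node (n + 2)}
    (h0 : p ≠ Sum.inl ⟨i, by omega⟩) (h1 : p ≠ Sum.inl ⟨i + 1, by omega⟩)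
    (h2 : p ≠ Sum.inl ⟨i + 2, hi⟩) (h3 : p ≠ c.partner (Sum.inl ⟨i + 2, hi⟩)) :
    c.partner p ≠ Sum.inl ⟨i, by omega⟩ ∧ c.partner p ≠ Sum.inl ⟨i + 1, by omega⟩ ∧
      c.partner p ≠ Sum.inl ⟨i + 2, hi⟩ ∧ c.partner p ≠ c.partner (Sum.inl ⟨i + 2, hi⟩) := by
  have := hc.partner_partner p
  refine ⟨fun e => h1 ?_, fun e => h0 ?_, fun e => h3 ?_, fun e => h2 ?_⟩
  · rw [← this, e, h.cup]
  · rw [← this, e, h.cup' hc]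
  · rw [← this, e]
  · rw [← this, e, hc.partner_partner]

/-- The simple diagram cuts the edge at `i + 2` into the edge of `a` at `i` and the edge
`{i + 1, i + 2}` of `a`. -/
theorem plainConcat (h : Slide c a i hi w) (hc : c.IsLR) :
    PlainConcat (simple ⟨i, by omega⟩) a c := by
  obtain ⟨f0, f1, f2⟩ := h.far_ne hc
  refine plainConcat_cut (w := shift n i) (by omega) (u := Sum.inl ⟨i + 2, hi⟩)
    (x := ⟨i + 1, by omega⟩) (y := ⟨i, by omega⟩) (by simp) (h.cup' hc) h.cup
    (h.cup_word' hc) h.cup_word rfl (hc.partner_partner _) (by simp) (by simp) f1 f0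
    h.partner_two h.partner_one h.partner_far h.partner_zero ?_ ?_ ?_ ?_ h.loops.symm h.vert
  · rw [h.word_two, h.word_zero, h.word, shift]
  · rw [h.word_one, h.word_far, hc.word_partner, h.word, shift, List.reverse_append,
      List.reverse_append, mark_reverse, mark_reverse, List.append_assoc]
  · exact fun p h1 h2 h3 h4 => h.other p h4 h3 h1 h2
  · intro p h1 h2
    have := hc.partner_partner p
    refine ⟨fun e => h2 ?_, fun e => h1 ?_⟩
    · rw [← this, e, h.cup' hc]
    · rw [← this, e, h.cup]

theorem partner_partner (h : Slide c a i hi w) (hc : c.IsLR) (p : Node (n + 2)) :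
    a.partner (a.partner p) = p := by
  rcases slide_cases c i hi p with rfl | rfl | rfl | rfl | ⟨h0, h1, h2, h3⟩
  · rw [h.partner_zero, h.partner_far]
  · rw [h.partner_one, h.partner_two]
  · rw [h.partner_two, h.partner_one]
  · rw [h.partner_far, h.partner_zero]
  · obtain ⟨g0, g1, g2, g3⟩ := h.other_partner hc h0 h1 h2 h3
    rw [(h.other p h0 h1 h2 h3).1, (h.other _ g0 g1 g2 g3).1, hc.partner_partner]

theorem partner_ne (h : Slide c a i hi w) (hc : c.IsLR) (p : Node (n + 2)) :
    a.partner p ≠ p := by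
  obtain ⟨f0, f1, f2⟩ := h.far_ne hc
  rcases slide_cases c i hi p with rfl | rfl | rfl | rfl | ⟨h0, h1, h2, h3⟩
  · rw [h.partner_zero]; exact f0
  · rw [h.partner_one]; simp
  · rw [h.partner_two]; simp
  · rw [h.partner_far]; exact f0.symm
  · rw [(h.other p h0 h1 h2 h3).1]; exact hc.partner_ne p

theorem word_partner (h : Slide c a i hi w) (hc : c.IsLR) (p : Node (n + 2)) :
    a.word (a.partner p) = (a.word p).reverse := by
  rcases slide_cases c i hi p with rfl | rfl | rfl | rfl | ⟨h0, h1, h2, h3⟩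
  · rw [h.partner_zero, h.word_zero, h.word_far]
  · rw [h.partner_one, h.word_two, h.word_one, mark_reverse]
  · rw [h.partner_two, h.word_two, h.word_one, mark_reverse]
  · rw [h.partner_far, h.word_zero, h.word_far, List.reverse_reverse]
  · obtain ⟨g0, g1, g2, g3⟩ := h.other_partner hc h0 h1 h2 h3
    rw [(h.other p h0 h1 h2 h3).1, (h.other _ g0 g1 g2 g3).2, hc.word_partner,
      (h.other p h0 h1 h2 h3).2]

theorem posL_facts (h : Slide c a i hi w) (hc : c.IsLR) :
    posL (c.partner (Sum.inl ⟨i + 2, hi⟩)) ≠ i ∧ posL (c.partner (Sum.inl ⟨i + 2, hi⟩)) ≠ i + 1 ∧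
    posL (c.partner (Sum.inl ⟨i + 2, hi⟩)) ≠ i + 2 := by
  obtain ⟨f0, f1, f2⟩ := h.far_ne hc
  exact ⟨posL_ne f0, posL_ne f1, posL_ne f2⟩

theorem planar (h : Slide c a i hi w) (hc : c.IsLR) (p q : Node (n + 2)) :
    ¬ (posL p < posL q ∧ posL q < posL (a.partner p) ∧
      posL (a.partner p) < posL (a.partner q)) := by
  obtain ⟨f0, f1, f2⟩ := h.posL_facts hc
  have e0 : posL (Sum.inl ⟨i, by omega⟩ : Node (n + 2)) = i := rfl
  have e1 : posL (Sum.inl ⟨i + 1, by omega⟩ : Node (n + 2)) = i + 1 := rfl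
  have e2 : posL (Sum.inl ⟨i + 2, hi⟩ : Node (n + 2)) = i + 2 := rfl
  have hcv := hc.partner_partner (Sum.inl ⟨i + 2, hi⟩)
  -- an edge `p` that is not moved does not cross a moved edge `q`
  have key : ∀ p, p ≠ Sum.inl ⟨i, by omega⟩ → p ≠ Sum.inl ⟨i + 1, by omega⟩ →
      p ≠ Sum.inl ⟨i + 2, hi⟩ → p ≠ c.partner (Sum.inl ⟨i + 2, hi⟩) →
      ∀ q, q = Sum.inl ⟨i, by omega⟩ ∨ q = Sum.inl ⟨i + 1, by omega⟩ ∨ q = Sum.inl ⟨i + 2, hi⟩ ∨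
        q = c.partner (Sum.inl ⟨i + 2, hi⟩) →
      ¬ (posL p < posL q ∧ posL q < posL (a.partner p) ∧
        posL (a.partner p) < posL (a.partner q)) ∧
      ¬ (posL q < posL p ∧ posL p < posL (a.partner q) ∧
        posL (a.partner q) < posL (a.partner p)) := by
    intro p h0 h1 h2 h3 q hq
    rw [(h.other p h0 h1 h2 h3).1]
    obtain ⟨g0, g1, g2, g3⟩ := h.other_partner hc h0 h1 h2 h3
    have a1 := hc.planar p (Sum.inl ⟨i + 2, hi⟩)
    have a2 := hc.planar (Sum.inl ⟨i + 2, hi⟩) p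
    have a3 := hc.planar p (c.partner (Sum.inl ⟨i + 2, hi⟩))
    have a4 := hc.planar (c.partner (Sum.inl ⟨i + 2, hi⟩)) p
    rw [hcv] at a3 a4
    replace h0 := posL_ne h0
    replace h1 := posL_ne h1
    replace h2 := posL_ne h2
    replace h3 := posL_ne h3
    replace g0 := posL_ne g0
    replace g1 := posL_ne g1
    replace g2 := posL_ne g2
    replace g3 := posL_ne g3
    rw [e2] at a1 a2 a3 a4
    rw [e0] at h0 g0
    rw [e1] at h1 g1
    rw [e2] at h2 g2
    rcases hq with rfl | rfl | rfl | rfl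
    · rw [h.partner_zero, e0]; omega
    · rw [h.partner_one, e1, e2]; omega
    · rw [h.partner_two, e1, e2]; omega
    · rw [h.partner_far, e0]; omega
  by_cases hp : p = Sum.inl ⟨i, by omega⟩ ∨ p = Sum.inl ⟨i + 1, by omega⟩ ∨
      p = Sum.inl ⟨i + 2, hi⟩ ∨ p = c.partner (Sum.inl ⟨i + 2, hi⟩)
  · by_cases hq : q = Sum.inl ⟨i, by omega⟩ ∨ q = Sum.inl ⟨i + 1, by omega⟩ ∨
      q = Sum.inl ⟨i + 2, hi⟩ ∨ q = c.partner (Sum.inl ⟨i + 2, hi⟩)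
    · rcases hp with rfl | rfl | rfl | rfl <;> rcases hq with rfl | rfl | rfl | rfl <;>
        simp only [h.partner_zero, h.partner_one, h.partner_two, h.partner_far, e0, e1, e2] <;>
        omega
    · push Not at hq
      exact (key q hq.1 hq.2.1 hq.2.2.1 hq.2.2.2 p hp).2
  · push Not at hp
    by_cases hq : q = Sum.inl ⟨i, by omega⟩ ∨ q = Sum.inl ⟨i + 1, by omega⟩ ∨
      q = Sum.inl ⟨i + 2, hi⟩ ∨ q = c.partner (Sum.inl ⟨i + 2, hi⟩)
    · exact (key p hp.1 hp.2.1 hp.2.2.1 hp.2.2.2 q hq).1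
    · push Not at hq
      rw [(h.other p hp.1 hp.2.1 hp.2.2.1 hp.2.2.2).1, (h.other q hq.1 hq.2.1 hq.2.2.1 hq.2.2.2).1]
      exact hc.planar p q

/-- The three neighbouring nodes of a slide are on the same side of any other node. -/
theorem pos_facts {pos : Node (n + 2) → ℕ} (hpos : pos = posL ∨ pos = posR) {q : Node (n + 2)}
    (h0 : q ≠ Sum.inl ⟨i, by omega⟩) (h1 : q ≠ Sum.inl ⟨i + 1, by omega⟩)
    (h2 : q ≠ Sum.inl ⟨i + 2, hi⟩) :
    (pos q < pos (Sum.inl ⟨i, by omega⟩) ∧ pos q < pos (Sum.inl ⟨i + 1, by omega⟩) ∧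
      pos q < pos (Sum.inl ⟨i + 2, by omega⟩)) ∨
    (pos (Sum.inl ⟨i, by omega⟩) < pos q ∧ pos (Sum.inl ⟨i + 1, by omega⟩) < pos q ∧
      pos (Sum.inl ⟨i + 2, by omega⟩) < pos q) := by
  replace h0 := posL_ne h0
  replace h1 := posL_ne h1
  replace h2 := posL_ne h2
  have a := posR_eq q
  have a0 := posR_eq (Sum.inl ⟨i, by omega⟩ : Node (n + 2))
  have a1 := posR_eq (Sum.inl ⟨i + 1, by omega⟩ : Node (n + 2))
  have a2 := posR_eq (Sum.inl ⟨i + 2, hi⟩ : Node (n + 2))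
  have e0 : posL (Sum.inl ⟨i, by omega⟩ : Node (n + 2)) = i := rfl
  have e1 : posL (Sum.inl ⟨i + 1, by omega⟩ : Node (n + 2)) = i + 1 := rfl
  have e2 : posL (Sum.inl ⟨i + 2, hi⟩ : Node (n + 2)) = i + 2 := rfl
  have := posL_lt q
  rcases hpos with rfl | rfl <;> omega

theorem pos_cup {pos : Node (n + 2) → ℕ} (hpos : pos = posL ∨ pos = posR) :
    (pos (Sum.inl ⟨i, by omega⟩) + 1 = pos (Sum.inl ⟨i + 1, by omega⟩) ∧
      pos (Sum.inl ⟨i + 1, by omega⟩) + 1 = pos (Sum.inl ⟨i + 2, hi⟩)) ∨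
    (pos (Sum.inl ⟨i + 1, by omega⟩) + 1 = pos (Sum.inl ⟨i, by omega⟩) ∧
      pos (Sum.inl ⟨i + 2, hi⟩) + 1 = pos (Sum.inl ⟨i + 1, by omega⟩)) := by
  have a0 := posR_eq (Sum.inl ⟨i, by omega⟩ : Node (n + 2))
  have a1 := posR_eq (Sum.inl ⟨i + 1, by omega⟩ : Node (n + 2))
  have a2 := posR_eq (Sum.inl ⟨i + 2, hi⟩ : Node (n + 2))
  have e0 : posL (Sum.inl ⟨i, by omega⟩ : Node (n + 2)) = i := rfl
  have e1 : posL (Sum.inl ⟨i + 1, by omega⟩ : Node (n + 2)) = i + 1 := rfl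
  have e2 : posL (Sum.inl ⟨i + 2, hi⟩ : Node (n + 2)) = i + 2 := rfl
  rcases hpos with rfl | rfl <;> omega

theorem exposed_zero (h : Slide c a i hi w) (hc : c.IsLR) {pos : Node (n + 2) → ℕ}
    (hpos : pos = posL ∨ pos = posR) (he : c.Exposed pos (Sum.inl ⟨i + 2, hi⟩)) :
    a.Exposed pos (Sum.inl ⟨i, by omega⟩) := by
  intro q
  obtain ⟨f0, f1, f2⟩ := h.far_ne hc
  have hf := pos_facts (i := i) (hi := hi) hpos f0 f1 f2
  have hcup := pos_cup (i := i) (hi := hi) hpos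
  rw [h.partner_zero]
  rcases slide_cases c i hi q with rfl | rfl | rfl | rfl | ⟨h0, h1, h2, h3⟩
  · omega
  · rw [h.partner_one]; omega
  · rw [h.partner_two]; omega
  · omega
  · rw [(h.other q h0 h1 h2 h3).1]
    obtain ⟨g0, g1, g2, g3⟩ := h.other_partner hc h0 h1 h2 h3
    have hq := pos_facts (i := i) (hi := hi) hpos h0 h1 h2
    have hq' := pos_facts (i := i) (hi := hi) hpos g0 g1 g2
    have := he q
    omega

theorem exposed_other (h : Slide c a i hi w) (hc : c.IsLR) {pos : Node (n + 2) → ℕ}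
    (hpos : pos = posL ∨ pos = posR) {p : Node (n + 2)}
    (h0 : p ≠ Sum.inl ⟨i, by omega⟩) (h1 : p ≠ Sum.inl ⟨i + 1, by omega⟩)
    (h2 : p ≠ Sum.inl ⟨i + 2, hi⟩) (h3 : p ≠ c.partner (Sum.inl ⟨i + 2, hi⟩)) :
    c.Exposed pos p ↔ a.Exposed pos p := by
  obtain ⟨g0, g1, g2, g3⟩ := h.other_partner hc h0 h1 h2 h3
  have hp := pos_facts (i := i) (hi := hi) hpos h0 h1 h2
  have hp' := pos_facts (i := i) (hi := hi) hpos g0 g1 g2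
  have hcup := pos_cup (i := i) (hi := hi) hpos
  obtain ⟨f0, f1, f2⟩ := h.far_ne hc
  have hf := pos_facts (i := i) (hi := hi) hpos f0 f1 f2
  have e := (h.other p h0 h1 h2 h3).1
  constructor
  · intro he q
    rw [e]
    rcases slide_cases c i hi q with rfl | rfl | rfl | rfl | ⟨h0, h1, h2, h3⟩
    · have := he (Sum.inl ⟨i + 2, hi⟩); rw [h.partner_zero]; omega
    · rw [h.partner_one]; omega
    · rw [h.partner_two]; omega
    · have := he (c.partner (Sum.inl ⟨i + 2, hi⟩))
      rw [hc.partner_partner] at this; rw [h.partner_far]; omega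
    · rw [(h.other q h0 h1 h2 h3).1]; exact he q
  · intro he q
    rw [Exposed, e] at he
    rcases slide_cases c i hi q with rfl | rfl | rfl | rfl | ⟨h0, h1, h2, h3⟩
    · rw [h.cup]; omega
    · rw [h.cup' hc]; omega
    · have := he (Sum.inl ⟨i, by omega⟩); rw [h.partner_zero] at this; omega
    · have := he (c.partner (Sum.inl ⟨i + 2, hi⟩))
      rw [hc.partner_partner]; rw [h.partner_far] at this; omega
    · have := he q
      rwa [(h.other q h0 h1 h2 h3).1] at this

/-- The nodes `i` and `i + 2` exchange the roles of being the end of a propagating edge. -/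
theorem isProp_swap (h : Slide c a i hi w) (hc : c.IsLR) (p : Node (n + 2)) :
    a.IsProp (Equiv.swap (Sum.inl ⟨i, by omega⟩) (Sum.inl ⟨i + 2, hi⟩) p) ↔ c.IsProp p := by
  obtain ⟨f0, f1, f2⟩ := h.far_ne hc
  unfold IsProp
  rcases slide_cases c i hi p with rfl | rfl | rfl | rfl | ⟨h0, h1, h2, h3⟩
  · rw [Equiv.swap_apply_left, h.partner_two, h.cup]; simp
  · rw [Equiv.swap_apply_of_ne_of_ne (by simp) (by simp), h.partner_one, h.cup' hc]; simp
  · rw [Equiv.swap_apply_right, h.partner_zero]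
    simp
  · rw [Equiv.swap_apply_of_ne_of_ne f0 f2, h.partner_far, hc.partner_partner]
    simp
  · rw [Equiv.swap_apply_of_ne_of_ne h0 h2, (h.other p h0 h1 h2 h3).1]

theorem propCount_eq (h : Slide c a i hi w) (hc : c.IsLR) : a.propCount = c.propCount := by
  classical
  rw [PreDiagram.propCount_eq, PreDiagram.propCount_eq]
  symm
  refine Finset.card_equiv (Equiv.swap ⟨i, by omega⟩ ⟨i + 2, hi⟩) fun x => ?_
  simp only [Finset.mem_filter, Finset.mem_univ, true_and]
  rw [← h.isProp_swap hc (Sum.inl x)]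
  have : (Equiv.swap (Sum.inl ⟨i, by omega⟩) (Sum.inl ⟨i + 2, hi⟩) (Sum.inl x) : Node (n + 2)) =
      Sum.inl (Equiv.swap ⟨i, by omega⟩ ⟨i + 2, hi⟩ x) := by
    simp only [Equiv.swap_apply_def, Sum.inl.injEq]
    split_ifs <;> rfl
  rw [this]

theorem aValue_eq (h : Slide c a i hi w) (hc : c.IsLR) : a.aValue = c.aValue := by
  have h1 := two_mul_aValue_add (h.partner_partner hc) (h.partner_ne hc)
  have h2 := two_mul_aValue_add hc.partner_partner hc.partner_ne
  have := h.propCount_eq hc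
  omega

end Slide

end slide

/-! ### Edges exposed to a wall -/

section exposure

variable {k : ℕ} {d : PreDiagram k}

theorem Exposed.partner (h : ∀ p, d.partner (d.partner p) = p) {pos : Node k → ℕ} {p : Node k}
    (he : d.Exposed pos p) : d.Exposed pos (d.partner p) := by
  intro q
  have := he q
  rw [h]
  omega

/-- Only one propagating edge can be deformed to touch a given wall. -/
theorem IsLR.exposed_unique (hd : d.IsLR) {pos : Node k → ℕ} (hpos : pos = posL ∨ pos = posR)
    {x y : Fin k} (hx : d.IsProp (Sum.inl x)) (hy : d.IsProp (Sum.inl y))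
    (hxe : d.Exposed pos (Sum.inl x)) (hye : d.Exposed pos (Sum.inl y)) : x = y := by
  obtain ⟨x', hx'⟩ := isProp_inl.1 hx
  obtain ⟨y', hy'⟩ := isProp_inl.1 hy
  by_contra hne
  have hne' : x'.val ≠ y'.val := fun e => hne (by
    have e : x' = y' := Fin.ext e
    have h1 := hd.partner_partner (Sum.inl x)
    have h2 := hd.partner_partner (Sum.inl y)
    rw [hx'] at h1
    rw [hy', ← e, h1] at h2
    exact Sum.inl_injective h2)
  have hne := Fin.val_ne_of_ne hne
  have p1 := hd.planar (Sum.inl x) (Sum.inl y)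
  have p2 := hd.planar (Sum.inl y) (Sum.inl x)
  have e1 := hxe (Sum.inl y)
  have e2 := hye (Sum.inl x)
  rw [hx', hy'] at p1 p2 e1 e2
  have := x.2
  have := y.2
  have := x'.2
  have := y'.2
  rcases hpos with rfl | rfl <;> simp only [posL, posR] at p1 p2 e1 e2 <;> omega

/-- In a diagram with propagating edges, a decorated north edge carries one type of
decorations. -/
theorem IsLR.not_exposed_both (hd : d.IsLR) {x y : Fin k} (hx : d.IsProp (Sum.inl x))
    (hy : ¬ d.IsProp (Sum.inl y)) (hL : d.Exposed posL (Sum.inl y))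
    (hR : d.Exposed posR (Sum.inl y)) : False := by
  obtain ⟨x', hx'⟩ := isProp_inl.1 hx
  obtain ⟨y', hy'⟩ := not_isProp_inl.1 hy
  have hxy : x ≠ y := by rintro rfl; exact hy hx
  have hxy' : x ≠ y' := by
    rintro rfl
    have := hd.partner_partner (Sum.inl y)
    rw [hy', hx'] at this
    cases this
  have := Fin.val_ne_of_ne hxy
  have := Fin.val_ne_of_ne hxy'
  have e1 := hL (Sum.inl x)
  have e2 := hR (Sum.inl x)
  have p1 := hd.planar (Sum.inl x) (Sum.inl y)
  have p2 := hd.planar (Sum.inl y) (Sum.inl x)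
  have p3 := hd.planar (Sum.inl y') (Sum.inl x)
  have hy2 := hd.partner_partner (Sum.inl y)
  rw [hy'] at hy2
  have := x.2
  have := y.2
  have := x'.2
  have := y'.2
  rw [hx', hy'] at p1 p2 e1 e2
  rw [hx', hy2] at p3
  simp only [posL, posR] at p1 p2 p3 e1 e2
  omega

end exposure

/-! ### Slides of LR-decorated diagrams -/

namespace Slide

variable {n : ℕ} {c a : PreDiagram (n + 2)} {i : ℕ} {hi : i + 2 < n + 2} {w : List Deco}

theorem mem_two (h : Slide c a i hi w) {x : Deco} (hx : x ∈ w) :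
    x ∈ c.word (Sum.inl ⟨i + 2, hi⟩) := by
  rw [h.word]; exact List.mem_append_right _ hx

theorem mem_mark (hn : 2 ≤ n) {x : Deco} (hi : i + 2 < n + 2) (hx : x ∈ mark n (i + 1)) :
    x = .odot ∧ i + 1 = n := by
  rcases shift_cases n i hi with h | h | h | h
  · simp [h.2.2.2.2] at hx
  · simp [h.2.2.2.2] at hx
  · rw [h.2.2.2.2] at hx; exact ⟨by simpa using hx, h.2.1⟩
  · omega

theorem exposed_last {a : PreDiagram (n + 2)} {hi : i + 2 < n + 2} (hin : i + 1 = n) :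
    a.Exposed posR (Sum.inl ⟨i + 2, hi⟩) := by
  intro q
  have : posR (Sum.inl ⟨i + 2, hi⟩ : Node (n + 2)) = 0 := by simp only [posR]; omega
  omega

theorem exposed_far (h : Slide c a i hi w) (hc : c.IsLR) {pos : Node (n + 2) → ℕ}
    (hpos : pos = posL ∨ pos = posR) (he : c.Exposed pos (Sum.inl ⟨i + 2, hi⟩)) :
    a.Exposed pos (c.partner (Sum.inl ⟨i + 2, hi⟩)) := by
  have := (h.exposed_zero hc hpos he).partner (h.partner_partner hc)
  rwa [h.partner_zero] at this

theorem closed_exposed (h : Slide c a i hi w) (hc : c.IsLR) (hn : 2 ≤ n) (p : Node (n + 2))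
    (x : Deco) (hx : x ∈ a.word p) (hxc : x.isClosed = true) : a.Exposed posL p := by
  rcases slide_cases c i hi p with rfl | rfl | rfl | rfl | ⟨h0, h1, h2, h3⟩
  · rw [h.word_zero] at hx
    exact h.exposed_zero hc (Or.inl rfl) (hc.closed_exposed _ x (h.mem_two hx) hxc)
  · rw [h.word_one] at hx
    rw [(mem_mark hn hi hx).1] at hxc
    simp [Deco.isClosed] at hxc
  · rw [h.word_two] at hx
    rw [(mem_mark hn hi hx).1] at hxc
    simp [Deco.isClosed] at hxc
  · rw [h.word_far, List.mem_reverse] at hx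
    exact h.exposed_far hc (Or.inl rfl) (hc.closed_exposed _ x (h.mem_two hx) hxc)
  · rw [(h.other p h0 h1 h2 h3).2] at hx
    exact (h.exposed_other hc (Or.inl rfl) h0 h1 h2 h3).1 (hc.closed_exposed _ x hx hxc)

theorem open_exposed (h : Slide c a i hi w) (hc : c.IsLR) (hn : 2 ≤ n) (p : Node (n + 2))
    (x : Deco) (hx : x ∈ a.word p) (hxc : x.isOpen = true) : a.Exposed posR p := by
  rcases slide_cases c i hi p with rfl | rfl | rfl | rfl | ⟨h0, h1, h2, h3⟩
  · rw [h.word_zero] at hx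
    exact h.exposed_zero hc (Or.inr rfl) (hc.open_exposed _ x (h.mem_two hx) hxc)
  · rw [h.word_one] at hx
    have := (exposed_last (a := a) (hi := hi) (mem_mark hn hi hx).2).partner (h.partner_partner hc)
    rwa [h.partner_two] at this
  · rw [h.word_two] at hx
    exact exposed_last (mem_mark hn hi hx).2
  · rw [h.word_far, List.mem_reverse] at hx
    exact h.exposed_far hc (Or.inr rfl) (hc.open_exposed _ x (h.mem_two hx) hxc)
  · rw [(h.other p h0 h1 h2 h3).2] at hx
    exact (h.exposed_other hc (Or.inr rfl) h0 h1 h2 h3).1 (hc.open_exposed _ x hx hxc)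

/-- The left ends of decorated edges of `a` come from left ends of edges of `c` with the same
letters, at the same place relative to the other ones; the only new letters are at the right
wall. -/
theorem leftEnd (h : Slide c a i hi w) (hc : c.IsLR) (hn : 2 ≤ n) {x y : Fin (n + 2)}
    (hxy : a.partner (Sum.inl x) = Sum.inl y) (hlt : x < y) :
    (x.val = i + 1 ∧ ∀ l ∈ a.word (Sum.inl x), l = .odot ∧ i + 1 = n) ∨
    ∃ x' y', c.partner (Sum.inl x') = Sum.inl y' ∧ x' < y' ∧
      (∃ s, a.word (Sum.inl x) <+: c.word (Sum.inl x') ∨ s ++ a.word (Sum.inl x) =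
        c.word (Sum.inl x')) ∧
      ((x.val = i ∧ x'.val = i + 2) ∨ (x' = x ∧ x.val ≠ i ∧ x.val ≠ i + 1 ∧ x.val ≠ i + 2)) := by
  obtain ⟨f0, f1, f2⟩ := h.far_ne hc
  by_cases hx0 : x = ⟨i, Nat.lt_of_succ_lt (Nat.lt_of_succ_lt hi)⟩
  · subst hx0
    right
    rw [h.partner_zero] at hxy
    refine ⟨⟨i + 2, hi⟩, y, hxy, ?_, ⟨shift n i, Or.inr (by rw [h.word, h.word_zero])⟩,
      Or.inl (by simp)⟩
    rw [hxy] at f1 f2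
    have h1 : y ≠ ⟨i + 1, by omega⟩ := fun e => f1 (by rw [e])
    have h2 : y ≠ ⟨i + 2, by omega⟩ := fun e => f2 (by rw [e])
    have h1 := Fin.val_ne_of_ne h1
    have h2 := Fin.val_ne_of_ne h2
    simp only [Fin.lt_def] at hlt h1 h2 ⊢
    omega
  by_cases hx1 : x = ⟨i + 1, Nat.lt_of_succ_lt hi⟩
  · subst hx1
    left
    refine ⟨rfl, fun l hl => ?_⟩
    rw [h.word_one] at hl
    exact mem_mark hn hi hl
  by_cases hx2 : x = ⟨i + 2, hi⟩
  · subst hx2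
    rw [h.partner_two] at hxy
    cases hxy
    simp only [Fin.lt_def] at hlt
    omega
  have v0 := Fin.val_ne_of_ne hx0
  have v1 := Fin.val_ne_of_ne hx1
  have v2 := Fin.val_ne_of_ne hx2
  have g0 : (Sum.inl x : Node (n + 2)) ≠ Sum.inl ⟨i, by omega⟩ := by simpa using hx0
  have g1 : (Sum.inl x : Node (n + 2)) ≠ Sum.inl ⟨i + 1, by omega⟩ := by simpa using hx1
  have g2 : (Sum.inl x : Node (n + 2)) ≠ Sum.inl ⟨i + 2, by omega⟩ := by simpa using hx2
  right
  by_cases hx3 : Sum.inl x = c.partner (Sum.inl ⟨i + 2, hi⟩)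
  · have hp := h.partner_far
    have hw := h.word_far
    rw [← hx3] at hp hw
    rw [hxy] at hp
    cases hp
    have hcw := hc.word_partner (Sum.inl ⟨i + 2, hi⟩)
    rw [← hx3, h.word, List.reverse_append, ← hw] at hcw
    refine ⟨x, ⟨i + 2, hi⟩, by rw [hx3, hc.partner_partner], ?_, ⟨[], Or.inl ?_⟩,
      Or.inr ⟨rfl, v0, v1, v2⟩⟩
    · simp only [Fin.lt_def] at hlt ⊢
      omega
    · rw [hcw]; exact List.prefix_append _ _
  · obtain ⟨e1, e2⟩ := h.other _ g0 g1 g2 hx3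
    rw [e1] at hxy
    exact ⟨x, y, hxy, hlt, ⟨[], Or.inl (by rw [e2])⟩, Or.inr ⟨rfl, v0, v1, v2⟩⟩

theorem north_sorted (h : Slide c a i hi w) (hc : c.IsLR) (hn : 2 ≤ n) (h0 : a.propCount = 0) :
    ClosedBeforeOpen a.northWord := by
  have hs := hc.north_sorted (by rw [← h.propCount_eq hc, h0])
  rw [northWord_sorted_iff] at hs ⊢
  obtain ⟨s1, s2⟩ := hs
  constructor
  · intro x y hxy hlt
    rcases h.leftEnd hc hn hxy hlt with ⟨_, hl⟩ | ⟨x', y', hxy', hlt', ⟨s, hs⟩, _⟩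
    · exact closedBeforeOpen_of_uniform (c := false) fun l hl' => by rw [(hl l hl').1]; rfl
    · have := s1 x' y' hxy' hlt'
      rcases hs with hs | hs
      · exact this.sublist hs.sublist
      · rw [← hs] at this
        exact this.sublist (List.sublist_append_right _ _)
  · intro x x' y y' hx hy hxx hyy hxy l hl m hm ho
    rcases h.leftEnd hc hn hy hyy with ⟨_, hm'⟩ | ⟨z, z', hz, hlt, ⟨s, hs⟩, hzy⟩
    · rw [(hm' m hm).1]; rfl
    · have hm' : m ∈ c.word (Sum.inl z) := by
        rcases hs with hs | hs
        · exact hs.subset hm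
        · rw [← hs]; exact List.mem_append_right _ hm
      rcases h.leftEnd hc hn hx hxx with ⟨hx1, hl'⟩ | ⟨u, u', hu, hlt', ⟨s', hs'⟩, hux⟩
      · have := hl' l hl
        have := x'.2
        have := y'.2
        simp only [Fin.lt_def] at hxx hyy hxy
        omega
      · have hl' : l ∈ c.word (Sum.inl u) := by
          rcases hs' with hs | hs
          · exact hs.subset hl
          · rw [← hs]; exact List.mem_append_right _ hl
        refine s2 u u' z z' hu hz hlt' hlt ?_ l hl' m hm' ho
        simp only [Fin.lt_def, Fin.ext_iff] at hxy hux hzy ⊢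
        omega

theorem southWord_eq (h : Slide c a i hi w) (h0 : c.propCount = 0) :
    a.southWord = c.southWord := by
  have : ∀ x, a.partner (Sum.inr x) = c.partner (Sum.inr x) ∧
      a.word (Sum.inr x) = c.word (Sum.inr x) := by
    intro x
    refine h.other _ (by simp) (by simp) (by simp) fun e => ?_
    obtain ⟨y, hy⟩ := not_isProp_inl.1 (propCount_eq_zero.1 h0 ⟨i + 2, hi⟩)
    rw [hy] at e
    cases e
  simp only [southWord, fun x => (this x).1, fun x => (this x).2]

theorem isProp_two (h : Slide c a i hi w) (hc : c.IsLR) (h1 : c.aValue = 1) :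
    c.IsProp (Sum.inl ⟨i + 2, hi⟩) := by
  by_contra hp
  obtain ⟨z, hz⟩ := not_isProp_inl.1 hp
  obtain ⟨f0, f1, f2⟩ := h.far_ne hc
  have hz' := hc.partner_partner (Sum.inl ⟨i + 2, hi⟩)
  rw [hz] at f0 f1 f2 hz'
  have f0 : z ≠ ⟨i, by omega⟩ := fun e => f0 (by rw [e])
  have f2 : z ≠ ⟨i + 2, by omega⟩ := fun e => f2 (by rw [e])
  rcases lt_or_gt_of_ne f2 with hlt | hlt
  · exact aValue_ne_one_of_two h.cup hz' (by simp) hlt f0.symm h1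
  · exact aValue_ne_one_of_two h.cup hz (by simp) hlt (by simp) h1

/-- Removing the shifted letters from the list of the decorations on propagating edges agrees with
removing them from the moving edge. -/
theorem vert_exposed (h : Slide c a i hi w) (hc : c.IsLR) (hn : 2 ≤ n) (h1 : c.aValue = 1)
    {f : Deco → Bool} {pos : Node (n + 2) → ℕ} (hpos : (pos = posL ∧ f = Deco.isClosed) ∨
      (pos = posR ∧ f = Deco.isOpen))
    (hv : ∀ x y, c.partner (Sum.inl x) = Sum.inr y → c.Exposed pos (Sum.inl x) →
      c.word (Sum.inl x) = (shift n i ++ a.vert).filter f)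
    (x y : Fin (n + 2)) (hxy : a.partner (Sum.inl x) = Sum.inr y)
    (hx : a.Exposed pos (Sum.inl x)) : a.word (Sum.inl x) = a.vert.filter f := by
  have hpos' : pos = posL ∨ pos = posR := hpos.imp And.left And.left
  obtain ⟨f0, f1, f2⟩ := h.far_ne hc
  have hf := pos_facts (i := i) (hi := hi) hpos' f0 f1 f2
  have hcup := pos_cup (i := i) (hi := hi) hpos'
  by_cases hx0 : x = ⟨i, by omega⟩
  · subst hx0
    -- the moving edge is exposed in `c`, since the edge that it passes does not cover it
    have he : c.Exposed pos (Sum.inl ⟨i + 2, hi⟩) := by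
      intro q
      rcases slide_cases c i hi q with rfl | rfl | rfl | rfl | ⟨h0, h1, h2, h3⟩
      · rw [h.cup]; omega
      · rw [h.cup' hc]; omega
      · omega
      · rw [hc.partner_partner]; omega
      · obtain ⟨g0, g1, g2, g3⟩ := h.other_partner hc h0 h1 h2 h3
        have hq := pos_facts (i := i) (hi := hi) hpos' h0 h1 h2
        have hq' := pos_facts (i := i) (hi := hi) hpos' g0 g1 g2
        have := hx q
        rw [(h.other q h0 h1 h2 h3).1, h.partner_zero] at this
        omega
    rw [h.partner_zero] at hxy
    have hw := hv _ _ hxy he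
    rw [h.word, List.filter_append] at hw
    rw [h.word_zero]
    rcases shift_cases n i hi with hs | hs | hs | hs
    · rw [hs.2.2.1] at hw
      rcases hpos with ⟨_, rfl⟩ | ⟨_, rfl⟩
      · exact List.append_cancel_left (as := [Deco.dot]) hw
      · have h' : Deco.dot ∈ [Deco.dot] ++ w := by simp
        rw [hw] at h'
        simp [Deco.isOpen, Deco.isClosed] at h'
    · rw [hs.2.2.1] at hw
      simpa using hw
    · rw [hs.2.2.1] at hw
      rcases hpos with ⟨_, rfl⟩ | ⟨_, rfl⟩
      · have h' : Deco.odot ∈ [Deco.odot] ++ w := by simp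
        rw [hw] at h'
        simp [Deco.isClosed] at h'
      · exact List.append_cancel_left (as := [Deco.odot]) hw
    · omega
  by_cases hx1 : x = ⟨i + 1, by omega⟩
  · subst hx1
    rw [h.partner_one] at hxy
    simp at hxy
  by_cases hx2 : x = ⟨i + 2, by omega⟩
  · subst hx2
    rw [h.partner_two] at hxy
    simp at hxy
  have g0 : (Sum.inl x : Node (n + 2)) ≠ Sum.inl ⟨i, by omega⟩ := by simpa using hx0
  have g1 : (Sum.inl x : Node (n + 2)) ≠ Sum.inl ⟨i + 1, by omega⟩ := by simpa using hx1
  have g2 : (Sum.inl x : Node (n + 2)) ≠ Sum.inl ⟨i + 2, by omega⟩ := by simpa using hx2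
  by_cases hx3 : Sum.inl x = c.partner (Sum.inl ⟨i + 2, hi⟩)
  · rw [hx3, h.partner_far] at hxy
    simp at hxy
  obtain ⟨e1, e2⟩ := h.other _ g0 g1 g2 hx3
  rw [e1] at hxy
  have hxc := (h.exposed_other hc hpos' g0 g1 g2 hx3).2 hx
  rw [e2, hv x y hxy hxc, List.filter_append]
  -- the shifted letters are on the exposed edge of their type, which is the moving one
  suffices hs : (shift n i).filter f = [] by rw [hs, List.nil_append]
  rcases shift_cases n i hi with hs | hs | hs | hs
  · rw [hs.2.2.1]
    rcases hpos with ⟨rfl, rfl⟩ | ⟨_, rfl⟩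
    · exact absurd (hc.exposed_unique (Or.inl rfl) (isProp_inl.2 ⟨y, hxy⟩) (h.isProp_two hc h1) hxc
        (hc.closed_exposed _ .dot (by rw [h.word, hs.2.2.1]; simp) rfl)) hx2
    · simp [Deco.isOpen, Deco.isClosed]
  · rw [hs.2.2.1]; rfl
  · rw [hs.2.2.1]
    rcases hpos with ⟨_, rfl⟩ | ⟨rfl, rfl⟩
    · simp [Deco.isClosed]
    · exact absurd (hc.exposed_unique (Or.inr rfl) (isProp_inl.2 ⟨y, hxy⟩) (h.isProp_two hc h1) hxc
        (hc.open_exposed _ .odot (by rw [h.word, hs.2.2.1]; simp) rfl)) hx2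
  · omega

theorem isLR (h : Slide c a i hi w) (hc : c.IsLR) (hn : 2 ≤ n) : a.IsLR where
  partner_partner := h.partner_partner hc
  partner_ne := h.partner_ne hc
  planar := h.planar hc
  word_partner := h.word_partner hc
  closed_exposed := h.closed_exposed hc hn
  open_exposed := h.open_exposed hc hn
  north_sorted := h.north_sorted hc hn
  south_sorted h0 := by
    rw [h.propCount_eq hc] at h0
    rw [h.southWord_eq h0]
    exact hc.south_sorted h0
  loops_undammed h0 := by
    rw [h.propCount_eq hc] at h0
    rw [h.loops]
    exact hc.loops_undammed h0
  loops_dammed h0 := by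
    rw [h.propCount_eq hc] at h0
    rw [h.loops]
    exact hc.loops_dammed h0
  vert_nil h0 := h.vert_nil (by rwa [h.aValue_eq hc] at h0)
  vert_left h1 := by
    rw [h.aValue_eq hc] at h1
    exact h.vert_exposed hc hn h1 (Or.inl ⟨rfl, rfl⟩) (by rw [← h.vert h1]; exact hc.vert_left h1)
  vert_right h1 := by
    rw [h.aValue_eq hc] at h1
    exact h.vert_exposed hc hn h1 (Or.inr ⟨rfl, rfl⟩) (by rw [← h.vert h1]; exact hc.vert_right h1)
  undecorated h0 := by
    exfalso
    classical
    rw [h.aValue_eq hc, aValue, Finset.card_eq_zero, Finset.filter_eq_empty_iff] at h0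
    exact h0 (Finset.mem_univ ⟨i, by omega⟩) ⟨⟨i + 1, by omega⟩, h.cup, by simp⟩

/-- No loop is formed, since the node `i` of `a` is not joined to `i + 1`. -/
theorem red (h : Slide c a i hi w) (hc : c.IsLR) (hn : 2 ≤ n) : Red c a :=
  Relation.ReflTransGen.single ⟨hc, h.isLR hc hn, _, Or.inl ⟨h.plainConcat hc, fun e =>
    (h.far_ne hc).2.1 (h.partner_zero.symm.trans e)⟩⟩

end Slide

/-! ### Taut diagrams -/

section taut

variable {n : ℕ}

/-- The zone of the `x`-th of the places `0, …, m`. -/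
def column (m x : ℕ) : Zone := if x = 0 then .L else if x = m then .R else .M

/-- The zone of a node. -/
def zone (p : Node (n + 2)) : Zone := column (n + 1) (p.elim id id).val

/-- The diagrams on which the reduction operates. All decorations on edges are circles, and an edge
is decorated by the walls that it has to touch: its word is a walk from its first to its last node,
and a non-propagating edge touches each wall at most twice. If the `a`-value is `1`, the words of
the single propagating edges need not be walks, but the decorations on all propagating edges
together, read from top to bottom, are a walk from the position of the non-propagating edge in the
north face to that in the south face. -/
structure Taut (d : PreDiagram (n + 2)) : Prop where
  isLR : d.IsLR
  nonprop : ∀ p, ¬ d.IsProp p → Walk (zone p) (d.word p) (zone (d.partner p)) ∧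
    (d.word p).count .dot ≤ 2 ∧ (d.word p).count .odot ≤ 2
  prop : d.aValue ≠ 1 → ∀ p, d.IsProp p → Walk (zone p) (d.word p) (zone (d.partner p))
  vert : d.aValue = 1 → ∃ (i j : ℕ) (hi : i < n + 1) (hj : j < n + 1),
    d.partner (Sum.inl ⟨i, by omega⟩) = Sum.inl ⟨i + 1, by omega⟩ ∧
    d.partner (Sum.inr ⟨j, by omega⟩) = Sum.inr ⟨j + 1, by omega⟩ ∧
    Walk (column n i) d.vert (column n j)
  loops : ∀ L ∈ d.loops, L = loopOf [.tri, .otri]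

/-- Passing from `i + 2` to `i`, an edge changes its zone exactly at the walls, where it loses a
circle. -/
theorem walk_shift {i : ℕ} (hi : i + 2 < n + 2) (hn : 2 ≤ n) {w : List Deco} {t : Zone}
    (h : Walk (column (n + 1) (i + 2)) (shift n i ++ w) t) : Walk (column (n + 1) i) w t := by
  rcases shift_cases n i hi with hs | hs | hs | hs
  · rw [hs.2.2.1] at h
    rw [column, if_neg (by omega), if_neg (by omega)] at h
    rw [column, if_pos hs.1]
    rcases h.dot_cons with h | h
    · simp at h
    · exact h.2
  · rw [hs.2.2.1, List.nil_append] at h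
    rw [column, if_neg (by omega), if_neg (by omega)] at h ⊢
    exact h
  · rw [hs.2.2.1] at h
    rw [column, if_neg (by omega), if_pos (by omega)] at h
    rw [column, if_neg (by omega), if_neg (by omega)]
    rcases h.odot_cons with h | h
    · exact h.2
    · simp at h
  · omega

/-- The position of the non-propagating edge changes its zone when the moving edge does. -/
theorem walk_shift_cup {i : ℕ} (hi : i + 2 < n + 2) (hn : 2 ≤ n) {w : List Deco} {t : Zone}
    (h : Walk (column n i) (shift n i ++ w) t) : Walk (column n (i + 1)) w t := by
  rcases shift_cases n i hi with hs | hs | hs | hs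
  · rw [hs.2.2.1] at h
    rw [column, if_pos hs.1] at h
    rw [column, if_neg (by omega), if_neg (by omega)]
    rcases h.dot_cons with h | h
    · exact h.2
    · simp at h
  · rw [hs.2.2.1, List.nil_append] at h
    rw [column, if_neg (by omega), if_neg (by omega)] at h ⊢
    exact h
  · rw [hs.2.2.1] at h
    rw [column, if_neg (by omega), if_neg (by omega)] at h
    rw [column, if_neg (by omega), if_pos (by omega)]
    rcases h.odot_cons with h | h
    · simp at h
    · exact h.2
  · omega

theorem walk_mark {i : ℕ} (hi : i < n + 1) (hn : 2 ≤ n) :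
    Walk (column (n + 1) i) (mark n i) (column (n + 1) (i + 1)) := by
  unfold column mark
  rw [if_neg (Nat.succ_ne_zero i)]
  by_cases h0 : i = 0
  · rw [if_pos h0, if_pos h0, if_neg (by omega)]
    exact .dotL (.nil _)
  · rw [if_neg h0, if_neg h0, if_neg (by omega)]
    by_cases h1 : i = n
    · rw [if_pos h1, if_pos (by omega)]
      exact .odotM (.nil _)
    · rw [if_neg h1, if_neg (by omega)]
      exact .nil _

theorem count_mark (i : ℕ) (x : Deco) : (mark n i).count x ≤ 1 := by
  unfold mark
  split_ifs <;> simp [List.count_cons] <;> split_ifs <;> simp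

theorem Slide.taut {c a : PreDiagram (n + 2)} {i : ℕ} {hi : i + 2 < n + 2} {w : List Deco}
    (h : Slide c a i hi w) (hc : c.Taut) (hn : 2 ≤ n) : a.Taut := by
  have hlr := hc.isLR
  have ha := h.isLR hlr hn
  obtain ⟨f0, f1, f2⟩ := h.far_ne hlr
  have hsub : w.Sublist (c.word (Sum.inl ⟨i + 2, hi⟩)) := by
    rw [h.word]; exact List.sublist_append_right _ _
  have hcount : ∀ x, (mark n (i + 1)).count x ≤ 2 := fun x => (count_mark _ x).trans (by omega)
  have hprop : ∀ p, p ≠ Sum.inl ⟨i, by omega⟩ → p ≠ Sum.inl ⟨i + 2, hi⟩ →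
      (a.IsProp p ↔ c.IsProp p) := by
    intro p h0 h2
    have := h.isProp_swap hlr p
    rwa [Equiv.swap_apply_of_ne_of_ne h0 h2] at this
  have hprop0 : a.IsProp (Sum.inl ⟨i, by omega⟩) ↔ c.IsProp (Sum.inl ⟨i + 2, hi⟩) := by
    have := h.isProp_swap hlr (Sum.inl ⟨i + 2, hi⟩)
    rwa [Equiv.swap_apply_right] at this
  have hwalk : Walk (zone (Sum.inl ⟨i + 2, hi⟩ : Node (n + 2))) (c.word (Sum.inl ⟨i + 2, hi⟩))
      (zone (c.partner (Sum.inl ⟨i + 2, hi⟩))) →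
      Walk (zone (Sum.inl ⟨i, by omega⟩ : Node (n + 2))) w
        (zone (c.partner (Sum.inl ⟨i + 2, hi⟩))) := by
    intro hw
    rw [h.word] at hw
    exact walk_shift hi hn hw
  refine ⟨ha, fun p hp => ?_, fun h1 p hp => ?_, fun h1 => ?_, ?_⟩
  · rcases slide_cases c i hi p with rfl | rfl | rfl | rfl | ⟨h0, h1, h2, h3⟩
    · obtain ⟨w1, w2, w3⟩ := hc.nonprop _ (by rwa [hprop0] at hp)
      rw [h.word_zero, h.partner_zero]
      exact ⟨hwalk w1, (hsub.count_le _).trans w2, (hsub.count_le _).trans w3⟩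
    · rw [h.word_one, h.partner_one]
      exact ⟨walk_mark (i := i + 1) (by omega) hn, hcount _, hcount _⟩
    · rw [h.word_two, h.partner_two]
      have := (walk_mark (i := i + 1) (by omega) hn).reverse
      rw [mark_reverse] at this
      exact ⟨this, hcount _, hcount _⟩
    · rw [← isProp_partner ha.partner_partner, h.partner_far, hprop0] at hp
      obtain ⟨w1, w2, w3⟩ := hc.nonprop _ hp
      rw [h.word_far, h.partner_far, List.count_reverse, List.count_reverse]
      exact ⟨(hwalk w1).reverse, (hsub.count_le _).trans w2, (hsub.count_le _).trans w3⟩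
    · rw [(h.other p h0 h1 h2 h3).1, (h.other p h0 h1 h2 h3).2]
      exact hc.nonprop p (by rwa [hprop p h0 h2] at hp)
  · rw [h.aValue_eq hlr] at h1
    rcases slide_cases c i hi p with rfl | rfl | rfl | rfl | ⟨h0, h1', h2, h3⟩
    · rw [h.word_zero, h.partner_zero]
      exact hwalk (hc.prop h1 _ (hprop0.1 hp))
    · rw [isProp_inl, h.partner_one] at hp
      simp at hp
    · rw [isProp_inl, h.partner_two] at hp
      simp at hp
    · rw [← isProp_partner ha.partner_partner, h.partner_far, hprop0] at hp
      rw [h.word_far, h.partner_far]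
      exact (hwalk (hc.prop h1 _ hp)).reverse
    · rw [(h.other p h0 h1' h2 h3).1, (h.other p h0 h1' h2 h3).2]
      exact hc.prop h1 p (by rwa [hprop p h0 h2] at hp)
  · rw [h.aValue_eq hlr] at h1
    obtain ⟨i', j, hi', hj, hci, hcj, hw⟩ := hc.vert h1
    have hii : i' = i := by
      by_contra hne
      exact aValue_ne_one_of_two hci h.cup (by simp) (by simp) (by simpa using hne) h1
    subst hii
    rw [h.vert h1] at hw
    refine ⟨i' + 1, j, by omega, hj, h.partner_one, ?_, walk_shift_cup hi hn hw⟩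
    rw [(h.other _ (by simp) (by simp) (by simp) fun e => ?_).1]
    · exact hcj
    · have := hlr.partner_partner (Sum.inl ⟨i' + 2, hi⟩)
      rw [← e, hcj] at this
      simp at this
  · rw [h.loops]; exact hc.loops

/-- The number of decorations that the reduction has to remove from an edge: all of them from a
propagating edge, and all but one circle of each type from any other edge. -/
def surplus (b : Prop) [Decidable b] (w : List Deco) : ℕ :=
  if b then w.length else (w.count .dot - 1) + (w.count .odot - 1)

theorem surplus_mono (b : Prop) [Decidable b] (u w : List Deco) :
    surplus b w ≤ surplus b (u ++ w) := by
  unfold surplus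
  split_ifs
  · simp
  · simp only [List.count_append]; omega

theorem surplus_reverse (b : Prop) [Decidable b] (w : List Deco) :
    surplus b w.reverse = surplus b w := by
  unfold surplus
  simp

open Classical in
/-- The total surplus of the edges of `d`, where each edge is counted at both ends. -/
noncomputable def excess (d : PreDiagram (n + 2)) : ℕ := ∑ p, surplus (d.IsProp p) (d.word p)

open Classical in
/-- The surplus is compared along the exchange of the nodes `i` and `i + 2`. -/
theorem Slide.surplus_le {c a : PreDiagram (n + 2)} {i : ℕ} {hi : i + 2 < n + 2} {w : List Deco}
    (h : Slide c a i hi w) (hc : c.IsLR) (p : Node (n + 2)) :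
    surplus (a.IsProp (Equiv.swap (Sum.inl ⟨i, by omega⟩) (Sum.inl ⟨i + 2, hi⟩) p))
      (a.word (Equiv.swap (Sum.inl ⟨i, by omega⟩) (Sum.inl ⟨i + 2, hi⟩) p)) ≤
    surplus (c.IsProp p) (c.word p) := by
  obtain ⟨f0, f1, f2⟩ := h.far_ne hc
  have hm : ∀ x, (mark n (i + 1)).count x ≤ 1 := count_mark _
  simp only [h.isProp_swap hc p]
  rcases slide_cases c i hi p with rfl | rfl | rfl | rfl | ⟨h0, h1, h2, h3⟩
  · rw [Equiv.swap_apply_left, h.word_two]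
    have : ¬ c.IsProp (Sum.inl ⟨i, by omega⟩) := not_isProp_inl.2 ⟨_, h.cup⟩
    have h1 := hm .dot
    have h2 := hm .odot
    simp only [surplus, if_neg this]
    omega
  · rw [Equiv.swap_apply_of_ne_of_ne (by simp) (by simp), h.word_one]
    have : ¬ c.IsProp (Sum.inl ⟨i + 1, by omega⟩) := not_isProp_inl.2 ⟨_, h.cup' hc⟩
    have h1 := hm .dot
    have h2 := hm .odot
    simp only [surplus, if_neg this]
    omega
  · rw [Equiv.swap_apply_right, h.word_zero, h.word]
    exact surplus_mono _ _ _
  · rw [Equiv.swap_apply_of_ne_of_ne f0 f2, h.word_far, hc.word_partner, h.word, surplus_reverse,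
      surplus_reverse]
    exact surplus_mono _ _ _
  · rw [Equiv.swap_apply_of_ne_of_ne h0 h2, (h.other p h0 h1 h2 h3).2]

theorem Slide.excess_le {c a : PreDiagram (n + 2)} {i : ℕ} {hi : i + 2 < n + 2} {w : List Deco}
    (h : Slide c a i hi w) (hc : c.IsLR) : a.excess ≤ c.excess := by
  classical
  rw [excess, excess, ← Equiv.sum_comp (Equiv.swap (Sum.inl ⟨i, by omega⟩) (Sum.inl ⟨i + 2, hi⟩))]
  exact Finset.sum_le_sum fun p _ => h.surplus_le hc p

open Classical in
/-- The excess drops if a circle that the moving edge loses counts towards its surplus. -/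
theorem Slide.excess_lt {c a : PreDiagram (n + 2)} {i : ℕ} {hi : i + 2 < n + 2} {w : List Deco}
    (h : Slide c a i hi w) (hc : c.IsLR)
    (hlt : surplus (c.IsProp (Sum.inl ⟨i + 2, hi⟩)) w <
      surplus (c.IsProp (Sum.inl ⟨i + 2, hi⟩)) (c.word (Sum.inl ⟨i + 2, hi⟩))) :
    a.excess < c.excess := by
  rw [excess, excess, ← Equiv.sum_comp (Equiv.swap (Sum.inl ⟨i, by omega⟩) (Sum.inl ⟨i + 2, hi⟩))]
  refine Finset.sum_lt_sum (fun p _ => h.surplus_le hc p)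
    ⟨Sum.inl ⟨i + 2, hi⟩, Finset.mem_univ _, ?_⟩
  have hp := h.isProp_swap hc (Sum.inl ⟨i + 2, hi⟩)
  rw [Equiv.swap_apply_right] at hp
  simp only [Equiv.swap_apply_right, h.word_zero, hp]
  exact hlt

end taut

end PreDiagram

/-- The decoration of the other type with the same shape. -/
def Deco.mirror : Deco → Deco
  | .dot => .odot
  | .tri => .otri
  | .odot => .dot
  | .otri => .tri

theorem Deco.mirror_mirror (x : Deco) : x.mirror.mirror = x := by cases x <;> rfl

theorem Deco.isClosed_mirror (x : Deco) : x.mirror.isClosed = x.isOpen := by cases x <;> rfl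

theorem Deco.isOpen_mirror (x : Deco) : x.mirror.isOpen = x.isClosed := by cases x <;> rfl

theorem map_mirror_mirror (u : List Deco) : (u.map Deco.mirror).map Deco.mirror = u := by
  simp [Function.comp_def, Deco.mirror_mirror]

theorem count_map_mirror (u : List Deco) (x : Deco) :
    (u.map Deco.mirror).count x = u.count x.mirror := by
  have h : Function.Injective Deco.mirror := Function.LeftInverse.injective Deco.mirror_mirror
  conv_lhs => rw [← Deco.mirror_mirror x]
  exact List.count_map_of_injective _ _ h _

/-- The zone on the other side. -/
def Zone.mirror : Zone → Zone
  | .L => .R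
  | .M => .M
  | .R => .L

theorem Walk.mirror {s t : Zone} {u : List Deco} (h : Walk s u t) :
    Walk s.mirror (u.map Deco.mirror) t.mirror := by
  induction h with
  | nil => exact .nil _
  | dotL _ ih => exact .odotR ih
  | dotM _ ih => exact .odotM ih
  | odotM _ ih => exact .dotM ih
  | odotR _ ih => exact .dotL ih

namespace PreDiagram

/-! ### Symmetries -/

section symmetries

variable {k n : ℕ}

/-- The reflection of a diagram that exchanges north and south. -/
def flip (d : PreDiagram k) : PreDiagram k where
  partner p := (d.partner p.swap).swap
  word p := d.word p.swap
  loops := d.loops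
  vert := d.vert.reverse

/-- The reflection of the nodes that exchanges left and right. -/
def mirrorNode : Node k → Node k := Sum.map Fin.rev Fin.rev

/-- The reflection of a diagram that exchanges left and right, and open and closed decorations.
The loops are left unchanged: this suffices for the loops carrying one closed and one open triangle,
which are their own reflections. -/
def mirror (d : PreDiagram k) : PreDiagram k where
  partner p := mirrorNode (d.partner (mirrorNode p))
  word p := (d.word (mirrorNode p)).map Deco.mirror
  loops := d.loops
  vert := d.vert.map Deco.mirror

theorem mirrorNode_inl (x : Fin k) : mirrorNode (Sum.inl x : Node k) = Sum.inl x.rev := rfl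

theorem mirrorNode_inr (x : Fin k) : mirrorNode (Sum.inr x : Node k) = Sum.inr x.rev := rfl

theorem mirrorNode_mirrorNode (p : Node k) : mirrorNode (mirrorNode p) = p := by
  rcases p with p | p <;> simp [mirrorNode]

theorem mirrorNode_inj {p q : Node k} : mirrorNode p = mirrorNode q ↔ p = q :=
  ⟨fun h => by rw [← mirrorNode_mirrorNode p, h, mirrorNode_mirrorNode], fun h => by rw [h]⟩

theorem swap_mirrorNode (p : Node k) : (mirrorNode p).swap = mirrorNode p.swap := by
  rcases p with p | p <;> rfl

theorem isLeft_mirrorNode (p : Node k) : (mirrorNode p).isLeft = p.isLeft := by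
  rcases p with p | p <;> rfl

theorem flip_flip (d : PreDiagram k) : d.flip.flip = d := by
  cases d
  simp [flip]

theorem mirror_mirror (d : PreDiagram k) : d.mirror.mirror = d := by
  cases d
  simp only [mirror, mirrorNode_mirrorNode, map_mirror_mirror]

theorem flip_mirror (d : PreDiagram k) : d.mirror.flip = d.flip.mirror := by
  simp only [mirror, flip, ← swap_mirrorNode, List.map_reverse]

theorem posL_swap (p : Node k) : posL p.swap + posL p + 1 = 2 * k := by
  rcases p with ⟨x, hx⟩ | ⟨x, hx⟩ <;> simp only [Sum.swap_inl, Sum.swap_inr, posL] <;> omega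

theorem posR_swap (p : Node k) : posR p.swap + posR p + 1 = 2 * k := by
  rcases p with ⟨x, hx⟩ | ⟨x, hx⟩ <;> simp only [Sum.swap_inl, Sum.swap_inr, posR] <;> omega

theorem posL_mirrorNode (p : Node k) : posL (mirrorNode p) = posR p := by
  rcases p with ⟨x, hx⟩ | ⟨x, hx⟩ <;> 
    simp only [mirrorNode_inl, mirrorNode_inr, Fin.val_rev, posL, posR] <;> omega

theorem posR_mirrorNode (p : Node k) : posR (mirrorNode p) = posL p := by
  rw [← posL_mirrorNode, mirrorNode_mirrorNode]

theorem Trace.flip {a b : PreDiagram k} {s : Node k ⊕ Node k} {q : Node k} {w : List Deco}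
    (h : Trace a b s q w) :
    Trace b.flip a.flip (s.swap.map Sum.swap Sum.swap) q.swap w := by
  induction h with
  | @top p i h =>
    have := Trace.bottom (a := b.flip) (b := a.flip) (p := p.swap) (j := i)
      (by simp [PreDiagram.flip, h])
    simpa [PreDiagram.flip] using this
  | @bottom p j h =>
    have := Trace.top (a := b.flip) (b := a.flip) (p := p.swap) (i := j)
      (by simp [PreDiagram.flip, h])
    simpa [PreDiagram.flip] using this
  | @down p q j w h t ih =>
    have := Trace.up (a := b.flip) (b := a.flip) (p := p.swap) (i := j) (q := q.swap) (w := w)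
      (by simp [PreDiagram.flip, h]) ih
    simpa [PreDiagram.flip] using this
  | @up p q j w h t ih =>
    have := Trace.down (a := b.flip) (b := a.flip) (p := p.swap) (j := j) (q := q.swap) (w := w)
      (by simp [PreDiagram.flip, h]) ih
    simpa [PreDiagram.flip] using this

theorem Trace.mirror {a b : PreDiagram k} {s : Node k ⊕ Node k} {q : Node k} {w : List Deco}
    (h : Trace a b s q w) :
    Trace a.mirror b.mirror (s.map mirrorNode mirrorNode) (mirrorNode q) (w.map Deco.mirror) := by
  induction h with
  | @top p i h =>
    have := Trace.top (a := a.mirror) (b := b.mirror) (p := mirrorNode p) (i := i.rev)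
      (by simp [PreDiagram.mirror, mirrorNode_mirrorNode, h]; rfl)
    simpa [PreDiagram.mirror, mirrorNode_mirrorNode, mirrorNode_inl, mirrorNode_inr] using this
  | @bottom p j h =>
    have := Trace.bottom (a := a.mirror) (b := b.mirror) (p := mirrorNode p) (j := j.rev)
      (by simp [PreDiagram.mirror, mirrorNode_mirrorNode, h]; rfl)
    simpa [PreDiagram.mirror, mirrorNode_mirrorNode, mirrorNode_inl, mirrorNode_inr] using this
  | @down p q j w h t ih =>
    have := Trace.down (a := a.mirror) (b := b.mirror) (p := mirrorNode p) (j := j.rev)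
      (by simp [PreDiagram.mirror, mirrorNode_mirrorNode, h]; rfl) ih
    simpa [PreDiagram.mirror, mirrorNode_mirrorNode, mirrorNode_inl, mirrorNode_inr] using this
  | @up p q j w h t ih =>
    have := Trace.up (a := a.mirror) (b := b.mirror) (p := mirrorNode p) (i := j.rev)
      (by simp [PreDiagram.mirror, mirrorNode_mirrorNode, h]; rfl) ih
    simpa [PreDiagram.mirror, mirrorNode_mirrorNode, mirrorNode_inl, mirrorNode_inr] using this

theorem isProp_flip {d : PreDiagram k} {p : Node k} : d.flip.IsProp p ↔ d.IsProp p.swap := by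
  simp only [IsProp, flip]
  rcases d.partner p.swap <;> rcases p <;> simp

theorem isProp_mirror {d : PreDiagram k} {p : Node k} :
    d.mirror.IsProp p ↔ d.IsProp (mirrorNode p) := by
  simp only [IsProp, mirror, isLeft_mirrorNode]

theorem flip_partner_partner {d : PreDiagram k} (h : ∀ p, d.partner (d.partner p) = p)
    (p : Node k) : d.flip.partner (d.flip.partner p) = p := by
  simp [flip, h]

theorem flip_partner_ne {d : PreDiagram k} (h : ∀ p, d.partner p ≠ p) (p : Node k) :
    d.flip.partner p ≠ p := fun e => h p.swap (by
  rw [flip] at e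
  simp only at e
  conv_rhs => rw [← e]
  rw [Sum.swap_swap])

theorem mirror_partner_partner {d : PreDiagram k} (h : ∀ p, d.partner (d.partner p) = p)
    (p : Node k) : d.mirror.partner (d.mirror.partner p) = p := by
  simp [mirror, h, mirrorNode_mirrorNode]

theorem mirror_partner_ne {d : PreDiagram k} (h : ∀ p, d.partner p ≠ p) (p : Node k) :
    d.mirror.partner p ≠ p := fun e => h (mirrorNode p) (by
  rw [mirror] at e
  simp only at e
  rw [← mirrorNode_inj, mirrorNode_mirrorNode, e])

theorem propCount_flip {d : PreDiagram k} (h : ∀ p, d.partner (d.partner p) = p) :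
    d.flip.propCount = d.propCount := by
  classical
  rw [propCount_eq, propCount_eq_south h]
  simp only [isProp_flip, Sum.swap_inl]

theorem propCount_mirror {d : PreDiagram k} : d.mirror.propCount = d.propCount := by
  classical
  rw [propCount_eq, propCount_eq]
  refine Finset.card_equiv Fin.revPerm fun x => ?_
  simp only [Finset.mem_filter, Finset.mem_univ, true_and, isProp_mirror]
  rfl

theorem aValue_flip {d : PreDiagram k} (h : ∀ p, d.partner (d.partner p) = p)
    (h' : ∀ p, d.partner p ≠ p) : d.flip.aValue = d.aValue := by
  have h1 := two_mul_aValue_add h h'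
  have h2 := two_mul_aValue_add (flip_partner_partner h) (flip_partner_ne h')
  have := propCount_flip h
  omega

theorem aValue_mirror {d : PreDiagram k} (h : ∀ p, d.partner (d.partner p) = p)
    (h' : ∀ p, d.partner p ≠ p) : d.mirror.aValue = d.aValue := by
  have h1 := two_mul_aValue_add h h'
  have h2 := two_mul_aValue_add (mirror_partner_partner h) (mirror_partner_ne h')
  have := propCount_mirror (d := d)
  omega

theorem northWord_flip (d : PreDiagram k) : d.flip.northWord = d.southWord := by
  unfold northWord southWord
  congr 1
  funext i
  simp only [flip, Sum.swap_inl]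
  rcases d.partner (Sum.inr i) <;> rfl

theorem southWord_flip (d : PreDiagram k) : d.flip.southWord = d.northWord := by
  rw [← northWord_flip, flip_flip]

theorem exposed_flip {d : PreDiagram k} (h : ∀ p, d.partner (d.partner p) = p) {p : Node k}
    {pos : Node k → ℕ} (hpos : pos = posL ∨ pos = posR) :
    d.flip.Exposed pos p ↔ d.Exposed pos p.swap := by
  have hs : ∀ q, pos q.swap + pos q + 1 = 2 * k := by
    rcases hpos with rfl | rfl
    · exact posL_swap
    · exact posR_swap
  constructor
  · intro he q
    have := he (d.partner q).swap
    simp only [flip, Sum.swap_swap, h] at this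
    have e1 := hs q
    have e2 := hs (d.partner q)
    have e3 := hs p
    have e4 := hs (d.partner p.swap)
    omega
  · intro he q
    have := he (d.partner q.swap)
    rw [h] at this
    simp only [flip]
    have e1 := hs q
    have e2 := hs (d.partner q.swap)
    have e3 := hs p
    have e4 := hs (d.partner p.swap)
    omega

theorem exposed_mirror {d : PreDiagram k} {p : Node k} :
    (d.mirror.Exposed posL p ↔ d.Exposed posR (mirrorNode p)) ∧
    (d.mirror.Exposed posR p ↔ d.Exposed posL (mirrorNode p)) := by
  refine ⟨⟨fun he q => ?_, fun he q => ?_⟩, ⟨fun he q => ?_, fun he q => ?_⟩⟩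
  · have := he (mirrorNode q)
    simp only [mirror, mirrorNode_mirrorNode, posL_mirrorNode] at this
    rwa [← posL_mirrorNode (mirrorNode p), mirrorNode_mirrorNode]
  · have := he (mirrorNode q)
    simp only [mirror, posL_mirrorNode]
    rwa [← posL_mirrorNode (mirrorNode p), ← posL_mirrorNode (mirrorNode q), mirrorNode_mirrorNode,
      mirrorNode_mirrorNode] at this
  · have := he (mirrorNode q)
    simp only [mirror, mirrorNode_mirrorNode, posR_mirrorNode] at this
    rwa [← posR_mirrorNode (mirrorNode p), mirrorNode_mirrorNode]
  · have := he (mirrorNode q)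
    simp only [mirror, posR_mirrorNode]
    rwa [← posR_mirrorNode (mirrorNode p), ← posR_mirrorNode (mirrorNode q), mirrorNode_mirrorNode,
      mirrorNode_mirrorNode] at this

theorem IsLR.flip {d : PreDiagram k} (hd : d.IsLR) : d.flip.IsLR where
  partner_partner := flip_partner_partner hd.partner_partner
  partner_ne := flip_partner_ne hd.partner_ne
  planar p q := by
    have := hd.planar (d.partner q.swap) (d.partner p.swap)
    rw [hd.partner_partner, hd.partner_partner] at this
    simp only [PreDiagram.flip]
    have e1 := posL_swap q
    have e2 := posL_swap (d.partner q.swap)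
    have e3 := posL_swap p
    have e4 := posL_swap (d.partner p.swap)
    omega
  word_partner p := by simp [PreDiagram.flip, hd.word_partner]
  closed_exposed p x hx hc :=
    (exposed_flip hd.partner_partner (Or.inl rfl)).2 (hd.closed_exposed _ x hx hc)
  open_exposed p x hx hc :=
    (exposed_flip hd.partner_partner (Or.inr rfl)).2 (hd.open_exposed _ x hx hc)
  north_sorted h := by
    rw [propCount_flip hd.partner_partner] at h
    rw [northWord_flip]
    exact hd.south_sorted h
  south_sorted h := by
    rw [propCount_flip hd.partner_partner] at h
    rw [southWord_flip]
    exact hd.north_sorted h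
  loops_undammed h := by
    rw [propCount_flip hd.partner_partner] at h
    exact hd.loops_undammed h
  loops_dammed h := by
    rw [propCount_flip hd.partner_partner] at h
    exact hd.loops_dammed h
  vert_nil h := by
    rw [aValue_flip hd.partner_partner hd.partner_ne] at h
    simp [PreDiagram.flip, hd.vert_nil h]
  vert_left h i j hij he := by
    rw [aValue_flip hd.partner_partner hd.partner_ne] at h
    have h1 : d.partner (Sum.inr i) = Sum.inl j := by
      simp only [PreDiagram.flip, Sum.swap_inl] at hij
      rw [← Sum.swap_swap (d.partner (Sum.inr i)), hij, Sum.swap_inr]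
    have h2 : d.partner (Sum.inl j) = Sum.inr i := by rw [← h1, hd.partner_partner]
    have h3 := ((exposed_flip hd.partner_partner (Or.inl rfl)).1 he).partner hd.partner_partner
    rw [Sum.swap_inl, h1] at h3
    have h4 := hd.word_partner (Sum.inl j)
    rw [h2, hd.vert_left h j i h2 h3] at h4
    simp [PreDiagram.flip, h4]
  vert_right h i j hij he := by
    rw [aValue_flip hd.partner_partner hd.partner_ne] at h
    have h1 : d.partner (Sum.inr i) = Sum.inl j := by
      simp only [PreDiagram.flip, Sum.swap_inl] at hij
      rw [← Sum.swap_swap (d.partner (Sum.inr i)), hij, Sum.swap_inr]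
    have h2 : d.partner (Sum.inl j) = Sum.inr i := by rw [← h1, hd.partner_partner]
    have h3 := ((exposed_flip hd.partner_partner (Or.inr rfl)).1 he).partner hd.partner_partner
    rw [Sum.swap_inl, h1] at h3
    have h4 := hd.word_partner (Sum.inl j)
    rw [h2, hd.vert_right h j i h2 h3] at h4
    simp [PreDiagram.flip, h4]
  undecorated h := by
    rw [aValue_flip hd.partner_partner hd.partner_ne] at h
    exact ⟨fun p => (hd.undecorated h).1 _, (hd.undecorated h).2⟩

/-- Planarity does not depend on the point where the boundary is cut open, and on its
orientation. -/
theorem IsLR.planarR {d : PreDiagram k} (hd : d.IsLR) (p q : Node k) :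
    ¬ (posR p < posR q ∧ posR q < posR (d.partner p) ∧
      posR (d.partner p) < posR (d.partner q)) := by
  have p1 := hd.planar p q
  have p2 := hd.planar q p
  have p3 := hd.planar p (d.partner q)
  have p4 := hd.planar q (d.partner p)
  have p5 := hd.planar (d.partner p) q
  have p6 := hd.planar (d.partner q) p
  have p7 := hd.planar (d.partner p) (d.partner q)
  have p8 := hd.planar (d.partner q) (d.partner p)
  simp only [hd.partner_partner] at p1 p2 p3 p4 p5 p6 p7 p8
  have r1 := posR_eq p
  have r2 := posR_eq q
  have r3 := posR_eq (d.partner p)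
  have r4 := posR_eq (d.partner q)
  have l1 := posL_lt p
  have l2 := posL_lt q
  have l3 := posL_lt (d.partner p)
  have l4 := posL_lt (d.partner q)
  omega

theorem closedBeforeOpen_map_mirror {u : List Deco} (h : ClosedBeforeOpen u) :
    ClosedBeforeOpen (u.reverse.map Deco.mirror) := by
  rw [ClosedBeforeOpen, List.pairwise_map, List.pairwise_reverse]
  refine List.Pairwise.imp ?_ h
  intro a b hab
  rw [Deco.isOpen_mirror, Deco.isOpen_mirror]
  cases a <;> cases b <;> simp_all [Deco.isOpen, Deco.isClosed]

theorem IsLR.mirror_sorted {d : PreDiagram k} (hd : d.IsLR) (h0 : d.propCount = 0) :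
    ClosedBeforeOpen d.mirror.northWord := by
  have hs := northWord_sorted_iff.1 (hd.north_sorted h0)
  have hp : ∀ x y : Fin k, d.mirror.partner (Sum.inl x) = Sum.inl y →
      d.partner (Sum.inl y.rev) = Sum.inl x.rev := by
    intro x y hxy
    have := mirror_partner_partner hd.partner_partner (Sum.inl x)
    rw [hxy] at this
    have := congrArg mirrorNode this
    simp only [PreDiagram.mirror, mirrorNode_mirrorNode] at this
    exact this
  rw [northWord_sorted_iff]
  constructor
  · intro x y hxy hlt
    have h1 := hp x y hxy
    have h2 := hs.1 _ _ h1 (by simpa using hlt)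
    have h3 := hd.word_partner (Sum.inl y.rev)
    rw [h1] at h3
    have := closedBeforeOpen_map_mirror h2
    rwa [← h3] at this
  · intro x x' y y' hx hy hxx hyy hxy l hl m hm ho
    have hx1 := hp x x' hx
    have hy1 := hp y y' hy
    have hx2 : d.partner (Sum.inl x.rev) = Sum.inl x'.rev := by rw [← hx1, hd.partner_partner]
    have hy2 : d.partner (Sum.inl y.rev) = Sum.inl y'.rev := by rw [← hy1, hd.partner_partner]
    obtain ⟨l, hl0, rfl⟩ := List.mem_map.1 hl
    obtain ⟨m, hm0, rfl⟩ := List.mem_map.1 hm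
    rw [Deco.isOpen_mirror] at ho ⊢
    change l ∈ d.word (Sum.inl x.rev) at hl0
    change m ∈ d.word (Sum.inl y.rev) at hm0
    by_contra hmc
    have hmo : m.isOpen = true := by simpa [Deco.isOpen] using hmc
    rcases lt_trichotomy x'.rev y'.rev with hlt | heq | hgt
    · -- the edge of `l` would cover that of `m`
      have he := hd.open_exposed _ m hm0 hmo (Sum.inl x.rev)
      rw [hx2, hy2] at he
      have := x.2
      have := y.2
      have := x'.2
      have := y'.2
      simp only [Fin.lt_def, Fin.val_rev] at hxx hyy hxy hlt
      simp only [posR, Fin.val_rev] at he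
      omega
    · rw [heq, hy1] at hx1
      have : y = x := by simpa using hx1
      exact absurd hxy (by rw [this]; exact lt_irrefl _)
    · have hl1 : l ∈ d.word (Sum.inl x'.rev) := by
        rw [← hx2, hd.word_partner]; exact List.mem_reverse.2 hl0
      have hm1 : m ∈ d.word (Sum.inl y'.rev) := by
        rw [← hy2, hd.word_partner]; exact List.mem_reverse.2 hm0
      have := hs.2 _ _ _ _ hy1 hx1 (by simpa using hyy) (by simpa using hxx) hgt m hm1 l hl1 hmo
      simp [Deco.isOpen, ho] at this

theorem IsLR.mirror {d : PreDiagram k} (hd : d.IsLR) : d.mirror.IsLR where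
  partner_partner := mirror_partner_partner hd.partner_partner
  partner_ne := mirror_partner_ne hd.partner_ne
  planar p q := by
    have := hd.planarR (mirrorNode p) (mirrorNode q)
    simp only [PreDiagram.mirror, posL_mirrorNode]
    rwa [← posL_mirrorNode (mirrorNode p), ← posL_mirrorNode (mirrorNode q), mirrorNode_mirrorNode,
      mirrorNode_mirrorNode] at this
  word_partner p := by
    simp [PreDiagram.mirror, hd.word_partner, mirrorNode_mirrorNode]
  closed_exposed p x hx hc := by
    obtain ⟨y, hy, rfl⟩ := List.mem_map.1 hx
    rw [Deco.isClosed_mirror] at hc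
    exact exposed_mirror.1.2 (hd.open_exposed _ y hy hc)
  open_exposed p x hx hc := by
    obtain ⟨y, hy, rfl⟩ := List.mem_map.1 hx
    rw [Deco.isOpen_mirror] at hc
    exact exposed_mirror.2.2 (hd.closed_exposed _ y hy hc)
  north_sorted h := hd.mirror_sorted (by rwa [propCount_mirror] at h)
  south_sorted h := by
    rw [propCount_mirror] at h
    rw [← northWord_flip, flip_mirror]
    exact hd.flip.mirror_sorted (by rwa [propCount_flip hd.partner_partner])
  loops_undammed h := by
    rw [propCount_mirror] at h
    exact hd.loops_undammed h
  loops_dammed h := by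
    rw [propCount_mirror] at h
    exact hd.loops_dammed h
  vert_nil h := by
    rw [aValue_mirror hd.partner_partner hd.partner_ne] at h
    simp [PreDiagram.mirror, hd.vert_nil h]
  vert_left h i j hij he := by
    rw [aValue_mirror hd.partner_partner hd.partner_ne] at h
    have h1 : d.partner (Sum.inl i.rev) = Sum.inr j.rev := by
      have := congrArg mirrorNode hij
      simp only [PreDiagram.mirror, mirrorNode_mirrorNode] at this
      exact this
    have h2 := hd.vert_right h _ _ h1 (exposed_mirror.1.1 he)
    have h3 : d.mirror.word (Sum.inl i) = (d.word (Sum.inl i.rev)).map Deco.mirror := rfl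
    rw [h3, h2, PreDiagram.mirror, List.filter_map]
    congr 2
    funext x
    exact (Deco.isClosed_mirror x).symm
  vert_right h i j hij he := by
    rw [aValue_mirror hd.partner_partner hd.partner_ne] at h
    have h1 : d.partner (Sum.inl i.rev) = Sum.inr j.rev := by
      have := congrArg mirrorNode hij
      simp only [PreDiagram.mirror, mirrorNode_mirrorNode] at this
      exact this
    have h2 := hd.vert_left h _ _ h1 (exposed_mirror.2.1 he)
    have h3 : d.mirror.word (Sum.inl i) = (d.word (Sum.inl i.rev)).map Deco.mirror := rfl
    rw [h3, h2, PreDiagram.mirror, List.filter_map]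
    congr 2
    funext x
    exact (Deco.isOpen_mirror x).symm
  undecorated h := by
    rw [aValue_mirror hd.partner_partner hd.partner_ne] at h
    refine ⟨fun p => ?_, (hd.undecorated h).2⟩
    simp [PreDiagram.mirror, (hd.undecorated h).1]

theorem PlainConcat.flip {a b c : PreDiagram k} (h : PlainConcat a b c)
    (h1 : c.flip.aValue = c.aValue) : PlainConcat b.flip a.flip c.flip where
  north i := (h.south i).flip
  south i := (h.north i).flip
  loops := by simp only [PreDiagram.flip]; rw [h.loops, add_comm]
  vert hc := by
    rw [h1] at hc
    obtain ⟨w, hw⟩ := h.vert hc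
    exact ⟨w.reverse, by simp [PreDiagram.flip, hw]⟩

theorem PlainConcat.mirror {a b c : PreDiagram k} (h : PlainConcat a b c)
    (h1 : c.mirror.aValue = c.aValue) : PlainConcat a.mirror b.mirror c.mirror where
  north i := by
    have t := (h.north i.rev).mirror
    simp only [Sum.map_inl, mirrorNode_inl, Fin.rev_rev] at t
    exact t
  south i := by
    have t := (h.south i.rev).mirror
    simp only [Sum.map_inr, mirrorNode_inr, Fin.rev_rev] at t
    exact t
  loops := h.loops
  vert hc := by
    rw [h1] at hc
    obtain ⟨w, hw⟩ := h.vert hc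
    exact ⟨w.map Deco.mirror, by simp [PreDiagram.mirror, hw]⟩

theorem flip_simple (i : Fin (n + 1)) : (simple i).flip = simple i := by
  simp only [flip, simple, List.reverse_nil]
  congr 1
  · funext p
    rcases p with x | x <;> simp only [Sum.swap_inl, Sum.swap_inr] <;> split_ifs <;> rfl
  · funext p
    rcases p with x | x <;> rfl

theorem mirror_simple (hn : 2 ≤ n) (i : Fin (n + 1)) : (simple i).mirror = simple i.rev := by
  have h1 : ∀ x : Fin (n + 2), x.rev = i.castSucc ↔ x = i.rev.succ := fun x => by
    rw [← Fin.rev_inj, Fin.rev_rev, Fin.rev_castSucc]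
  have h2 : ∀ x : Fin (n + 2), x.rev = i.succ ↔ x = i.rev.castSucc := fun x => by
    rw [← Fin.rev_inj, Fin.rev_rev, Fin.rev_succ]
  have hne : i.rev.succ ≠ i.rev.castSucc := by simp [Fin.ext_iff]
  simp only [mirror, simple, List.map_nil]
  congr 1
  · funext p
    rcases p with x | x <;> simp only [mirrorNode_inl, mirrorNode_inr, h1, h2]
    · by_cases hx : x = i.rev.succ
      · rw [if_pos hx, if_neg (by rw [hx]; exact hne), if_pos hx, mirrorNode_inl, Fin.rev_succ]
      · rw [if_neg hx, if_neg hx]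
        split_ifs
        · rw [mirrorNode_inl, Fin.rev_castSucc]
        · rw [mirrorNode_inr, Fin.rev_rev]
    · by_cases hx : x = i.rev.succ
      · rw [if_pos hx, if_neg (by rw [hx]; exact hne), if_pos hx, mirrorNode_inr, Fin.rev_succ]
      · rw [if_neg hx, if_neg hx]
        split_ifs
        · rw [mirrorNode_inr, Fin.rev_castSucc]
        · rw [mirrorNode_inl, Fin.rev_rev]
  · have h0 : (i.rev = 0 ↔ i = Fin.last n) := by
      rw [← Fin.rev_inj, Fin.rev_rev, Fin.rev_zero]
    have h0' : (i.rev = Fin.last n ↔ i = 0) := by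
      rw [← Fin.rev_inj, Fin.rev_rev, Fin.rev_last]
    have hnn : (0 : Fin (n + 1)) ≠ Fin.last n := by simp [Fin.ext_iff]; omega
    funext p
    have : (mirrorNode p).elim id id = (p.elim id id).rev := by rcases p with x | x <;> rfl
    simp only [this, h1, h2, h0, h0', or_comm]
    split_ifs <;> simp_all [Deco.mirror]

theorem Step.flip {c a : PreDiagram (n + 2)} (h : Step c a) : Step c.flip a.flip := by
  obtain ⟨hc, ha, i, h⟩ := h
  have hv := aValue_flip hc.partner_partner hc.partner_ne
  refine ⟨hc.flip, ha.flip, i, ?_⟩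
  rcases h with ⟨h, h'⟩ | ⟨h, h'⟩
  · right
    refine ⟨by simpa [flip_simple] using h.flip hv, fun e => h' ?_⟩
    simp only [PreDiagram.flip, Sum.swap_inr] at e
    rw [← Sum.swap_swap (a.partner _), e, Sum.swap_inr]
  · left
    refine ⟨by simpa [flip_simple] using h.flip hv, fun e => h' ?_⟩
    simp only [PreDiagram.flip, Sum.swap_inl] at e
    rw [← Sum.swap_swap (a.partner _), e, Sum.swap_inl]

theorem Step.mirror (hn : 2 ≤ n) {c a : PreDiagram (n + 2)} (h : Step c a) :
    Step c.mirror a.mirror := by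
  obtain ⟨hc, ha, i, h⟩ := h
  have hv := aValue_mirror hc.partner_partner hc.partner_ne
  refine ⟨hc.mirror, ha.mirror, i.rev, ?_⟩
  rcases h with ⟨h, h'⟩ | ⟨h, h'⟩
  · left
    refine ⟨by simpa [mirror_simple hn] using h.mirror hv, fun e => h' ?_⟩
    have e := congrArg mirrorNode e
    simp only [PreDiagram.mirror, mirrorNode_mirrorNode, mirrorNode_inl, Fin.rev_castSucc,
      Fin.rev_succ, Fin.rev_rev] at e
    rw [← e, ha.partner_partner]
  · right
    refine ⟨by simpa [mirror_simple hn] using h.mirror hv, fun e => h' ?_⟩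
    have e := congrArg mirrorNode e
    simp only [PreDiagram.mirror, mirrorNode_mirrorNode, mirrorNode_inr, Fin.rev_castSucc,
      Fin.rev_succ, Fin.rev_rev] at e
    rw [← e, ha.partner_partner]

theorem Red.flip {c a : PreDiagram (n + 2)} (h : Red c a) : Red c.flip a.flip := by
  induction h with
  | refl => exact .refl
  | tail _ h ih => exact ih.tail h.flip

theorem Red.mirror (hn : 2 ≤ n) {c a : PreDiagram (n + 2)} (h : Red c a) :
    Red c.mirror a.mirror := by
  induction h with
  | refl => exact .refl
  | tail _ h ih => exact ih.tail (h.mirror hn)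

theorem zone_swap (p : Node (n + 2)) : zone p.swap = zone p := by
  rcases p with x | x <;> rfl

theorem column_sub {m x : ℕ} (hm : m ≠ 0) (hx : x ≤ m) :
    column m (m - x) = (column m x).mirror := by
  unfold column
  by_cases h0 : x = 0
  · rw [if_neg (by omega), if_pos (by omega), if_pos h0]; rfl
  · by_cases h1 : x = m
    · rw [if_pos (by omega), if_neg h0, if_pos h1]; rfl
    · rw [if_neg (by omega), if_neg (by omega), if_neg h0, if_neg h1]; rfl

theorem zone_mirrorNode (p : Node (n + 2)) : zone (mirrorNode p) = (zone p).mirror := by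
  unfold zone
  have h : ((mirrorNode p).elim id id).val = n + 1 - (p.elim id id).val := by
    rcases p with x | x <;> simp [mirrorNode_inl, mirrorNode_inr, Fin.val_rev]
  rw [h, column_sub (by omega)]
  have := (p.elim id id).2
  omega

theorem Taut.flip {d : PreDiagram (n + 2)} (hd : d.Taut) : d.flip.Taut where
  isLR := hd.isLR.flip
  nonprop p hp := by
    have := hd.nonprop p.swap (by rwa [isProp_flip] at hp)
    rw [zone_swap] at this
    rw [PreDiagram.flip]
    simp only
    rwa [zone_swap]
  prop h p hp := by
    have := hd.prop (by rwa [aValue_flip hd.isLR.partner_partner hd.isLR.partner_ne] at h) p.swap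
      (by rwa [isProp_flip] at hp)
    rw [zone_swap] at this
    rw [PreDiagram.flip]
    simp only
    rwa [zone_swap]
  vert h := by
    obtain ⟨i, j, hi, hj, h1, h2, hw⟩ :=
      hd.vert (by rwa [aValue_flip hd.isLR.partner_partner hd.isLR.partner_ne] at h)
    refine ⟨j, i, hj, hi, ?_, ?_, hw.reverse⟩ <;> simp [PreDiagram.flip, h1, h2]
  loops := hd.loops

theorem Taut.mirror (hn : 2 ≤ n) {d : PreDiagram (n + 2)} (hd : d.Taut) : d.mirror.Taut where
  isLR := hd.isLR.mirror
  nonprop p hp := by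
    obtain ⟨h1, h2, h3⟩ := hd.nonprop (mirrorNode p) (by rwa [isProp_mirror] at hp)
    have := h1.mirror
    rw [← zone_mirrorNode, ← zone_mirrorNode, mirrorNode_mirrorNode] at this
    rw [PreDiagram.mirror]
    simp only [count_map_mirror]
    exact ⟨this, h3, h2⟩
  prop h p hp := by
    have := hd.prop (by rwa [aValue_mirror hd.isLR.partner_partner hd.isLR.partner_ne] at h)
      (mirrorNode p) (by rwa [isProp_mirror] at hp)
    have := this.mirror
    rw [← zone_mirrorNode, ← zone_mirrorNode, mirrorNode_mirrorNode] at this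
    exact this
  vert h := by
    obtain ⟨i, j, hi, hj, h1, h2, hw⟩ :=
      hd.vert (by rwa [aValue_mirror hd.isLR.partner_partner hd.isLR.partner_ne] at h)
    have h1' := hd.isLR.partner_partner (Sum.inl ⟨i, by omega⟩)
    have h2' := hd.isLR.partner_partner (Sum.inr ⟨j, by omega⟩)
    rw [h1] at h1'
    rw [h2] at h2'
    have hr : ∀ (x y : ℕ) (hx : x < n + 2) (hy : y < n + 2), x + y = n + 1 →
        (⟨x, hx⟩ : Fin (n + 2)).rev = ⟨y, hy⟩ := by
      intro x y hx hy hxy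
      ext
      simp [Fin.val_rev]
      omega
    refine ⟨n - i, n - j, by omega, by omega, ?_, ?_, ?_⟩
    · simp only [PreDiagram.mirror, mirrorNode_inl]
      rw [hr _ (i + 1) _ (by omega) (by omega), h1', mirrorNode_inl,
        hr i (n - i + 1) _ (by omega) (by omega)]
    · simp only [PreDiagram.mirror, mirrorNode_inr]
      rw [hr _ (j + 1) _ (by omega) (by omega), h2', mirrorNode_inr,
        hr j (n - j + 1) _ (by omega) (by omega)]
    · rw [column_sub (by omega) (by omega), column_sub (by omega) (by omega)]
      exact hw.mirror
  loops := hd.loops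

theorem excess_flip (d : PreDiagram (n + 2)) : d.flip.excess = d.excess := by
  classical
  rw [excess, excess, ← Equiv.sum_comp (Equiv.sumComm _ _)]
  refine Finset.sum_congr rfl fun p _ => ?_
  simp only [isProp_flip]
  simp [flip]

theorem surplus_map_mirror (b : Prop) [Decidable b] (w : List Deco) :
    surplus b (w.map Deco.mirror) = surplus b w := by
  unfold surplus
  simp only [List.length_map, count_map_mirror, Deco.mirror, Nat.add_comm]

theorem excess_mirror (d : PreDiagram (n + 2)) : d.mirror.excess = d.excess := by
  classical
  let e : Node (n + 2) ≃ Node (n + 2) :=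
    ⟨mirrorNode, mirrorNode, mirrorNode_mirrorNode, mirrorNode_mirrorNode⟩
  rw [excess, excess, ← Equiv.sum_comp e]
  refine Finset.sum_congr rfl fun p _ => ?_
  have h : d.mirror.word (e p) = (d.word p).map Deco.mirror := by
    simp [e, PreDiagram.mirror, mirrorNode_mirrorNode]
  have h' : d.mirror.IsProp (e p) ↔ d.IsProp p := by
    simp [e, isProp_mirror, mirrorNode_mirrorNode]
  simp only [h, h', surplus_map_mirror]

end symmetries

/-! ### Flattening the north face -/

section flatten

variable {n : ℕ}

/-- `a` is a taut diagram obtained from `c` by splitting off simple diagrams, and the excess has not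
grown. -/
structure Reach (c a : PreDiagram (n + 2)) : Prop where
  taut : a.Taut
  red : Red c a
  excess_le : a.excess ≤ c.excess
  loops : a.loops = c.loops

theorem Reach.refl {c : PreDiagram (n + 2)} (hc : c.Taut) : Reach c c :=
  ⟨hc, .refl, le_rfl, rfl⟩

theorem Reach.trans {c a b : PreDiagram (n + 2)} (h : Reach c a) (h' : Reach a b) : Reach c b :=
  ⟨h'.taut, h.red.trans h'.red, h'.excess_le.trans h.excess_le, h'.loops.trans h.loops⟩

theorem Reach.flip {c a : PreDiagram (n + 2)} (h : Reach c a) : Reach c.flip a.flip :=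
  ⟨h.taut.flip, h.red.flip, by rw [excess_flip, excess_flip]; exact h.excess_le, h.loops⟩

theorem Reach.mirror (hn : 2 ≤ n) {c a : PreDiagram (n + 2)} (h : Reach c a) :
    Reach c.mirror a.mirror :=
  ⟨h.taut.mirror hn, h.red.mirror hn, by rw [excess_mirror, excess_mirror]; exact h.excess_le,
    h.loops⟩

theorem Slide.reach {c a : PreDiagram (n + 2)} {i : ℕ} {hi : i + 2 < n + 2} {w : List Deco}
    (h : Slide c a i hi w) (hc : c.Taut) (hn : 2 ≤ n) : Reach c a :=
  ⟨h.taut hc hn, h.red hc.isLR hn, h.excess_le hc.isLR, h.loops⟩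

theorem Slide.partner_south {c a : PreDiagram (n + 2)} {i : ℕ} {hi : i + 2 < n + 2} {w : List Deco}
    (h : Slide c a i hi w) (hc : c.IsLR) (x y : Fin (n + 2)) :
    a.partner (Sum.inr x) = Sum.inr y ↔ c.partner (Sum.inr x) = Sum.inr y := by
  by_cases hx : Sum.inr x = c.partner (Sum.inl ⟨i + 2, hi⟩)
  · rw [hx, h.partner_far, hc.partner_partner]
    simp
  · rw [(h.other _ (by simp) (by simp) (by simp) hx).1]

/-- All non-propagating edges in the north face join neighbouring nodes. -/
def FlatNorth (d : PreDiagram (n + 2)) : Prop :=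
  ∀ x y : Fin (n + 2), d.partner (Sum.inl x) = Sum.inl y → x.val + 1 = y.val ∨ y.val + 1 = x.val

theorem flatNorth_flip {d : PreDiagram (n + 2)} : d.flip.FlatNorth ↔
    ∀ x y : Fin (n + 2), d.partner (Sum.inr x) = Sum.inr y →
      x.val + 1 = y.val ∨ y.val + 1 = x.val := by
  have : ∀ x y, d.flip.partner (Sum.inl x) = Sum.inl y ↔ d.partner (Sum.inr x) = Sum.inr y := by
    intro x y
    simp only [flip, Sum.swap_inl]
    rcases d.partner (Sum.inr x) <;> simp
  simp only [FlatNorth, this]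

theorem FlatNorth.mirror {d : PreDiagram (n + 2)} (hd : d.FlatNorth) : d.mirror.FlatNorth := by
  intro x y hxy
  have := congrArg mirrorNode hxy
  simp only [PreDiagram.mirror, mirrorNode_mirrorNode, mirrorNode_inl] at this
  have := hd _ _ this
  simp only [Fin.val_rev] at this
  omega

theorem IsLR.word_eq_nil {d : PreDiagram (n + 2)} (hd : d.IsLR) {p : Node (n + 2)}
    (h : ¬ d.Exposed posL p) (h' : ¬ d.Exposed posR p) : d.word p = [] := by
  rw [List.eq_nil_iff_forall_not_mem]
  intro x hx
  by_cases hc : x.isClosed = true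
  · exact h (hd.closed_exposed p x hx hc)
  · exact h' (hd.open_exposed p x hx (by simpa [Deco.isOpen] using hc))

theorem Taut.exists_slide {c : PreDiagram (n + 2)} {i : ℕ} {hi : i + 2 < n + 2} (hc : c.Taut)
    (cup : c.partner (Sum.inl ⟨i, by omega⟩) = Sum.inl ⟨i + 1, by omega⟩)
    (cup_word : c.word (Sum.inl ⟨i, by omega⟩) = mark n i)
    (word : ∃ w, c.word (Sum.inl ⟨i + 2, hi⟩) = shift n i ++ w)
    (vert : c.aValue = 1 → ∃ v, c.vert = shift n i ++ v) :
    ∃ a w, Slide c a i hi w := by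
  obtain ⟨w, hw⟩ := word
  by_cases h : c.aValue = 1
  · obtain ⟨v, hv⟩ := vert h
    obtain ⟨a, ha, _⟩ := PreDiagram.exists_slide (v := v) hc.isLR cup cup_word hw (fun _ => hv)
      (fun h' => absurd h h')
    exact ⟨a, w, ha⟩
  · obtain ⟨a, ha, _⟩ := PreDiagram.exists_slide (v := []) hc.isLR cup cup_word hw
      (fun h' => absurd h' h) (fun _ => rfl)
    exact ⟨a, w, ha⟩

theorem shift_mid {i : ℕ} (h0 : i ≠ 0) (h1 : i + 1 < n) : shift n i = [] ∧ mark n i = [] := by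
  rcases shift_cases n i (by omega) with h | h | h | h
  · omega
  · exact ⟨h.2.2.1, h.2.2.2.1⟩
  · omega
  · omega

theorem shift_zero (hn : 2 ≤ n) : shift n 0 = [.dot] := by
  rcases shift_cases n 0 (by omega) with h | h | h | h
  · exact h.2.2.1
  all_goals omega

theorem shift_last {i : ℕ} (hn : 2 ≤ n) (h1 : i + 1 = n) :
    shift n i = [.odot] ∧ mark n i = [] := by
  rcases shift_cases n i (by omega) with h | h | h | h
  · omega
  · omega
  · exact ⟨h.2.2.1, h.2.2.2.1⟩
  · omega

/-- A walk from the right column to somewhere else starts with an open circle. -/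
theorem walk_R {w : List Deco} {t : Zone} (h : Walk .R w t) (ht : t ≠ .R) :
    ∃ w', w = .odot :: w' := by
  cases h with
  | nil => exact absurd rfl ht
  | odotR h => exact ⟨_, rfl⟩

/-- Below a north edge that does not join neighbouring nodes, there is one whose right end is
preceded by an edge joining neighbouring nodes. -/
theorem IsLR.exists_inner {c : PreDiagram (n + 2)} (hc : c.IsLR) :
    ∀ (m u v : ℕ) (hu : u < n + 2) (hv : v < n + 2), v ≤ u + m → u + 1 < v →
      c.partner (Sum.inl ⟨u, hu⟩) = Sum.inl ⟨v, hv⟩ →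
      ∃ (i u' : ℕ) (hi : i + 2 < n + 2) (hu' : u' < i),
        c.partner (Sum.inl ⟨i, by omega⟩) = Sum.inl ⟨i + 1, by omega⟩ ∧
        c.partner (Sum.inl ⟨u', by omega⟩) = Sum.inl ⟨i + 2, hi⟩ := by
  intro m
  induction m using Nat.strong_induction_on with
  | _ m ih =>
    intro u v hu hv hm huv h
    have p1 := hc.planar (Sum.inl ⟨u, hu⟩) (Sum.inl ⟨v - 1, by omega⟩)
    have h' := hc.partner_partner (Sum.inl ⟨u, hu⟩)
    rw [h] at h' p1
    rcases ht : c.partner (Sum.inl ⟨v - 1, by omega⟩) with ⟨t, htn⟩ | ⟨t, htn⟩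
    · have ht' := hc.partner_partner (Sum.inl ⟨v - 1, by omega⟩)
      have hne := hc.partner_ne (Sum.inl ⟨v - 1, by omega⟩)
      have p2 := hc.planar (Sum.inl ⟨t, htn⟩) (Sum.inl ⟨u, hu⟩)
      rw [ht] at ht' hne p1
      rw [ht', h] at p2
      simp only [posL] at p1 p2
      have n1 : t ≠ u := by rintro rfl; rw [h] at ht'; simp at ht'; omega
      have n2 : t ≠ v := by rintro rfl; rw [h'] at ht'; simp at ht'; omega
      have n3 : t ≠ v - 1 := by rintro rfl; exact hne rfl
      by_cases h2 : t + 2 = v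
      · subst h2
        exact ⟨t, u, hv, by omega, ht', h⟩
      · exact ih (v - 1 - t) (by omega) t (v - 1) htn (by omega) (by omega) (by omega) ht'
    · rw [ht] at p1
      simp only [posL] at p1
      omega

open Classical in
/-- The total length of the non-propagating edges. -/
noncomputable def span (d : PreDiagram (n + 2)) : ℕ :=
  ∑ p, if d.IsProp p then 0 else
    (posL (d.partner p) - posL p) + (posL p - posL (d.partner p))

/-- The enclosing edge `{u, i + 2}` is shortened to `{u, i}`. -/
theorem Slide.span_lt {c a : PreDiagram (n + 2)} {i : ℕ} {hi : i + 2 < n + 2} {w : List Deco}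
    (h : Slide c a i hi w) (hc : c.IsLR) {u : ℕ} (hu : u < i)
    (hcu : c.partner (Sum.inl ⟨i + 2, hi⟩) = Sum.inl ⟨u, by omega⟩) : a.span < c.span := by
  classical
  have hle : ∀ p, (if a.IsProp (Equiv.swap (Sum.inl ⟨i, by omega⟩) (Sum.inl ⟨i + 2, hi⟩) p) then 0
      else (posL (a.partner (Equiv.swap (Sum.inl ⟨i, by omega⟩) (Sum.inl ⟨i + 2, hi⟩) p)) -
        posL (Equiv.swap (Sum.inl ⟨i, by omega⟩) (Sum.inl ⟨i + 2, hi⟩) p)) +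
        (posL (Equiv.swap (Sum.inl ⟨i, by omega⟩) (Sum.inl ⟨i + 2, hi⟩) p) -
        posL (a.partner (Equiv.swap (Sum.inl ⟨i, by omega⟩) (Sum.inl ⟨i + 2, hi⟩) p)))) ≤
      (if c.IsProp p then 0 else
        (posL (c.partner p) - posL p) + (posL p - posL (c.partner p))) := by
    intro p
    simp only [h.isProp_swap hc p]
    split_ifs
    · exact le_rfl
    obtain ⟨f0, f1, f2⟩ := h.far_ne hc
    rcases slide_cases c i hi p with rfl | rfl | rfl | rfl | ⟨h0, h1, h2, h3⟩
    · rw [Equiv.swap_apply_left, h.partner_two, h.cup]; simp only [posL]; omega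
    · rw [Equiv.swap_apply_of_ne_of_ne (by simp) (by simp), h.partner_one, h.cup' hc]
      simp only [posL]; omega
    · rw [Equiv.swap_apply_right, h.partner_zero, hcu]; simp only [posL]; omega
    · rw [Equiv.swap_apply_of_ne_of_ne f0 f2, h.partner_far, hc.partner_partner, hcu]
      simp only [posL]; omega
    · rw [Equiv.swap_apply_of_ne_of_ne h0 h2, (h.other p h0 h1 h2 h3).1]
  rw [span, span, ← Equiv.sum_comp (Equiv.swap (Sum.inl ⟨i, by omega⟩) (Sum.inl ⟨i + 2, hi⟩))]
  refine Finset.sum_lt_sum (fun p _ => hle p) ⟨Sum.inl ⟨i + 2, hi⟩, Finset.mem_univ _, ?_⟩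
  have hp : ¬ c.IsProp (Sum.inl ⟨i + 2, hi⟩) := not_isProp_inl.2 ⟨_, hcu⟩
  have hq := h.isProp_swap hc (Sum.inl ⟨i + 2, hi⟩)
  rw [Equiv.swap_apply_right] at hq
  simp only [hq, if_neg hp, Equiv.swap_apply_right, h.partner_zero, hcu, posL]
  omega

/-- The north face can be flattened without changing the non-propagating edges of the south face. -/
theorem Taut.exists_flatNorth (hn : 2 ≤ n) :
    ∀ (m : ℕ) (c : PreDiagram (n + 2)), c.span ≤ m → c.Taut → ∃ a, Reach c a ∧ a.FlatNorth ∧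
      ∀ x y, a.partner (Sum.inr x) = Sum.inr y ↔ c.partner (Sum.inr x) = Sum.inr y := by
  intro m
  induction m using Nat.strong_induction_on with
  | _ m ih =>
    intro c hm hc
    by_cases hf : c.FlatNorth
    · exact ⟨c, .refl hc, hf, fun _ _ => Iff.rfl⟩
    have hlr := hc.isLR
    have : ∃ (u v : ℕ) (hu : u < n + 2) (hv : v < n + 2), u + 1 < v ∧
        c.partner (Sum.inl ⟨u, hu⟩) = Sum.inl ⟨v, hv⟩ := by
      rw [FlatNorth] at hf
      push Not at hf
      obtain ⟨x, y, hxy, h1, h2⟩ := hf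
      have hne : x.val ≠ y.val := fun e => hlr.partner_ne (Sum.inl x) (by rw [hxy, Fin.ext e])
      rcases lt_or_gt_of_ne hne with hlt | hlt
      · exact ⟨x, y, x.2, y.2, by omega, hxy⟩
      · exact ⟨y, x, y.2, x.2, by omega, by rw [← hxy, hlr.partner_partner]⟩
    obtain ⟨u, v, hu, hv, huv, h⟩ := this
    obtain ⟨i, u, hi, hui, h1, h2⟩ := hlr.exists_inner (v - u) u v hu hv (by omega) huv h
    have h3 := hlr.partner_partner (Sum.inl ⟨u, by omega⟩)
    rw [h2] at h3
    -- the edge `{i, i + 1}` is enclosed by the edge `{u, i + 2}`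
    have hw : c.word (Sum.inl ⟨i, by omega⟩) = [] := by
      apply hlr.word_eq_nil
      · intro he
        have := he (Sum.inl ⟨u, by omega⟩)
        rw [h1, h2] at this
        simp only [posL] at this
        omega
      · intro he
        have := he (Sum.inl ⟨i + 2, hi⟩)
        rw [h1, h3] at this
        simp only [posR] at this
        omega
    have ha : c.aValue ≠ 1 :=
      aValue_ne_one_of_two h1 h2 (by simp) (by simp; omega) (by simp; omega)
    have hs : ∃ a w, Slide c a i hi w := by
      by_cases hin : i + 1 = n
      · obtain ⟨s1, s2⟩ := shift_last hn hin
        refine hc.exists_slide h1 (by rw [hw, s2]) ?_ fun h => absurd h ha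
        have := (hc.nonprop (Sum.inl ⟨i + 2, hi⟩) (not_isProp_inl.2 ⟨_, h3⟩)).1
        rw [h3] at this
        have hz : zone (Sum.inl ⟨i + 2, hi⟩ : Node (n + 2)) = .R := by
          simp [zone, column]; omega
        rw [hz] at this
        obtain ⟨w, hw⟩ := walk_R this (by
          have hn1 : u ≠ n + 1 := by omega
          simp only [zone, column, Sum.elim_inl, id, hn1, if_false]
          split_ifs <;> simp)
        exact ⟨w, by rw [s1, hw]; rfl⟩
      · obtain ⟨s1, s2⟩ := shift_mid (n := n) (i := i) (by omega) (by omega)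
        exact hc.exists_slide h1 (by rw [hw, s2]) ⟨_, by rw [s1]; rfl⟩ fun h => absurd h ha
    obtain ⟨a, w, hs⟩ := hs
    have hr := hs.reach hc hn
    obtain ⟨b, hb, hbf, hbs⟩ :=
      ih a.span (lt_of_lt_of_le (hs.span_lt hlr hui h3) hm) a le_rfl hr.taut
    exact ⟨b, hr.trans hb, hbf, fun x y => (hbs x y).trans (hs.partner_south hlr x y)⟩

/-- Both faces can be flattened. -/
theorem Taut.exists_flat (hn : 2 ≤ n) {c : PreDiagram (n + 2)} (hc : c.Taut) :
    ∃ a, Reach c a ∧ a.FlatNorth ∧ a.flip.FlatNorth := by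
  obtain ⟨a, ha, hf, -⟩ := Taut.exists_flatNorth hn _ c le_rfl hc
  obtain ⟨b, hb, hf', hs⟩ := Taut.exists_flatNorth hn _ a.flip le_rfl ha.taut.flip
  refine ⟨b.flip, ha.trans (by simpa [flip_flip] using hb.flip), ?_, by rwa [flip_flip]⟩
  rw [flatNorth_flip]
  intro x y hxy
  rw [hs] at hxy
  apply hf x y
  simp only [PreDiagram.flip, Sum.swap_inr] at hxy
  rw [← Sum.swap_swap (a.partner _), hxy, Sum.swap_inr]

end flatten

/-! ### Removing surplus decorations -/

section surplus

variable {n : ℕ}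

/-- An edge behind a row of edges joining neighbouring nodes at the left wall can be pulled to the
wall, where it loses its first closed circle. -/
theorem Taut.pull_left (hn : 2 ≤ n) : ∀ (y : ℕ) (hy : 2 * y + 2 < n + 2) {c : PreDiagram (n + 2)},
    c.Taut →
    (∀ (j : ℕ) (hj : j ≤ y),
      c.partner (Sum.inl ⟨2 * j, by omega⟩) = Sum.inl ⟨2 * j + 1, by omega⟩ ∧
      c.word (Sum.inl ⟨2 * j, by omega⟩) = mark n (2 * j)) →
    (∃ w, c.word (Sum.inl ⟨2 * y + 2, hy⟩) = .dot :: w) →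
    (c.aValue = 1 → ∃ v, c.vert = .dot :: v) →
    (c.IsProp (Sum.inl ⟨2 * y + 2, hy⟩) ∨ 2 ≤ (c.word (Sum.inl ⟨2 * y + 2, hy⟩)).count .dot) →
    ∃ a, Reach c a ∧ a.excess < c.excess := by
  intro y
  induction y with
  | zero =>
    intro hy c hc cup hw hv hs
    obtain ⟨a, w, h⟩ := Taut.exists_slide (i := 0) (hi := hy) hc (cup 0 le_rfl).1 (cup 0 le_rfl).2
      (by rw [shift_zero hn]; exact hw) (by rw [shift_zero hn]; exact hv)
    refine ⟨a, h.reach hc hn, h.excess_lt hc.isLR ?_⟩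
    have := h.word
    rw [shift_zero hn] at this
    simp only [Nat.mul_zero, Nat.zero_add] at this hs ⊢
    rw [this] at hs ⊢
    unfold surplus
    split_ifs with hp
    · simp
    · rcases hs with hs | hs
      · exact absurd hs hp
      · simp only [List.singleton_append, List.count_cons_self, List.count_cons] at hs ⊢
        simp at hs ⊢
        omega
  | succ y ih =>
    intro hy c hc cup hw hv hs
    have hlr := hc.isLR
    have c0 := (cup 0 (by omega)).1
    have c1 := cup (y + 1) le_rfl
    have ha : c.aValue ≠ 1 :=
      aValue_ne_one_of_two c0 c1.1 (by simp) (by simp) (by simp)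
    -- a walk from the right column cannot start with a closed circle
    have hlast : 2 * y + 2 + 1 ≠ n := by
      intro e
      obtain ⟨w, hw⟩ := hw
      have hwalk : Walk (zone (Sum.inl ⟨2 * (y + 1) + 2, hy⟩ : Node (n + 2)))
          (c.word (Sum.inl ⟨2 * (y + 1) + 2, hy⟩))
          (zone (c.partner (Sum.inl ⟨2 * (y + 1) + 2, hy⟩))) := by
        by_cases hp : c.IsProp (Sum.inl ⟨2 * (y + 1) + 2, hy⟩)
        · exact hc.prop ha _ hp
        · exact (hc.nonprop _ hp).1
      have hz : zone (Sum.inl ⟨2 * (y + 1) + 2, hy⟩ : Node (n + 2)) = .R := by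
        simp [zone, column]; omega
      rw [hz, hw] at hwalk
      cases hwalk
    obtain ⟨s1, s2⟩ := shift_mid (n := n) (i := 2 * (y + 1)) (by omega) (by omega)
    obtain ⟨a, w', h⟩ := Taut.exists_slide (i := 2 * (y + 1)) (hi := hy) hc c1.1 c1.2
      ⟨_, by rw [s1]; rfl⟩ fun h => absurd h ha
    have hr := h.reach hc hn
    have hw' := h.word
    rw [s1, List.nil_append] at hw'
    suffices ∃ b, Reach a b ∧ b.excess < a.excess by
      obtain ⟨b, hb, hlt⟩ := this
      exact ⟨b, hr.trans hb, lt_of_lt_of_le hlt hr.excess_le⟩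
    refine ih (by omega) hr.taut ?_ ?_ ?_ ?_
    · intro j hj
      have hcj := cup j (by omega)
      have := h.other (Sum.inl ⟨2 * j, by omega⟩) (by simp; omega) (by simp; omega)
        (by simp; omega) (fun e => by
          have := hlr.partner_partner (Sum.inl ⟨2 * (y + 1) + 2, hy⟩)
          rw [← e, hcj.1] at this
          simp at this
          try omega)
      rw [this.1, this.2]
      exact hcj
    · have := h.word_zero
      rw [← hw'] at this
      rw [← this] at hw
      exact hw
    · intro h1
      rw [h.aValue_eq hlr] at h1
      exact absurd h1 ha
    · have hp := h.isProp_swap hlr (Sum.inl ⟨2 * (y + 1) + 2, hy⟩)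
      rw [Equiv.swap_apply_right] at hp
      have := h.word_zero
      rw [← hw'] at this
      rw [← hp, ← this] at hs
      exact hs

/-- No propagating edge is to the left of an edge that can be deformed to touch the left wall. -/
theorem IsLR.not_isProp_of_exposed {c : PreDiagram (n + 2)} (hc : c.IsLR) {x z : Fin (n + 2)}
    (hzx : z < x) (he : c.Exposed posL (Sum.inl x))
    (hx : c.IsProp (Sum.inl x) ∨ ∃ y, c.partner (Sum.inl x) = Sum.inl y ∧ x < y) :
    ¬ c.IsProp (Sum.inl z) := by
  intro hz
  obtain ⟨z', hz'⟩ := isProp_inl.1 hz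
  have h1 := he (Sum.inl z)
  have h2 := hc.planar (Sum.inl z) (Sum.inl x)
  rw [hz'] at h1 h2
  rcases hx with hx | ⟨y, hy, hxy⟩
  · obtain ⟨x', hx'⟩ := isProp_inl.1 hx
    have hne : x' ≠ z' := by
      rintro rfl
      have e1 := hc.partner_partner (Sum.inl x)
      have e2 := hc.partner_partner (Sum.inl z)
      rw [hx'] at e1
      rw [hz', e1] at e2
      simp only [Sum.inl.injEq] at e2
      omega
    have := Fin.val_ne_of_ne hne
    rw [hx'] at h1 h2
    simp only [posL] at h1 h2
    omega
  · rw [hy] at h1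
    simp only [posL] at h1
    omega

/-- If the nodes left of `x` are joined among themselves in neighbouring pairs, then these pairs are
`{2 j, 2 j + 1}`. -/
theorem IsLR.cups_left {c : PreDiagram (n + 2)} (hc : c.IsLR) (hf : c.FlatNorth) {x : ℕ}
    (hx : x < n + 2)
    (hleft : ∀ z : Fin (n + 2), z.val < x →
      ¬ c.IsProp (Sum.inl z) ∧ c.partner (Sum.inl z) ≠ Sum.inl ⟨x, hx⟩)
    (j : ℕ) (hjx : 2 * j < x) : 2 * j + 1 < x ∧ ∀ h : 2 * j + 1 < n + 2,
      c.partner (Sum.inl ⟨2 * j, by omega⟩) = Sum.inl ⟨2 * j + 1, h⟩ := by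
  induction j using Nat.strong_induction_on with
  | _ j ih =>
    obtain ⟨h1, h2⟩ := hleft ⟨2 * j, by omega⟩ hjx
    obtain ⟨⟨y, hy⟩, hy'⟩ := not_isProp_inl.1 h1
    have h3 := hf _ _ hy'
    simp only at h3
    have hyj : y = 2 * j + 1 := by
      rcases h3 with h3 | h3
      · exact h3.symm
      · exfalso
        obtain ⟨j, rfl⟩ : ∃ j', j = j' + 1 := ⟨j - 1, by omega⟩
        have := (ih j (by omega) (by omega)).2 (by omega)
        have h4 := hc.partner_partner (Sum.inl ⟨2 * j, by omega⟩)
        obtain rfl : y = 2 * j + 1 := by omega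
        have h5 := hc.partner_partner (Sum.inl ⟨2 * (j + 1), by omega⟩)
        rw [this] at h4
        rw [hy', h4] at h5
        simp at h5
    subst hyj
    refine ⟨?_, fun _ => hy'⟩
    by_contra hcon
    obtain rfl : x = 2 * j + 1 := by omega
    exact h2 hy'

/-- A non-propagating edge between neighbouring nodes that touches each wall at most once is
decorated as in a simple diagram. -/
theorem Taut.word_eq_mark (hn : 2 ≤ n) {c : PreDiagram (n + 2)} (hc : c.Taut) {i : ℕ}
    (hi : i + 1 < n + 2) (h : c.partner (Sum.inl ⟨i, by omega⟩) = Sum.inl ⟨i + 1, hi⟩)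
    (h1 : (c.word (Sum.inl ⟨i, by omega⟩)).count .dot ≤ 1)
    (h2 : (c.word (Sum.inl ⟨i, by omega⟩)).count .odot ≤ 1) :
    c.word (Sum.inl ⟨i, by omega⟩) = mark n i := by
  obtain ⟨hw, -, -⟩ := hc.nonprop _ (not_isProp_inl.2 ⟨_, h⟩)
  rw [h] at hw
  have z1 : zone (Sum.inl ⟨i, by omega⟩ : Node (n + 2)) = column (n + 1) i := rfl
  have z2 : zone (Sum.inl ⟨i + 1, hi⟩ : Node (n + 2)) = column (n + 1) (i + 1) := rfl
  rw [z1, z2] at hw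
  generalize c.word (Sum.inl ⟨i, by omega⟩) = u at *
  have e1 := hw.count_dot
  have e2 := hw.count_odot
  have d1 : Even (u.count .dot) ↔ u.count .dot = 0 := by
    constructor
    · rintro ⟨r, hr⟩; omega
    · intro h; simp [h]
  have d2 : Even (u.count .odot) ↔ u.count .odot = 0 := by
    constructor
    · rintro ⟨r, hr⟩; omega
    · intro h; simp [h]
  rw [d1] at e1
  rw [d2] at e2
  unfold column at hw e1 e2
  unfold mark
  rw [if_neg (Nat.succ_ne_zero i)] at hw e1 e2
  by_cases h0 : i = 0
  · rw [if_pos h0, if_neg (by omega)] at hw e1 e2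
    rw [if_pos h0]
    simp at e1 e2
    cases hw with
    | dotL hw =>
      rw [hw.eq_nil_of_count (by simp at h1; simpa using h1) (by simpa using e2)]
  · rw [if_neg h0, if_neg (by omega)] at hw e1 e2
    rw [if_neg h0]
    by_cases hin : i = n
    · rw [if_pos (by omega)] at hw e1 e2
      rw [if_pos hin]
      simp at e1 e2
      cases hw with
      | odotM hw =>
        rw [hw.eq_nil_of_count (by simpa using e1) (by simp at h2; simpa using h2)]
      | dotM hw => simp at e1
    · rw [if_neg (by omega)] at hw e1 e2
      rw [if_neg hin]
      simp at e1 e2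
      exact hw.eq_nil_of_count (by simpa using e1) (by simpa using e2)

/-- The edges at `x` whose closed circle at `x` has to be removed. -/
def Removable (c : PreDiagram (n + 2)) (x : ℕ) : Prop :=
  0 < x ∧ ∃ hx : x < n + 2, (∃ w, c.word (Sum.inl ⟨x, hx⟩) = .dot :: w) ∧
    (c.IsProp (Sum.inl ⟨x, hx⟩) ∨ (2 ≤ (c.word (Sum.inl ⟨x, hx⟩)).count .dot ∧
      ∃ h : x + 1 < n + 2, c.partner (Sum.inl ⟨x, hx⟩) = Sum.inl ⟨x + 1, h⟩))

theorem Removable.exposed {c : PreDiagram (n + 2)} (hc : c.IsLR) {x : ℕ} (h : c.Removable x)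
    (hx : x < n + 2) : c.Exposed posL (Sum.inl ⟨x, hx⟩) ∧ ∀ z : Fin (n + 2), z.val < x →
      ¬ c.IsProp (Sum.inl z) ∧ c.partner (Sum.inl z) ≠ Sum.inl ⟨x, hx⟩ := by
  obtain ⟨h0, hx', ⟨w, hw⟩, h⟩ := h
  have he : c.Exposed posL (Sum.inl ⟨x, hx⟩) :=
    hc.closed_exposed _ .dot (by rw [hw]; simp) rfl
  refine ⟨he, fun z hz => ⟨hc.not_isProp_of_exposed (x := ⟨x, hx⟩) hz he ?_, fun e => ?_⟩⟩
  · rcases h with h | ⟨_, h1, h2⟩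
    · exact Or.inl h
    · exact Or.inr ⟨_, h2, by simp [Fin.lt_def]⟩
  · have := hc.partner_partner (Sum.inl z)
    rw [e] at this
    rcases h with h | ⟨_, h1, h2⟩
    · obtain ⟨y, hy⟩ := isProp_inl.1 h
      rw [hy] at this
      simp at this
    · rw [h2] at this
      simp only [Sum.inl.injEq, ← Fin.val_inj] at this
      omega

/-- A closed circle that a north edge not at the left wall has in excess can be removed. For the
leftmost such edge, all edges to the left of it join neighbouring nodes and have no excess, so that
the edge can be pulled to the left wall. -/
theorem Taut.remove_dot (hn : 2 ≤ n) {c : PreDiagram (n + 2)} (hc : c.Taut) (hf : c.FlatNorth)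
    (h : ∃ x, c.Removable x) (hv : c.aValue = 1 → ∃ v, c.vert = .dot :: v) :
    ∃ a, Reach c a ∧ a.excess < c.excess := by
  classical
  have hlr := hc.isLR
  have hmin : ∀ z, z < Nat.find h → ¬ c.Removable z := fun z hz => Nat.find_min h hz
  have hR := Nat.find_spec h
  generalize Nat.find h = x at hmin hR
  obtain ⟨h0, hx, ⟨w, hw⟩, hX⟩ := id hR
  obtain ⟨he, hleft⟩ := hR.exposed hlr hx
  have hcups := hlr.cups_left hf hx hleft
  obtain ⟨y, rfl⟩ : ∃ y, x = 2 * y + 2 := by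
    rcases Nat.even_or_odd' x with ⟨y, rfl | rfl⟩
    · exact ⟨y - 1, by omega⟩
    · have := (hcups y (by omega)).1
      omega
  refine Taut.pull_left hn y hx hc (fun j hj => ?_) ⟨w, hw⟩ hv (hX.imp id And.left)
  obtain ⟨hj1, hj2⟩ := hcups j (by omega)
  have hcup := hj2 (by omega)
  refine ⟨hcup, ?_⟩
  have hp : ¬ c.IsProp (Sum.inl ⟨2 * j, by omega⟩) := not_isProp_inl.2 ⟨_, hcup⟩
  obtain ⟨hwalk, hcd, -⟩ := hc.nonprop _ hp
  -- an open circle on the edge would have to get past the edge at `x` on its way to the right wall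
  have hopen : Deco.odot ∉ c.word (Sum.inl ⟨2 * j, by omega⟩) := by
    intro ho
    by_cases hpc : c.propCount = 0
    · have hs := (northWord_sorted_iff.1 (hlr.north_sorted hpc)).2
      obtain ⟨x', hx'⟩ := not_isProp_inl.1 (propCount_eq_zero.1 hpc ⟨2 * y + 2, hx⟩)
      have hlt : (⟨2 * y + 2, hx⟩ : Fin (n + 2)) < x' := by
        rcases hX with hX | ⟨_, h1, h2⟩
        · exact absurd hX (propCount_eq_zero.1 hpc _)
        · rw [h2] at hx'
          simp only [Sum.inl.injEq] at hx'
          rw [← hx']; simp [Fin.lt_def]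
      have := hs _ _ _ _ hcup hx' (by simp [Fin.lt_def]) hlt (by simp [Fin.lt_def]; omega) _ ho .dot
        (by rw [hw]; simp) rfl
      simp [Deco.isOpen, Deco.isClosed] at this
    · rw [propCount_eq_zero] at hpc
      push Not at hpc
      obtain ⟨p, hp'⟩ := hpc
      refine hlr.not_exposed_both hp' hp (fun q => ?_) (hlr.open_exposed _ _ ho rfl)
      rintro ⟨q1, q2, q3, q4⟩
      rw [hcup] at q2 q4
      rcases q with ⟨q, hq⟩ | ⟨q, hq⟩
      · simp only [posL] at q1 q2 q3 q4
        obtain ⟨⟨r, hr⟩, hr'⟩ := not_isProp_inl.1 (hleft ⟨q, hq⟩ (by simp only; omega)).1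
        have := hf _ _ hr'
        simp only at this
        rw [hr'] at q3 q4
        simp only at q3 q4
        omega
      · simp only [posL] at q1
        omega
  apply hc.word_eq_mark hn (by omega) hcup
  · -- two closed circles are excluded by the choice of `x`, and by parity at the left wall
    rcases hcases : c.word (Sum.inl ⟨2 * j, by omega⟩) with _ | ⟨l, u⟩
    · simp
    · rcases hwalk.mem l (by rw [hcases]; simp) with rfl | rfl
      · rw [← hcases]
        by_contra hcon
        by_cases hj0 : j = 0
        · subst hj0
          have := hwalk.count_dot
          rw [hcup] at this
          have e2 : (c.word (Sum.inl ⟨2 * 0, by omega⟩)).count .dot = 2 := by omega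
          rw [e2] at this
          simp [zone, column] at this
          split_ifs at this
        · exact hmin (2 * j) (by omega) ⟨by omega, by omega, ⟨u, hcases⟩,
            Or.inr ⟨by omega, by omega, hcup⟩⟩
      · exact absurd (by rw [hcases]; simp) hopen
  · rw [List.count_eq_zero.2 hopen]
    omega

/-- The rightmost non-propagating edge in the north face can be pushed to the right wall, where it
removes an open circle from the rightmost propagating edge. -/
theorem Taut.push_right (hn : 2 ≤ n) : ∀ (m i : ℕ) (hi : i + 2 < n + 2) {c : PreDiagram (n + 2)},
    n ≤ i + m → c.Taut →
    c.partner (Sum.inl ⟨i, by omega⟩) = Sum.inl ⟨i + 1, by omega⟩ →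
    c.word (Sum.inl ⟨i, by omega⟩) = mark n i → i ≠ 0 →
    (∀ x : Fin (n + 2), i + 2 ≤ x.val → c.IsProp (Sum.inl x)) →
    (∃ w, c.word (Sum.inl (Fin.last (n + 1))) = .odot :: w) →
    (c.aValue = 1 → ∃ v, c.vert = .odot :: v) →
    ∃ a, Reach c a ∧ a.excess < c.excess := by
  intro m
  induction m with
  | zero => intro i hi c hm; omega
  | succ m ih =>
    intro i hi c hm hc cup cup_word hi0 hprop hw hv
    have hlr := hc.isLR
    by_cases hin : i + 1 = n
    · obtain ⟨s1, s2⟩ := shift_last hn hin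
      have hX : (⟨i + 2, hi⟩ : Fin (n + 2)) = Fin.last (n + 1) := by
        ext; simp; omega
      obtain ⟨a, w, h⟩ := Taut.exists_slide (hi := hi) hc cup cup_word
        (by rw [s1, hX]; exact hw) (by rw [s1]; exact hv)
      refine ⟨a, h.reach hc hn, h.excess_lt hlr ?_⟩
      have hp := hprop ⟨i + 2, hi⟩ le_rfl
      rw [h.word, s1]
      simp [surplus, hp]
    · obtain ⟨s1, s2⟩ := shift_mid (n := n) (i := i) hi0 (by omega)
      obtain ⟨a, w', h⟩ := Taut.exists_slide (hi := hi) hc cup cup_word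
        ⟨_, by rw [s1]; rfl⟩ (fun _ => ⟨_, by rw [s1]; rfl⟩)
      have hr := h.reach hc hn
      obtain ⟨y, hy⟩ := isProp_inl.1 (hprop ⟨i + 2, hi⟩ le_rfl)
      have hoth : ∀ x : Fin (n + 2), i + 3 ≤ x.val →
          a.partner (Sum.inl x) = c.partner (Sum.inl x) ∧
            a.word (Sum.inl x) = c.word (Sum.inl x) := by
        intro x hx
        refine h.other _ ?_ ?_ ?_ (by rw [hy]; simp) <;>
        · intro e
          simp only [Sum.inl.injEq, ← Fin.val_inj] at e
          omega
      suffices ∃ b, Reach a b ∧ b.excess < a.excess by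
        obtain ⟨b, hb, hlt⟩ := this
        exact ⟨b, hr.trans hb, lt_of_lt_of_le hlt hr.excess_le⟩
      refine ih (i + 1) (by omega) (by omega) hr.taut h.partner_one h.word_one (by omega) ?_ ?_ ?_
      · intro x hx
        have := hprop x (by omega)
        rwa [IsProp, (hoth x hx).1]
      · rw [(hoth (Fin.last (n + 1)) (by simp; omega)).2]
        exact hw
      · intro h1
        rw [h.aValue_eq hlr] at h1
        have := h.vert h1
        rw [s1, List.nil_append] at this
        rw [← this]
        exact hv h1

theorem aValue_eq_one_of_cup {c : PreDiagram (n + 2)} {x y : Fin (n + 2)}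
    (h : c.partner (Sum.inl x) = Sum.inl y) (h' : c.partner (Sum.inl y) = Sum.inl x) (hxy : x < y)
    (hp : ∀ z, z ≠ x → z ≠ y → c.IsProp (Sum.inl z)) : c.aValue = 1 := by
  rw [aValue, Finset.card_eq_one]
  refine ⟨x, ?_⟩
  ext z
  simp only [Finset.mem_filter, Finset.mem_univ, true_and, Finset.mem_singleton]
  constructor
  · rintro ⟨j, hj, hlt⟩
    by_contra hzx
    by_cases hzy : z = y
    · rw [hzy, h'] at hj
      simp only [Sum.inl.injEq] at hj
      omega
    · exact not_isProp_inl.2 ⟨j, hj⟩ (hp z hzx hzy)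
  · rintro rfl
    exact ⟨y, h, hxy⟩

/-- All non-propagating north edges touch each wall at most once. -/
def ExactNorth (c : PreDiagram (n + 2)) : Prop :=
  ∀ x, ¬ c.IsProp (Sum.inl x) →
    (c.word (Sum.inl x)).count .dot ≤ 1 ∧ (c.word (Sum.inl x)).count .odot ≤ 1

/-- An open circle at the north end of an edge propagating from the last node can be removed. -/
theorem Taut.remove_corner (hn : 2 ≤ n) {c : PreDiagram (n + 2)} (hc : c.Taut) (hf : c.FlatNorth)
    (hx : c.ExactNorth) (hp : c.IsProp (Sum.inl (Fin.last (n + 1))))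
    (hw : ∃ w, c.word (Sum.inl (Fin.last (n + 1))) = .odot :: w)
    (hv : c.aValue = 1 → ∃ v, c.vert = .odot :: v) :
    ∃ a, Reach c a ∧ a.excess < c.excess := by
  classical
  have hlr := hc.isLR
  have ha0 : c.aValue ≠ 0 := by
    intro h0
    obtain ⟨w, hw⟩ := hw
    rw [(hlr.undecorated h0).1] at hw
    simp at hw
  have hne : (Finset.univ.filter fun x : Fin (n + 2) => ¬ c.IsProp (Sum.inl x)).Nonempty := by
    rw [aValue] at ha0
    obtain ⟨x, hx⟩ := Finset.card_ne_zero.1 ha0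
    simp only [Finset.mem_filter, Finset.mem_univ, true_and] at hx
    obtain ⟨j, hj, _⟩ := hx
    exact ⟨x, by simpa using not_isProp_inl.2 ⟨j, hj⟩⟩
  obtain ⟨⟨y, hy⟩, hy1, hy2⟩ := Finset.exists_max_image _ (fun x => x.val) hne
  simp only [Finset.mem_filter, Finset.mem_univ, true_and] at hy1 hy2
  obtain ⟨⟨i, hi⟩, hi'⟩ := not_isProp_inl.1 hy1
  have hback := hlr.partner_partner (Sum.inl ⟨y, hy⟩)
  rw [hi'] at hback
  have hle := hy2 ⟨i, hi⟩ (not_isProp_inl.2 ⟨_, hback⟩)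
  simp only at hle
  have := hf _ _ hi'
  simp only at this
  obtain rfl : y = i + 1 := by omega
  have hlast : i + 1 ≠ n + 1 := by
    intro e
    apply hy1
    have : (⟨i + 1, hy⟩ : Fin (n + 2)) = Fin.last (n + 1) := by ext; simpa using e
    rw [this]
    exact hp
  have hprop : ∀ x : Fin (n + 2), i + 2 ≤ x.val → c.IsProp (Sum.inl x) := by
    intro x hx
    by_contra hcon
    have := hy2 x hcon
    omega
  obtain ⟨e1, e2⟩ := hx ⟨i, hi⟩ (not_isProp_inl.2 ⟨_, hback⟩)
  refine Taut.push_right hn n i (by omega) (by omega) hc hback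
    (hc.word_eq_mark hn hy hback e1 e2) ?_ hprop hw hv
  rintro rfl
  -- the only non-propagating edge is at the left wall, where the walk along all propagating edges
  -- cannot start with an open circle
  have ha1 : c.aValue = 1 := by
    refine aValue_eq_one_of_cup hback hi' (by simp) fun z h1 h2 => hprop z ?_
    rw [Ne, ← Fin.val_inj] at h1 h2
    simp only at h1 h2
    omega
  obtain ⟨v, hv⟩ := hv ha1
  obtain ⟨i', j, hi', hj, hci, hcj, hwalk⟩ := hc.vert ha1
  have : i' = 0 := by
    by_contra hne
    exact aValue_ne_one_of_two hci hback (by simp) (by simp) (by simpa using hne) ha1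
  subst this
  rw [hv] at hwalk
  cases hwalk

theorem ExactNorth.mirror {c : PreDiagram (n + 2)} (h : c.ExactNorth) : c.mirror.ExactNorth := by
  intro x hx
  rw [isProp_mirror] at hx
  have := h x.rev hx
  simp only [PreDiagram.mirror, count_map_mirror, mirrorNode_inl, Deco.mirror]
  exact ⟨this.2, this.1⟩

/-- A result on the mirror image of a diagram is transferred back. -/
theorem reach_of_mirror (hn : 2 ≤ n) {c : PreDiagram (n + 2)}
    (h : ∃ a, Reach c.mirror a ∧ a.excess < c.mirror.excess) :
    ∃ a, Reach c a ∧ a.excess < c.excess := by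
  obtain ⟨a, ha, hlt⟩ := h
  refine ⟨a.mirror, ?_, by rwa [excess_mirror, ← excess_mirror c]⟩
  have := ha.mirror hn
  rwa [mirror_mirror] at this

theorem reach_of_flip {c : PreDiagram (n + 2)}
    (h : ∃ a, Reach c.flip a ∧ a.excess < c.flip.excess) :
    ∃ a, Reach c a ∧ a.excess < c.excess := by
  obtain ⟨a, ha, hlt⟩ := h
  refine ⟨a.flip, ?_, by rwa [excess_flip, ← excess_flip c]⟩
  have := ha.flip
  rwa [flip_flip] at this

/-- A closed circle at the north end of a propagating edge can be removed. -/
theorem Taut.remove_prop (hn : 2 ≤ n) {c : PreDiagram (n + 2)} (hc : c.Taut) (hf : c.FlatNorth)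
    (hx : c.ExactNorth) {x : Fin (n + 2)} (hp : c.IsProp (Sum.inl x))
    (hw : ∃ w, c.word (Sum.inl x) = .dot :: w)
    (hv : c.aValue = 1 → ∃ v, c.vert = .dot :: v) :
    ∃ a, Reach c a ∧ a.excess < c.excess := by
  by_cases h0 : x.val = 0
  · apply reach_of_mirror hn
    have hlast : (Fin.last (n + 1)).rev = x := by ext; simp [h0]
    refine (hc.mirror hn).remove_corner hn hf.mirror hx.mirror ?_ ?_ ?_
    · rwa [isProp_mirror, mirrorNode_inl, hlast]
    · obtain ⟨w, hw⟩ := hw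
      exact ⟨w.map Deco.mirror, by
        simp only [PreDiagram.mirror, mirrorNode_inl, hlast, hw]; rfl⟩
    · intro h1
      rw [aValue_mirror hc.isLR.partner_partner hc.isLR.partner_ne] at h1
      obtain ⟨v, hv⟩ := hv h1
      exact ⟨v.map Deco.mirror, by simp only [PreDiagram.mirror, hv]; rfl⟩
  · exact hc.remove_dot hn hf ⟨x, by omega, x.2, hw, Or.inl hp⟩ hv

/-- A closed circle in excess on a non-propagating north edge can be removed. -/
theorem Taut.remove_nonprop (hn : 2 ≤ n) {c : PreDiagram (n + 2)} (hc : c.Taut) (hf : c.FlatNorth)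
    {x : Fin (n + 2)} (hp : ¬ c.IsProp (Sum.inl x)) (h2 : 2 ≤ (c.word (Sum.inl x)).count .dot) :
    ∃ a, Reach c a ∧ a.excess < c.excess := by
  have hlr := hc.isLR
  have : ∃ (i : ℕ) (hi : i + 1 < n + 2),
      c.partner (Sum.inl ⟨i, by omega⟩) = Sum.inl ⟨i + 1, hi⟩ ∧
      2 ≤ (c.word (Sum.inl ⟨i, by omega⟩)).count .dot := by
    obtain ⟨⟨x', hx'⟩, h⟩ := not_isProp_inl.1 hp
    obtain ⟨x, hx⟩ := x
    have h3 := hf _ _ h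
    simp only at h3
    rcases h3 with h3 | h3
    · subst h3
      exact ⟨x, hx', h, h2⟩
    · subst h3
      refine ⟨x', hx, by rw [← h, hlr.partner_partner], ?_⟩
      rwa [← h, hlr.word_partner, List.count_reverse]
  obtain ⟨i, hi, hcup, h2⟩ := this
  have hp := (not_isProp_inl (d := c)).2 ⟨_, hcup⟩
  obtain ⟨hwalk, hcd, -⟩ := hc.nonprop _ hp
  have hmem : Deco.dot ∈ c.word (Sum.inl ⟨i, by omega⟩) := by
    rw [← List.count_pos_iff]; omega
  have he := hlr.closed_exposed _ _ hmem rfl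
  -- at the left wall, the number of closed circles is odd
  have hi0 : i ≠ 0 := by
    rintro rfl
    have := hwalk.count_dot
    rw [hcup, show (c.word (Sum.inl ⟨0, by omega⟩)).count .dot = 2 by omega] at this
    simp [zone, column] at this
    split_ifs at this
  -- closed circles precede open ones
  have hodot : ∀ u, c.word (Sum.inl ⟨i, by omega⟩) ≠ .odot :: u := by
    intro u hu
    by_cases hpc : c.propCount = 0
    · have := (northWord_sorted_iff.1 (hlr.north_sorted hpc)).1 _ _ hcup (by simp [Fin.lt_def])
      rw [hu] at hmem this
      rw [ClosedBeforeOpen, List.pairwise_cons] at this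
      have := this.1 .dot (by simpa using hmem) rfl
      simp [Deco.isOpen, Deco.isClosed] at this
    · rw [propCount_eq_zero] at hpc
      push Not at hpc
      obtain ⟨p, hp'⟩ := hpc
      exact hlr.not_exposed_both hp' hp he (hlr.open_exposed _ .odot (by rw [hu]; simp) rfl)
  have hw : ∃ w, c.word (Sum.inl ⟨i, by omega⟩) = .dot :: w := by
    rcases hcases : c.word (Sum.inl ⟨i, by omega⟩) with _ | ⟨l, u⟩
    · rw [hcases] at hmem; simp at hmem
    · rcases hwalk.mem l (by rw [hcases]; simp) with rfl | rfl
      · exact ⟨u, rfl⟩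
      · exact absurd hcases (hodot u)
  have hR : c.Removable i := ⟨by omega, by omega, hw, Or.inr ⟨h2, hi, hcup⟩⟩
  -- there is another non-propagating edge `{0, 1}`, so that the `a`-value is not `1`
  refine hc.remove_dot hn hf ⟨i, hR⟩ fun h1 => ?_
  have := (hlr.cups_left hf (by omega) (hR.exposed hlr (by omega)).2 0 (by omega)).2 (by omega)
  exact absurd h1 (aValue_ne_one_of_two this hcup (by simp) (by simp [Fin.lt_def]) (by simp; omega))

/-- The leftmost propagating edge can be deformed to touch the left wall. -/
theorem exists_exposed {c : PreDiagram (n + 2)} (h0 : c.propCount ≠ 0) :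
    ∃ x, c.IsProp (Sum.inl x) ∧ c.Exposed posL (Sum.inl x) := by
  classical
  have hne : (Finset.univ.filter fun x : Fin (n + 2) => c.IsProp (Sum.inl x)).Nonempty := by
    rw [propCount_eq] at h0
    exact Finset.card_ne_zero.1 h0
  obtain ⟨x, hx1, hx2⟩ := Finset.exists_min_image _ (fun x => x.val) hne
  simp only [Finset.mem_filter, Finset.mem_univ, true_and] at hx1 hx2
  refine ⟨x, hx1, fun q => ?_⟩
  obtain ⟨x', hx'⟩ := isProp_inl.1 hx1
  rw [hx']
  rintro ⟨q1, q2, q3, q4⟩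
  rcases q with q | q
  · have hq : ¬ c.IsProp (Sum.inl q) := fun h => by
      have := hx2 q h
      simp only [posL] at q1
      omega
    obtain ⟨q', hq'⟩ := not_isProp_inl.1 hq
    rw [hq'] at q4
    simp only [posL] at q4
    omega
  · simp only [posL] at q1
    omega

/-- A decorated propagating edge allows the excess to be reduced. -/
theorem Taut.remove_of_prop (hn : 2 ≤ n) {c : PreDiagram (n + 2)} (hc : c.Taut) (hf : c.FlatNorth)
    (hx : c.ExactNorth) {x : Fin (n + 2)} (hp : c.IsProp (Sum.inl x))
    (hw : c.word (Sum.inl x) ≠ []) : ∃ a, Reach c a ∧ a.excess < c.excess := by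
  have hlr := hc.isLR
  have hpp := hlr.partner_partner
  by_cases h1 : c.aValue = 1
  · have hpc : c.propCount ≠ 0 := fun e => propCount_eq_zero.1 e x hp
    obtain ⟨_, _, _, _, _, _, hwalk⟩ := hc.vert h1
    -- the first letter of the vertical sequence is the first letter of the edge exposed to its wall
    rcases hvert : c.vert with _ | ⟨l, v⟩
    · obtain ⟨j, hj⟩ := isProp_inl.1 hp
      obtain ⟨y, hy⟩ := List.exists_mem_of_ne_nil _ hw
      exfalso
      by_cases hcl : y.isClosed = true
      · have := hlr.vert_left h1 _ _ hj (hlr.closed_exposed _ y hy hcl)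
        rw [hvert] at this
        exact hw this
      · have := hlr.vert_right h1 _ _ hj
          (hlr.open_exposed _ y hy (by simpa [Deco.isOpen] using hcl))
        rw [hvert] at this
        exact hw this
    · rcases hwalk.mem l (by rw [hvert]; simp) with rfl | rfl
      · obtain ⟨z, hz, hze⟩ := exists_exposed hpc
        obtain ⟨j, hj⟩ := isProp_inl.1 hz
        refine hc.remove_prop hn hf hx hz ?_ fun _ => ⟨v, hvert⟩
        rw [hlr.vert_left h1 z j hj hze, hvert]
        exact ⟨_, rfl⟩
      · apply reach_of_mirror hn
        have hpc' : c.mirror.propCount ≠ 0 := by rwa [propCount_mirror]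
        have h1' : c.mirror.aValue = 1 := by rwa [aValue_mirror hpp hlr.partner_ne]
        have hvert' : c.mirror.vert = .dot :: v.map Deco.mirror := by
          simp only [PreDiagram.mirror, hvert]; rfl
        obtain ⟨z, hz, hze⟩ := exists_exposed hpc'
        obtain ⟨j, hj⟩ := isProp_inl.1 hz
        refine (hc.mirror hn).remove_prop hn hf.mirror hx.mirror hz ?_ fun _ => ⟨_, hvert'⟩
        rw [hlr.mirror.vert_left h1' z j hj hze, hvert']
        exact ⟨_, rfl⟩
  · have hwalk := hc.prop h1 _ hp
    rcases hcases : c.word (Sum.inl x) with _ | ⟨l, u⟩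
    · exact absurd hcases hw
    · rcases hwalk.mem l (by rw [hcases]; simp) with rfl | rfl
      · exact hc.remove_prop hn hf hx hp ⟨u, hcases⟩ fun h => absurd h h1
      · apply reach_of_mirror hn
        refine (hc.mirror hn).remove_prop hn hf.mirror hx.mirror (x := x.rev) ?_ ?_ fun h => ?_
        · rwa [isProp_mirror, mirrorNode_inl, Fin.rev_rev]
        · refine ⟨u.map Deco.mirror, ?_⟩
          simp only [PreDiagram.mirror, mirrorNode_inl, Fin.rev_rev, hcases]
          rfl
        · rw [aValue_mirror hpp hlr.partner_ne] at h
          exact absurd h h1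

/-- The excess of a diagram with flat faces can be reduced. -/
theorem Taut.exists_excess_lt (hn : 2 ≤ n) {c : PreDiagram (n + 2)} (hc : c.Taut)
    (hf : c.FlatNorth) (hf' : c.flip.FlatNorth) (h0 : c.excess ≠ 0) :
    ∃ a, Reach c a ∧ a.excess < c.excess := by
  classical
  have hlr := hc.isLR
  have key : ∀ c : PreDiagram (n + 2), c.Taut → c.FlatNorth → ¬ c.ExactNorth →
      ∃ a, Reach c a ∧ a.excess < c.excess := by
    intro c hc hf hx
    rw [ExactNorth] at hx
    push Not at hx
    obtain ⟨x, hp, hx⟩ := hx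
    by_cases h1 : (c.word (Sum.inl x)).count .dot ≤ 1
    · apply reach_of_mirror hn
      refine (hc.mirror hn).remove_nonprop hn hf.mirror (x := x.rev) ?_ ?_
      · rwa [isProp_mirror, mirrorNode_inl, Fin.rev_rev]
      · have := hx h1
        simp only [PreDiagram.mirror, mirrorNode_inl, Fin.rev_rev, count_map_mirror, Deco.mirror]
        omega
    · exact hc.remove_nonprop hn hf hp (by omega)
  by_cases hx : c.ExactNorth
  · by_cases hx' : c.flip.ExactNorth
    · have : ∃ p, surplus (c.IsProp p) (c.word p) ≠ 0 := by
        by_contra hcon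
        push Not at hcon
        exact h0 (Finset.sum_eq_zero fun p _ => hcon p)
      obtain ⟨p, hp⟩ := this
      by_cases hpp : c.IsProp p
      · have hw : c.word p ≠ [] := by
          intro e
          rw [e] at hp
          simp [surplus] at hp
        rcases p with x | x
        · exact hc.remove_of_prop hn hf hx hpp hw
        · apply reach_of_flip
          exact hc.flip.remove_of_prop hn hf' hx' (x := x) (by rwa [isProp_flip]) hw
      · exfalso
        rw [surplus, if_neg hpp] at hp
        rcases p with x | x
        · have := hx x hpp
          omega
        · have := hx' x (by rwa [isProp_flip])
          simp only [PreDiagram.flip, Sum.swap_inl] at this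
          omega
    · exact reach_of_flip (key _ hc.flip hf' hx')
  · exact key c hc hf hx

/-- Every taut diagram reduces to one with flat faces and without excess. -/
theorem Taut.exists_reduced (hn : 2 ≤ n) : ∀ (m : ℕ) {c : PreDiagram (n + 2)}, c.excess ≤ m →
    c.Taut → ∃ a, Reach c a ∧ a.FlatNorth ∧ a.flip.FlatNorth ∧ a.excess = 0 := by
  intro m
  induction m with
  | zero =>
    intro c hm hc
    obtain ⟨a, ha, h1, h2⟩ := hc.exists_flat hn
    exact ⟨a, ha, h1, h2, by have := ha.excess_le; omega⟩
  | succ m ih =>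
    intro c hm hc
    obtain ⟨a, ha, h1, h2⟩ := hc.exists_flat hn
    by_cases h0 : a.excess = 0
    · exact ⟨a, ha, h1, h2, h0⟩
    · obtain ⟨b, hb, hlt⟩ := ha.taut.exists_excess_lt hn h1 h2 h0
      obtain ⟨d, hd, h⟩ := ih (c := b) (by have := ha.excess_le; omega) hb.taut
      exact ⟨d, (ha.trans hb).trans hd, h⟩

end surplus

/-! ### Diagrams without surplus decorations -/

section clean

variable {n : ℕ}

/-- A diagram with flat faces, in which the non-propagating edges are decorated as in simple
diagrams and nothing else is decorated. -/
structure Clean (c : PreDiagram (n + 2)) : Prop where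
  partner_partner : ∀ p, c.partner (c.partner p) = p
  partner_ne : ∀ p, c.partner p ≠ p
  planar : ∀ p q, ¬ (posL p < posL q ∧ posL q < posL (c.partner p) ∧
    posL (c.partner p) < posL (c.partner q))
  north : ∀ x y : Fin (n + 2), c.partner (Sum.inl x) = Sum.inl y →
    (x.val + 1 = y.val ∨ y.val + 1 = x.val) ∧ c.word (Sum.inl x) = mark n (min x.val y.val)
  south : ∀ x y : Fin (n + 2), c.partner (Sum.inr x) = Sum.inr y →
    (x.val + 1 = y.val ∨ y.val + 1 = x.val) ∧ c.word (Sum.inr x) = mark n (min x.val y.val)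
  word_prop : ∀ p, c.IsProp p → c.word p = []
  vert : c.vert = []
  loops : c.loops = 0
  zero : c.IsProp (Sum.inl 0) ↔ c.IsProp (Sum.inr 0)
  last : c.IsProp (Sum.inl (Fin.last _)) ↔ c.IsProp (Sum.inr (Fin.last _))

theorem Clean.flip {c : PreDiagram (n + 2)} (hc : c.Clean) : c.flip.Clean where
  partner_partner := flip_partner_partner hc.partner_partner
  partner_ne := flip_partner_ne hc.partner_ne
  planar p q := by
    have := hc.planar (c.partner q.swap) (c.partner p.swap)
    have s1 := posL_swap (c.partner p.swap)
    have s2 := posL_swap (c.partner q.swap)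
    have s3 := posL_swap p
    have s4 := posL_swap q
    simp only [hc.partner_partner] at this
    simp only [PreDiagram.flip]
    omega
  north x y h := hc.south x y (by
    simp only [PreDiagram.flip, Sum.swap_inl] at h
    rw [← Sum.swap_swap (c.partner _), h, Sum.swap_inl])
  south x y h := hc.north x y (by
    simp only [PreDiagram.flip, Sum.swap_inr] at h
    rw [← Sum.swap_swap (c.partner _), h, Sum.swap_inr])
  word_prop p hp := hc.word_prop _ (by rwa [isProp_flip] at hp)
  vert := by simp [PreDiagram.flip, hc.vert]
  loops := hc.loops
  zero := by rw [isProp_flip, isProp_flip]; exact hc.zero.symm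
  last := by rw [isProp_flip, isProp_flip]; exact hc.last.symm

theorem mem_mark_iff {i : ℕ} {x : Deco} (h : x ∈ mark n i) :
    (i = 0 ∧ x = .dot) ∨ (i = n ∧ x = .odot) := by
  unfold mark at h
  split_ifs at h <;> simp_all

theorem aValue_ne_zero {c : PreDiagram (n + 2)} (hp : ∀ p, c.partner (c.partner p) = p)
    (hne : ∀ p, c.partner p ≠ p) {p : Node (n + 2)} (h : ¬ c.IsProp p) : c.aValue ≠ 0 := by
  intro h0
  have key : ∀ c : PreDiagram (n + 2), (∀ p, c.partner (c.partner p) = p) →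
      (∀ p, c.partner p ≠ p) → c.aValue = 0 → ∀ x, c.IsProp (Sum.inl x) := by
    classical
    intro c hp hne h0 x
    have h1 := two_mul_aValue_add hp hne
    rw [h0, propCount_eq] at h1
    have h2 : (Finset.univ.filter fun i => c.IsProp (Sum.inl i)).card =
        Fintype.card (Fin (n + 2)) := by simpa using h1
    have h3 := Finset.mem_univ x
    rw [← (Finset.card_eq_iff_eq_univ _).1 h2] at h3
    simpa using h3
  rcases p with x | x
  · exact h (key c hp hne h0 x)
  · have := key c.flip (flip_partner_partner hp) (flip_partner_ne hne)
      (by rw [aValue_flip hp hne, h0]) x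
    rw [isProp_flip] at this
    exact h this

theorem Clean.north_sorted {c : PreDiagram (n + 2)} (hc : c.Clean) :
    ClosedBeforeOpen c.northWord := by
  rw [northWord_sorted_iff]
  refine ⟨fun i j hij _ => ?_, fun i i' j j' hi hj hii hjj hij x hx y hy hxo => ?_⟩
  · rw [(hc.north _ _ hij).2]
    unfold mark
    split_ifs <;> simp [ClosedBeforeOpen]
  · rw [(hc.north _ _ hi).2] at hx
    rcases mem_mark_iff hx with ⟨_, rfl⟩ | ⟨h, rfl⟩
    · simp [Deco.isOpen, Deco.isClosed] at hxo
    · have := j'.2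
      simp only [Fin.lt_def] at hii hjj hij
      omega

theorem Clean.isLR {c : PreDiagram (n + 2)} (hc : c.Clean) : c.IsLR where
  partner_partner := hc.partner_partner
  partner_ne := hc.partner_ne
  planar := hc.planar
  word_partner p := by
    have hpp := hc.partner_partner p
    by_cases hp : c.IsProp p
    · rw [hc.word_prop p hp, hc.word_prop _ ((isProp_partner hc.partner_partner p).2 hp)]
      rfl
    rcases p with x | x
    · obtain ⟨y, hy⟩ := not_isProp_inl.1 hp
      rw [hy] at hpp ⊢
      rw [(hc.north _ _ hy).2, (hc.north _ _ hpp).2, mark_reverse, min_comm]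
    · obtain ⟨y, hy⟩ := not_isProp_inr.1 hp
      rw [hy] at hpp ⊢
      rw [(hc.south _ _ hy).2, (hc.south _ _ hpp).2, mark_reverse, min_comm]
  closed_exposed p l hl hlc q := by
    have hq := posL_lt (c.partner q)
    by_cases hp : c.IsProp p
    · rw [hc.word_prop p hp] at hl
      simp at hl
    rcases p with x | x
    · obtain ⟨y, hy⟩ := not_isProp_inl.1 hp
      obtain ⟨h1, h2⟩ := hc.north _ _ hy
      rw [h2] at hl
      rcases mem_mark_iff hl with ⟨h, rfl⟩ | ⟨h, rfl⟩
      · rw [hy]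
        simp only [posL]
        omega
      · simp [Deco.isClosed] at hlc
    · obtain ⟨y, hy⟩ := not_isProp_inr.1 hp
      obtain ⟨h1, h2⟩ := hc.south _ _ hy
      rw [h2] at hl
      rcases mem_mark_iff hl with ⟨h, rfl⟩ | ⟨h, rfl⟩
      · have e1 : posL (Sum.inr x : Node (n + 2)) = 2 * (n + 2) - 1 - x := rfl
        have e2 : posL (Sum.inr y : Node (n + 2)) = 2 * (n + 2) - 1 - y := rfl
        rw [hy, e1, e2]
        omega
      · simp [Deco.isClosed] at hlc
  open_exposed p l hl hlc q := by
    have hq := posL_lt (c.partner q)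
    have hq' := posR_eq (c.partner q)
    by_cases hp : c.IsProp p
    · rw [hc.word_prop p hp] at hl
      simp at hl
    rcases p with x | x
    · obtain ⟨y, hy⟩ := not_isProp_inl.1 hp
      obtain ⟨h1, h2⟩ := hc.north _ _ hy
      rw [h2] at hl
      rcases mem_mark_iff hl with ⟨h, rfl⟩ | ⟨h, rfl⟩
      · simp [Deco.isOpen, Deco.isClosed] at hlc
      · rw [hy]
        simp only [posR]
        omega
    · obtain ⟨y, hy⟩ := not_isProp_inr.1 hp
      obtain ⟨h1, h2⟩ := hc.south _ _ hy
      rw [h2] at hl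
      rcases mem_mark_iff hl with ⟨h, rfl⟩ | ⟨h, rfl⟩
      · simp [Deco.isOpen, Deco.isClosed] at hlc
      · have e1 : posR (Sum.inr x : Node (n + 2)) = n + 2 + x := rfl
        have e2 : posR (Sum.inr y : Node (n + 2)) = n + 2 + y := rfl
        rw [hy, e1, e2]
        omega
  north_sorted _ := hc.north_sorted
  south_sorted _ := by
    rw [← northWord_flip]
    exact hc.flip.north_sorted
  loops_undammed _ L hL := by rw [hc.loops] at hL; simp at hL
  loops_dammed _ L hL := by rw [hc.loops] at hL; simp at hL
  vert_nil _ := hc.vert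
  vert_left _ i j h _ := by
    rw [hc.word_prop _ (isProp_inl.2 ⟨j, h⟩), hc.vert]; rfl
  vert_right _ i j h _ := by
    rw [hc.word_prop _ (isProp_inl.2 ⟨j, h⟩), hc.vert]; rfl
  undecorated h0 := by
    refine ⟨fun p => hc.word_prop p ?_, fun L hL => by rw [hc.loops] at hL; simp at hL⟩
    by_contra hp
    exact aValue_ne_zero hc.partner_partner hc.partner_ne hp h0

/-- Without excess, the propagating edges are undecorated, and the words of the non-propagating
edges are determined by the zones of their ends. -/
theorem Taut.clean (hn : 2 ≤ n) {c : PreDiagram (n + 2)} (hc : c.Taut) (hf : c.FlatNorth)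
    (hf' : c.flip.FlatNorth) (h0 : c.excess = 0) (hl : c.loops = 0) : c.Clean := by
  classical
  have hlr := hc.isLR
  have hs : ∀ p, surplus (c.IsProp p) (c.word p) = 0 := fun p =>
    Finset.sum_eq_zero_iff.1 h0 p (Finset.mem_univ p)
  have hprop : ∀ p, c.IsProp p → c.word p = [] := by
    intro p hp
    have := hs p
    rw [surplus, if_pos hp] at this
    exact List.length_eq_zero_iff.1 this
  have hnonprop : ∀ p, ¬ c.IsProp p → (c.word p).count .dot ≤ 1 ∧ (c.word p).count .odot ≤ 1 := by
    intro p hp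
    have := hs p
    rw [surplus, if_neg hp] at this
    omega
  have hnorth : ∀ (d : PreDiagram (n + 2)), d.Taut → d.FlatNorth →
      (∀ p, ¬ d.IsProp p → (d.word p).count .dot ≤ 1 ∧ (d.word p).count .odot ≤ 1) →
      ∀ x y : Fin (n + 2), d.partner (Sum.inl x) = Sum.inl y →
      (x.val + 1 = y.val ∨ y.val + 1 = x.val) ∧ d.word (Sum.inl x) = mark n (min x.val y.val) := by
    intro d hd hf hw x y hxy
    have h := hf x y hxy
    refine ⟨h, ?_⟩
    obtain ⟨x, hx⟩ := x
    obtain ⟨y, hy⟩ := y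
    simp only at h ⊢
    have h1 := hd.isLR.partner_partner (Sum.inl ⟨x, hx⟩)
    have h2 := hd.isLR.word_partner (Sum.inl ⟨x, hx⟩)
    rw [hxy] at h1 h2
    rcases h with rfl | rfl
    · obtain ⟨w1, w2⟩ := hw _ (not_isProp_inl.2 ⟨_, hxy⟩)
      rw [hd.word_eq_mark hn hy hxy w1 w2]
      congr 1
      omega
    · obtain ⟨w1, w2⟩ := hw _ (not_isProp_inl.2 ⟨_, h1⟩)
      have h3 := hd.word_eq_mark hn hx h1 w1 w2
      rw [h3] at h2
      rw [← List.reverse_reverse (d.word (Sum.inl ⟨y + 1, hx⟩)), ← h2, mark_reverse]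
      congr 1
      omega
  have hvert : c.vert = [] := by
    by_cases h1 : c.aValue = 1
    · have hpc : c.propCount ≠ 0 := by
        have := two_mul_aValue_add hlr.partner_partner hlr.partner_ne
        omega
      obtain ⟨x, hx, hxe⟩ := exists_exposed hpc
      obtain ⟨j, hj⟩ := isProp_inl.1 hx
      have e1 := hlr.vert_left h1 x j hj hxe
      rw [hprop _ hx] at e1
      obtain ⟨x, hx, hxe⟩ := exists_exposed (c := c.mirror) (by rwa [propCount_mirror])
      obtain ⟨j, hj⟩ := isProp_inl.1 hx
      have e2 := hlr.mirror.vert_left (by rwa [aValue_mirror hlr.partner_partner hlr.partner_ne])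
        x j hj hxe
      rw [isProp_mirror] at hx
      have e3 : c.mirror.word (Sum.inl x) = [] := by
        simp only [PreDiagram.mirror, hprop _ hx, List.map_nil]
      rw [e3] at e2
      rw [List.eq_nil_iff_forall_not_mem]
      intro l hl
      have f1 := List.filter_eq_nil_iff.1 e1.symm l hl
      have f2 := List.filter_eq_nil_iff.1 e2.symm l.mirror (List.mem_map_of_mem hl)
      rw [Deco.isClosed_mirror, Deco.isOpen] at f2
      simp at f1 f2
      rw [f1] at f2
      exact absurd f2 (by simp)
    · exact hlr.vert_nil h1
  -- a corner is the end of a propagating edge if and only if the corner below it is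
  have hcorner : ∀ d : PreDiagram (n + 2), d.Taut → (∀ p, d.IsProp p → d.word p = []) →
      d.vert = [] → ∀ e : Fin (n + 2), e = 0 ∨ e = Fin.last (n + 1) →
      d.IsProp (Sum.inl e) → d.IsProp (Sum.inr e) := by
    intro d hd hw hv e he hp
    by_contra hcon
    by_cases h1 : d.aValue = 1
    · obtain ⟨i, j, hi, hj, hci, hcj, hwalk⟩ := hd.vert h1
      rw [hv] at hwalk
      have h3 : column n i = column n j := Walk.nil_iff.1 hwalk
      obtain ⟨y, hy⟩ := not_isProp_inr.1 hcon
      have hpp := hd.isLR.partner_partner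
      have hcj' := hpp (Sum.inr ⟨j, by omega⟩)
      have hye := hpp (Sum.inr e)
      rw [hcj] at hcj'
      rw [hy] at hye
      have hfa : d.flip.aValue = 1 := by rw [aValue_flip hpp hd.isLR.partner_ne, h1]
      have hfp : ∀ x y : Fin (n + 2), d.partner (Sum.inr x) = Sum.inr y →
          d.flip.partner (Sum.inl x) = Sum.inl y := by
        intro x y h
        simp [PreDiagram.flip, h]
      have hej : e.val = j ∨ e.val = j + 1 := by
        have hne : e ≠ y := fun h => hd.isLR.partner_ne (Sum.inr e) (by rw [hy, h])
        rcases lt_or_gt_of_ne hne with hlt | hlt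
        · by_contra hcon'
          exact aValue_ne_one_of_two (hfp _ _ hy) (hfp _ _ hcj) hlt (by simp)
            (fun h => hcon' (Or.inl (by rw [h]))) hfa
        · by_contra hcon'
          refine aValue_ne_one_of_two (hfp _ _ hye) (hfp _ _ hcj) hlt (by simp)
            (fun h => hcon' (Or.inr ?_)) hfa
          rw [h, hcj] at hye
          simp only [Sum.inr.injEq] at hye
          rw [← hye]
      have hei : e.val = i ∨ e.val = i + 1 := by
        unfold column at h3
        rcases he with rfl | rfl
        · obtain rfl : j = 0 := by simp at hej; omega
          left
          by_contra hi0
          rw [if_neg (show i ≠ 0 from fun h => hi0 (by rw [h]; rfl)), if_pos rfl] at h3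
          split_ifs at h3
        · simp at hej
          obtain rfl : j = n := by omega
          rw [if_neg (show j ≠ 0 by omega), if_pos rfl] at h3
          split_ifs at h3
          simp
          omega
      rcases hei with hei | hei
      · have : e = ⟨i, by omega⟩ := Fin.ext hei
        rw [this, isProp_inl, hci] at hp
        simp at hp
      · have h4 := hpp (Sum.inl ⟨i, by omega⟩)
        rw [hci] at h4
        have : e = ⟨i + 1, by omega⟩ := Fin.ext hei
        rw [this, isProp_inl, h4] at hp
        simp at hp
    · have hwalk := hd.prop h1 _ hp
      rw [hw _ hp] at hwalk
      obtain ⟨y, hy⟩ := isProp_inl.1 hp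
      rw [hy] at hwalk
      have hz : zone (Sum.inl e : Node (n + 2)) = zone (Sum.inr y : Node (n + 2)) :=
        Walk.nil_iff.1 hwalk
      have hye : y = e := by
        simp only [zone, column, Sum.elim_inl, Sum.elim_inr, id] at hz
        rcases he with rfl | rfl <;> simp at hz <;> ext <;> simp <;> split_ifs at hz <;> simp_all
      subst hye
      apply hcon
      rw [isProp_inr]
      have := hd.isLR.partner_partner (Sum.inl y)
      rw [hy] at this
      exact ⟨_, this⟩
  have hwf : ∀ p, c.flip.IsProp p → c.flip.word p = [] := fun p hp =>
    hprop _ (by rwa [isProp_flip] at hp)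
  have hvf : c.flip.vert = [] := by simp [PreDiagram.flip, hvert]
  have hback : ∀ e : Fin (n + 2), e = 0 ∨ e = Fin.last (n + 1) →
      c.IsProp (Sum.inr e) → c.IsProp (Sum.inl e) := by
    intro e he hp
    have := hcorner c.flip hc.flip hwf hvf e he (by rwa [isProp_flip])
    rwa [isProp_flip] at this
  refine ⟨hlr.partner_partner, hlr.partner_ne, hlr.planar, hnorth c hc hf hnonprop, ?_, hprop,
    hvert, hl, ⟨hcorner c hc hprop hvert _ (Or.inl rfl), hback _ (Or.inl rfl)⟩,
    ⟨hcorner c hc hprop hvert _ (Or.inr rfl), hback _ (Or.inr rfl)⟩⟩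
  intro x y hxy
  exact hnorth c.flip hc.flip hf' (fun p hp => hnonprop _ (by rwa [isProp_flip] at hp)) x y
    (by simp [PreDiagram.flip, hxy])

end clean

/-! ### Clean diagrams are products -/

section clean_product

variable {n : ℕ}

theorem Slide.clean {c a : PreDiagram (n + 2)} {i : ℕ} {hi : i + 2 < n + 2} {w : List Deco}
    (h : Slide c a i hi w) (hc : c.Clean) (hn : 2 ≤ n) (h0 : i ≠ 0) (h1 : i + 1 ≠ n)
    (hp : c.IsProp (Sum.inl ⟨i + 2, hi⟩)) : a.Clean := by
  have hlr := hc.isLR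
  have ha := h.isLR hlr hn
  obtain ⟨v, hv⟩ := isProp_inl.1 hp
  have hw : w = [] := by
    have := h.word
    rw [hc.word_prop _ hp] at this
    exact (List.append_eq_nil_iff.1 this.symm).2
  have hfix : ∀ p, p ≠ Sum.inl ⟨i, by omega⟩ → p ≠ Sum.inl ⟨i + 2, hi⟩ →
      (a.IsProp p ↔ c.IsProp p) := by
    intro p h0 h2
    have := h.isProp_swap hlr p
    rwa [Equiv.swap_apply_of_ne_of_ne h0 h2] at this
  refine ⟨ha.partner_partner, ha.partner_ne, ha.planar, fun x y hxy => ?_, fun x y hxy => ?_,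
    fun p hp' => ?_, ?_, by rw [h.loops, hc.loops], ?_, ?_⟩
  · rcases slide_cases c i hi (Sum.inl x) with e | e | e | e | ⟨h0, h1, h2, h3⟩
    · rw [e, h.partner_zero, hv] at hxy
      simp at hxy
    · rw [e, h.word_one]
      rw [e, h.partner_one] at hxy
      simp only [Sum.inl.injEq] at hxy e
      subst hxy e
      simp
    · rw [e, h.word_two]
      rw [e, h.partner_two] at hxy
      simp only [Sum.inl.injEq] at hxy e
      subst hxy e
      simp
    · rw [hv] at e
      simp at e
    · rw [(h.other _ h0 h1 h2 h3).1] at hxy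
      rw [(h.other _ h0 h1 h2 h3).2]
      exact hc.north x y hxy
  · by_cases e : Sum.inr x = c.partner (Sum.inl ⟨i + 2, hi⟩)
    · rw [e, h.partner_far] at hxy
      simp at hxy
    · obtain ⟨e1, e2⟩ := h.other _ (by simp) (by simp) (by simp) e
      rw [e1] at hxy
      rw [e2]
      exact hc.south x y hxy
  · rcases slide_cases c i hi p with rfl | rfl | rfl | rfl | ⟨h0, h1, h2, h3⟩
    · rw [h.word_zero, hw]
    · rw [isProp_inl, h.partner_one] at hp'
      simp at hp'
    · rw [isProp_inl, h.partner_two] at hp'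
      simp at hp'
    · rw [h.word_far, hw]
      rfl
    · rw [(h.other _ h0 h1 h2 h3).2]
      exact hc.word_prop p (by rwa [hfix p h0 h2] at hp')
  · by_cases h1 : c.aValue = 1
    · have := h.vert h1
      rw [hc.vert] at this
      exact (List.append_eq_nil_iff.1 this.symm).2
    · exact h.vert_nil h1
  · rw [hfix (Sum.inl 0) (by simpa [← Fin.val_inj] using h0.symm) (by simp [← Fin.val_inj]),
      hfix (Sum.inr 0) (by simp) (by simp)]
    exact hc.zero
  · rw [hfix (Sum.inl (Fin.last _)) (by simp [← Fin.val_inj]; omega)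
      (by simp [← Fin.val_inj]; omega), hfix (Sum.inr (Fin.last _)) (by simp) (by simp)]
    exact hc.last

/-- All edges at the nodes numbered `s` or higher are vertical. -/
def VerticalFrom (c : PreDiagram (n + 2)) (s : ℕ) : Prop :=
  ∀ p : Node (n + 2), s ≤ (p.elim id id).val → c.partner p = p.swap

theorem VerticalFrom.flip {c : PreDiagram (n + 2)} {s : ℕ} (h : c.VerticalFrom s) :
    c.flip.VerticalFrom s := by
  intro p hp
  simp only [PreDiagram.flip]
  rw [h p.swap (by rcases p with p | p <;> simpa using hp), Sum.swap_swap]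

/-- A pair of opposite non-propagating edges of a clean diagram can be cut into two vertical
edges. -/
theorem Clean.cut {c : PreDiagram (n + 2)} (hc : c.Clean) {s : ℕ} (hs : s + 1 < n + 2)
    (hv : c.VerticalFrom (s + 2))
    (h : c.partner (Sum.inl ⟨s, by omega⟩) = Sum.inl ⟨s + 1, hs⟩)
    (h' : c.partner (Sum.inr ⟨s, by omega⟩) = Sum.inr ⟨s + 1, hs⟩) :
    ∃ a, Red c a ∧ a.Clean ∧ a.VerticalFrom s := by
  classical
  have hpp := hc.partner_partner
  have g := hpp (Sum.inl ⟨s, by omega⟩)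
  have g' := hpp (Sum.inr ⟨s, by omega⟩)
  rw [h] at g
  rw [h'] at g'
  have hcases : ∀ p : Node (n + 2), s ≤ (p.elim id id).val →
      p = Sum.inl ⟨s, by omega⟩ ∨ p = Sum.inl ⟨s + 1, hs⟩ ∨ p = Sum.inr ⟨s, by omega⟩ ∨
      p = Sum.inr ⟨s + 1, hs⟩ ∨ s + 2 ≤ (p.elim id id).val := by
    rintro (x | x) hx <;> simp [← Fin.val_inj] at hx ⊢ <;> omega
  have hsw : ∀ p : Node (n + 2), (p.swap.elim id id).val = (p.elim id id).val := by
    rintro (x | x) <;> rfl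
  have hge : ∀ p : Node (n + 2), s ≤ (p.elim id id).val → s ≤ ((c.partner p).elim id id).val := by
    intro p hp
    rcases hcases p hp with rfl | rfl | rfl | rfl | hp'
    · rw [h]; simp
    · rw [g]; simp
    · rw [h']; simp
    · rw [g']; simp
    · rw [hv p hp', hsw]; exact hp
  have hlt : ∀ p : Node (n + 2), ¬ s ≤ (p.elim id id).val →
      ¬ s ≤ ((c.partner p).elim id id).val := by
    intro p hp hp'
    have := hge _ hp'
    rw [hpp] at this
    exact hp this
  -- both edges are replaced by vertical ones, and the edges to the right are vertical already
  let a : PreDiagram (n + 2) :=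
    { partner := fun p => if s ≤ (p.elim id id).val then p.swap else c.partner p
      word := fun p => if s ≤ (p.elim id id).val then [] else c.word p
      loops := 0
      vert := [] }
  have a1 : ∀ p, s ≤ (p.elim id id).val → a.partner p = p.swap := fun p hp => if_pos hp
  have a2 : ∀ p, ¬ s ≤ (p.elim id id).val → a.partner p = c.partner p := fun p hp => if_neg hp
  have w1 : ∀ p, s ≤ (p.elim id id).val → a.word p = [] := fun p hp => if_pos hp
  have w2 : ∀ p, ¬ s ≤ (p.elim id id).val → a.word p = c.word p := fun p hp => if_neg hp
  have p1 : ∀ p : Node (n + 2), s ≤ (p.elim id id).val → s ≤ posL p ∧ posL p + s < 2 * (n + 2) := by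
    rintro (x | x) hx <;> simp only [Sum.elim_inl, Sum.elim_inr, id, posL] at hx ⊢ <;> omega
  have p2 : ∀ p : Node (n + 2), ¬ s ≤ (p.elim id id).val →
      posL p < s ∨ 2 * (n + 2) ≤ posL p + s := by
    rintro (x | x) hx <;> simp only [Sum.elim_inl, Sum.elim_inr, id, posL] at hx ⊢ <;> omega
  have hprop : ∀ p, a.IsProp p ↔ s ≤ (p.elim id id).val ∨ c.IsProp p := by
    intro p
    rw [IsProp, IsProp]
    by_cases hp : s ≤ (p.elim id id).val
    · rw [a1 p hp]
      rcases p with p | p <;> simp at hp ⊢ <;> exact Or.inl hp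
    · rw [a2 p hp]
      simp [hp]
  have ha : a.Clean := by
    refine ⟨fun p => ?_, fun p => ?_, fun p q => ?_, fun x y hxy => ?_, fun x y hxy => ?_,
      fun p hp => ?_, rfl, rfl, ?_, ?_⟩
    · by_cases hp : s ≤ (p.elim id id).val
      · rw [a1 p hp, a1 _ (by rwa [hsw]), Sum.swap_swap]
      · rw [a2 p hp, a2 _ (hlt p hp), hpp]
    · by_cases hp : s ≤ (p.elim id id).val
      · rw [a1 p hp]
        rcases p with p | p <;> simp
      · rw [a2 p hp]
        exact hc.partner_ne p
    · by_cases hp : s ≤ (p.elim id id).val <;> by_cases hq : s ≤ (q.elim id id).val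
      · rw [a1 p hp, a1 q hq]
        have := posL_swap p
        have := posL_swap q
        omega
      · rw [a1 p hp, a2 q hq]
        have := posL_swap p
        have := p1 p hp
        have := p2 q hq
        omega
      · rw [a2 p hp, a1 q hq]
        have := posL_swap q
        have := p1 q hq
        have := p2 p hp
        have := p2 _ (hlt p hp)
        omega
      · rw [a2 p hp, a2 q hq]
        exact hc.planar p q
    · by_cases hp : s ≤ x.val
      · rw [a1 (Sum.inl x) hp] at hxy
        simp at hxy
      · rw [a2 (Sum.inl x) hp] at hxy
        rw [w2 (Sum.inl x) hp]
        exact hc.north x y hxy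
    · by_cases hp : s ≤ x.val
      · rw [a1 (Sum.inr x) hp] at hxy
        simp at hxy
      · rw [a2 (Sum.inr x) hp] at hxy
        rw [w2 (Sum.inr x) hp]
        exact hc.south x y hxy
    · by_cases hp' : s ≤ (p.elim id id).val
      · exact w1 p hp'
      · rw [w2 p hp']
        exact hc.word_prop p (((hprop p).1 hp).resolve_left hp')
    · rw [hprop, hprop, hc.zero]; rfl
    · rw [hprop, hprop, hc.last]; rfl
  have hmark : ∀ p : Node (n + 2), p = Sum.inl ⟨s, by omega⟩ ∨ p = Sum.inl ⟨s + 1, hs⟩ ∨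
      p = Sum.inr ⟨s, by omega⟩ ∨ p = Sum.inr ⟨s + 1, hs⟩ → c.word p = mark n s := by
    rintro p (rfl | rfl | rfl | rfl)
    · rw [(hc.north _ _ h).2]; simp
    · rw [(hc.north _ _ g).2]; simp
    · rw [(hc.south _ _ h').2]; simp
    · rw [(hc.south _ _ g').2]; simp
  refine ⟨a, .single ⟨hc.isLR, ha.isLR, ⟨s, by omega⟩, Or.inl ⟨?_, ?_⟩⟩, ha, a1⟩
  · refine plainConcat_cut (w := []) (u := Sum.inr ⟨s, by omega⟩) (v := Sum.inr ⟨s + 1, hs⟩)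
      (x := ⟨s, by omega⟩) (y := ⟨s + 1, hs⟩) (by omega) (by simp) h g (hmark _ (by simp))
      (hmark _ (by simp)) h' g' (by simp) (by simp) (by simp) (by simp) ?_ ?_ ?_ ?_ ?_ ?_ ?_ ?_
      hc.loops fun _ => hc.vert
    · exact a1 _ (by simp)
    · exact a1 _ (by simp)
    · exact a1 _ (by simp)
    · exact a1 _ (by simp)
    · rw [hmark _ (by simp), w1 _ (by simp), w1 _ (by simp)]; simp
    · rw [hmark _ (by simp), w1 _ (by simp), w1 _ (by simp)]; simp
    · intro p q1 q2 q3 q4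
      by_cases hp : s ≤ (p.elim id id).val
      · rcases hcases p hp with e | e | e | e | hp'
        · exact absurd e q3
        · exact absurd e q4
        · exact absurd e q1
        · exact absurd e q2
        · rw [a1 p hp, w1 p hp, hv p hp', hc.word_prop p ?_]
          · exact ⟨rfl, rfl⟩
          · rw [IsProp, hv p hp']
            rcases p with p | p <;> simp
      · rw [a2 p hp, w2 p hp]
        exact ⟨rfl, rfl⟩
    · intro p q1 q2
      refine ⟨fun e => q2 ?_, fun e => q1 ?_⟩
      · rw [← hpp p, e, h]
      · rw [← hpp p, e, g]
  · rw [a1 _ (by simp)]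
    simp

/-- In a clean diagram whose edges to the right of `t` are vertical, the rightmost non-propagating
north edge can be pushed to `t` if there is a non-propagating edge at the south node `t`. -/
theorem Clean.push_right (hn : 2 ≤ n) {t : ℕ} (ht : t < n + 2) : ∀ (m i : ℕ) (hi : i + 1 ≤ t)
    {c : PreDiagram (n + 2)}, t ≤ i + 1 + m → c.Clean → c.VerticalFrom (t + 1) →
    c.partner (Sum.inl ⟨i, by omega⟩) = Sum.inl ⟨i + 1, by omega⟩ →
    (∀ x : Fin (n + 2), i + 2 ≤ x.val → c.IsProp (Sum.inl x)) → ¬ c.IsProp (Sum.inr ⟨t, ht⟩) →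
    ∃ a, Red c a ∧ a.Clean ∧ a.VerticalFrom (t + 1) ∧ ¬ a.IsProp (Sum.inl ⟨t, ht⟩) ∧
      ¬ a.IsProp (Sum.inr ⟨t, ht⟩) := by
  intro m
  induction m with
  | zero =>
    intro i hi c hm hc hv h hp hs
    obtain rfl : t = i + 1 := by omega
    have g := hc.partner_partner (Sum.inl ⟨i, by omega⟩)
    rw [h] at g
    exact ⟨c, .refl, hc, hv, not_isProp_inl.2 ⟨_, g⟩, hs⟩
  | succ m ih =>
    intro i hi c hm hc hv h hp hs
    by_cases hit : t = i + 1
    · exact ih i hi (by omega) hc hv h hp hs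
    have hlr := hc.isLR
    have hpp := hc.partner_partner
    have g := hpp (Sum.inl ⟨i, by omega⟩)
    rw [h] at g
    -- otherwise `t` is the last node, where the two faces agree
    have h1 : i + 1 ≠ n := by
      intro e
      have : (⟨t, ht⟩ : Fin (n + 2)) = Fin.last (n + 1) := by ext; simp; omega
      rw [this, ← hc.last] at hs
      exact hs (hp _ (by simp; omega))
    -- otherwise the south face has a non-propagating edge at `0` and another one at `t`
    have h0 : i ≠ 0 := by
      rintro rfl
      have ha : c.aValue = 1 := by
        refine aValue_eq_one_of_cup h g (by simp) fun z z1 z2 => hp z ?_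
        rw [Ne, ← Fin.val_inj] at z1 z2
        simp only at z1 z2
        omega
      have hz : ¬ c.IsProp (Sum.inl 0) := not_isProp_inl.2 ⟨_, h⟩
      rw [hc.zero] at hz
      obtain ⟨y, hy⟩ := not_isProp_inr.1 hz
      have hy1 := (hc.south _ _ hy).1
      obtain ⟨z, hz⟩ := not_isProp_inr.1 hs
      have hz1 := (hc.south _ _ hz).1
      have hz2 := hpp (Sum.inr ⟨t, ht⟩)
      rw [hz] at hz2
      simp only [Fin.val_zero] at hy1 hz1
      have hzt : z.val + 1 = t := by
        by_contra hcon
        have := hv (Sum.inr z) (by simp; omega)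
        rw [hz2] at this
        simp at this
      rw [← aValue_flip hpp hc.partner_ne] at ha
      refine aValue_ne_one_of_two (d := c.flip) (x := 0) (y := z) (x' := y) (y' := ⟨t, ht⟩)
        ?_ ?_ ?_ ?_ ?_ ha
      · simp [PreDiagram.flip, hy]
      · simp [PreDiagram.flip, hz2]
      · rw [Fin.lt_def, Fin.val_zero]; omega
      · rw [Fin.lt_def]; simp only; omega
      · rw [Ne, ← Fin.val_inj, Fin.val_zero]; omega
    obtain ⟨s1, s2⟩ := shift_mid (n := n) (i := i) h0 (by omega)
    have hX := hp ⟨i + 2, by omega⟩ le_rfl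
    obtain ⟨y, hy⟩ := isProp_inl.1 hX
    obtain ⟨a, ha, -⟩ := PreDiagram.exists_slide (hi := by omega) (w := []) (v := []) hlr h
      (by rw [(hc.north _ _ h).2]; simp) (by rw [s1, hc.word_prop _ hX]; rfl)
      (fun _ => by rw [s1, hc.vert]; rfl) (fun _ => rfl)
    have hac := ha.clean hc hn h0 h1 hX
    have hne : Sum.inr ⟨t, ht⟩ ≠ c.partner (Sum.inl ⟨i + 2, by omega⟩) := by
      intro e
      have := hpp (Sum.inl ⟨i + 2, by omega⟩)
      rw [← e] at this
      rw [isProp_inr] at hs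
      exact hs ⟨_, this⟩
    have hfix : ∀ p : Node (n + 2), t + 1 ≤ (p.elim id id).val → a.partner p = c.partner p := by
      intro p hp'
      refine (ha.other p ?_ ?_ ?_ ?_).1
      · rintro rfl; simp at hp'; omega
      · rintro rfl; simp at hp'; omega
      · rintro rfl; simp at hp'; omega
      · rintro rfl
        have := hv _ hp'
        rw [hpp, hy, Sum.swap_inr] at this
        rw [hy] at hp'
        simp only [Sum.inl.injEq, ← Fin.val_inj] at this
        simp at hp'
        omega
    obtain ⟨b, hb, hbc⟩ : ∃ b, Red a b ∧ b.Clean ∧ b.VerticalFrom (t + 1) ∧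
        ¬ b.IsProp (Sum.inl ⟨t, ht⟩) ∧ ¬ b.IsProp (Sum.inr ⟨t, ht⟩) := by
      refine ih (i + 1) (by omega) (by omega) hac (fun p hp' => by rw [hfix p hp', hv p hp'])
        ha.partner_one (fun x hx => ?_) ?_
      · by_cases hxt : x.val ≤ t
        · have := ha.isProp_swap hlr (Sum.inl x)
          rw [Equiv.swap_apply_of_ne_of_ne (by simp [← Fin.val_inj]; omega)
            (by simp [← Fin.val_inj]; omega)] at this
          exact this.2 (hp x (by omega))
        · rw [IsProp, hfix _ (by simp; omega)]
          exact hp x (by omega)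
      · rw [IsProp, (ha.other _ (by simp) (by simp) (by simp) hne).1]
        exact hs
    exact ⟨b, (ha.red hlr hn).trans hb, hbc⟩

/-- The rightmost non-propagating edges of both faces can be moved on top of each other. -/
theorem Clean.align (hn : 2 ≤ n) {t : ℕ} (ht : t < n + 2) {c : PreDiagram (n + 2)} (hc : c.Clean)
    (hv : c.VerticalFrom (t + 1)) (hs : ¬ c.IsProp (Sum.inr ⟨t, ht⟩)) :
    ∃ a, Red c a ∧ a.Clean ∧ a.VerticalFrom (t + 1) ∧ ¬ a.IsProp (Sum.inl ⟨t, ht⟩) ∧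
      ¬ a.IsProp (Sum.inr ⟨t, ht⟩) := by
  classical
  have hpp := hc.partner_partner
  have hne : (Finset.univ.filter fun x : Fin (n + 2) => ¬ c.IsProp (Sum.inl x)).Nonempty := by
    have ha := aValue_ne_zero hpp hc.partner_ne hs
    rw [aValue] at ha
    obtain ⟨x, hx⟩ := Finset.card_ne_zero.1 ha
    simp only [Finset.mem_filter, Finset.mem_univ, true_and] at hx
    obtain ⟨j, hj, _⟩ := hx
    exact ⟨x, by simpa using not_isProp_inl.2 ⟨j, hj⟩⟩
  obtain ⟨⟨y, hy⟩, hy1, hy2⟩ := Finset.exists_max_image _ (fun x => x.val) hne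
  simp only [Finset.mem_filter, Finset.mem_univ, true_and] at hy1 hy2
  obtain ⟨⟨i, hi⟩, hi'⟩ := not_isProp_inl.1 hy1
  have g := hpp (Sum.inl ⟨y, hy⟩)
  rw [hi'] at g
  have hle := hy2 ⟨i, hi⟩ (not_isProp_inl.2 ⟨_, g⟩)
  have hc1 := (hc.north _ _ hi').1
  simp only at hle hc1
  obtain rfl : y = i + 1 := by omega
  refine Clean.push_right hn ht t i ?_ (by omega) hc hv g (fun x hx => ?_) hs
  · by_contra hcon
    have := hv (Sum.inl ⟨i + 1, hy⟩) (by simp; omega)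
    rw [hi'] at this
    simp at this
  · by_contra hcon
    have := hy2 x hcon
    omega

/-- A clean diagram is a product of simple diagrams. -/
theorem Clean.isProduct (hn : 2 ≤ n) : ∀ (m : ℕ) {c : PreDiagram (n + 2)}, m ≤ n + 2 → c.Clean →
    c.VerticalFrom m → c.IsProduct := by
  intro m
  induction m using Nat.strong_induction_on with
  | _ m ih =>
    intro c hm hc hv
    rcases m with _ | t
    · have h1 : ∀ p, c.partner p = p.swap := fun p => hv p (Nat.zero_le _)
      have : c = identity (n + 2) := by
        have h2 : c.partner = Sum.swap := funext h1
        have h3 : c.word = fun _ => [] := funext fun p => hc.word_prop p (by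
          rw [IsProp, h1]
          rcases p with p | p <;> simp)
        have h4 := hc.loops
        have h5 := hc.vert
        cases c
        simp only at h2 h3 h4 h5
        subst h2 h3 h4 h5
        rfl
      rw [this]
      exact identity_isProduct
    · have ht : t < n + 2 := by omega
      have key : ∀ c : PreDiagram (n + 2), c.Clean → c.VerticalFrom (t + 1) →
          ¬ c.IsProp (Sum.inl ⟨t, ht⟩) → ¬ c.IsProp (Sum.inr ⟨t, ht⟩) → c.IsProduct := by
        intro c hc hv h1 h2
        obtain ⟨⟨x, hx⟩, hx'⟩ := not_isProp_inl.1 h1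
        obtain ⟨⟨y, hy⟩, hy'⟩ := not_isProp_inr.1 h2
        have e1 := (hc.north _ _ hx').1
        have e2 := (hc.south _ _ hy').1
        have g1 := hc.partner_partner (Sum.inl ⟨t, ht⟩)
        have g2 := hc.partner_partner (Sum.inr ⟨t, ht⟩)
        rw [hx'] at g1
        rw [hy'] at g2
        have f1 : ¬ t + 1 ≤ x := fun h => by
          rw [hv (Sum.inl ⟨x, hx⟩) h] at g1
          simp at g1
        have f2 : ¬ t + 1 ≤ y := fun h => by
          rw [hv (Sum.inr ⟨y, hy⟩) h] at g2
          simp at g2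
        simp only at e1 e2
        obtain rfl : x = y := by omega
        obtain rfl : t = x + 1 := by omega
        obtain ⟨a, ha, hac, hav⟩ := hc.cut ht hv g1 g2
        exact ha.isProduct (ih x (by omega) (by omega) hac hav)
      by_cases h2 : c.IsProp (Sum.inr ⟨t, ht⟩)
      · by_cases h1 : c.IsProp (Sum.inl ⟨t, ht⟩)
        · refine ih t (by omega) (by omega) hc ?_
          obtain ⟨x, hx⟩ := isProp_inl.1 h1
          obtain ⟨y, hy⟩ := isProp_inr.1 h2
          have g1 := hc.partner_partner (Sum.inl ⟨t, ht⟩)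
          have g2 := hc.partner_partner (Sum.inr ⟨t, ht⟩)
          rw [hx] at g1
          rw [hy] at g2
          have f1 : ¬ t + 1 ≤ x.val := fun h => by
            rw [hv (Sum.inr x) h] at g1
            simp only [Sum.swap_inr, Sum.inl.injEq] at g1
            rw [g1] at h
            simp at h
          have f2 : ¬ t + 1 ≤ y.val := fun h => by
            rw [hv (Sum.inl y) h] at g2
            simp only [Sum.swap_inl, Sum.inr.injEq] at g2
            rw [g2] at h
            simp at h
          -- otherwise the two edges cross
          have hpl := hc.planar (Sum.inl y) (Sum.inl ⟨t, ht⟩)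
          rw [g2, hx] at hpl
          simp only [posL] at hpl
          have hxy : x.val = t := by
            by_contra hne
            have hyt : y.val ≠ t := fun e => by
              obtain rfl : y = ⟨t, ht⟩ := Fin.ext e
              rw [hx] at g2
              simp only [Sum.inr.injEq] at g2
              rw [g2] at hne
              exact hne rfl
            omega
          obtain rfl : x = ⟨t, ht⟩ := Fin.ext hxy
          intro p hp
          by_cases hp' : t + 1 ≤ (p.elim id id).val
          · exact hv p hp'
          · rcases p with ⟨p, hp1⟩ | ⟨p, hp1⟩ <;> simp at hp hp' <;> obtain rfl : p = t := by omega
            · exact hx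
            · exact g1
        · obtain ⟨a, ha, hac, hav, n1, n2⟩ := hc.flip.align hn ht hv.flip (by rwa [isProp_flip])
          have := ha.flip
          rw [flip_flip] at this
          exact this.isProduct (key _ hac.flip hav.flip (by rwa [isProp_flip])
            (by rwa [isProp_flip]))
      · obtain ⟨a, ha, hac, hav, n1, n2⟩ := hc.align hn ht hv h2
        exact ha.isProduct (key a hac hav n1 n2)

end clean_product

/-! ### Loops -/

section loops

variable {n : ℕ}

/-- The diagram with the same edges as `d` and the loops `M`. -/
def withLoops (d : PreDiagram (n + 2)) (M : Multiset LoopWord) : PreDiagram (n + 2) where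
  partner := d.partner
  word := d.word
  loops := M
  vert := d.vert

theorem IsLR.withLoops {d : PreDiagram (n + 2)} (hd : d.IsLR) (h0 : d.propCount = 0)
    {M : Multiset LoopWord} (hM : ∀ L ∈ M, ∃ u, L = loopOf u ∧ ClosedBeforeOpen u) :
    (d.withLoops M).IsLR where
  partner_partner := hd.partner_partner
  partner_ne := hd.partner_ne
  planar := hd.planar
  word_partner := hd.word_partner
  closed_exposed := hd.closed_exposed
  open_exposed := hd.open_exposed
  north_sorted := hd.north_sorted
  south_sorted := hd.south_sorted
  loops_undammed _ := hM
  loops_dammed h := absurd h0 h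
  vert_nil := hd.vert_nil
  vert_left := hd.vert_left
  vert_right := hd.vert_right
  undecorated h1 := by
    have h2 : d.aValue = 0 := h1
    have := two_mul_aValue_add hd.partner_partner hd.partner_ne
    omega

theorem loopOf_perm {u v : List Deco} (h : loopOf u = loopOf v) : u.Perm v := by
  rcases Quotient.exact h with h | h
  · exact h.perm
  · exact h.perm.trans v.reverse_perm

/-- A diagram with loops carrying both types of triangles is undammed. -/
theorem Taut.propCount_eq_zero {c : PreDiagram (n + 2)} (hc : c.Taut) (hl : c.loops ≠ 0) :
    c.propCount = 0 := by
  by_contra h0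
  obtain ⟨L, hL⟩ := Multiset.exists_mem_of_ne_zero hl
  obtain ⟨u, hu, h⟩ := hc.isLR.loops_dammed h0 L hL
  rw [hc.loops L hL] at hu
  have hp : ∀ x, x ∈ [Deco.tri, Deco.otri] ↔ x ∈ u := fun _ => (loopOf_perm hu).mem_iff
  rcases h with h | h
  · have := h .otri ((hp _).1 (by simp))
    simp [Deco.isClosed] at this
  · have := h .tri ((hp _).1 (by simp))
    simp [Deco.isOpen, Deco.isClosed] at this

theorem isProduct_of_loopReduces {d e : PreDiagram (n + 2)} (he : e.IsProduct) (hd : d.IsLR)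
    (h : d.LoopReduces 1 e ∨ e.LoopReduces 1 d) : d.IsProduct := by
  obtain ⟨hel, l, hl⟩ := he
  refine ⟨hd, l, ?_⟩
  rw [← hl]
  rcases h with h | h
  · have := RingQuot.mkAlgHom_rel ℤ[X] (Rel.loop (⟨d, hd⟩ : LRDiagram n) ⟨e, hel⟩ 1 h)
    rwa [one_smul] at this
  · have := RingQuot.mkAlgHom_rel ℤ[X] (Rel.loop (⟨e, hel⟩ : LRDiagram n) ⟨d, hd⟩ 1 h)
    rw [one_smul] at this
    exact this.symm

/-- The diagram from which the simple diagram at the left wall splits off the loop `L` as well as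
the edge at the first two north nodes: this edge is given two further open circles. -/
def splitLoop (d : PreDiagram (n + 2)) (M : Multiset LoopWord) : PreDiagram (n + 2) where
  partner := d.partner
  word p := if p = Sum.inl 0 then [.dot, .odot, .odot] else
    if p = Sum.inl 1 then [.odot, .odot, .dot] else d.word p
  loops := M
  vert := d.vert

/-- The edge `{0, 1}` of `splitLoop` and the south edge of the simple diagram close up to a loop,
and the north edge of the simple diagram takes its place. -/
theorem splitLoop_isConcat {d : PreDiagram (n + 2)} (hd : d.IsLR) {M : Multiset LoopWord}
    (h : d.partner (Sum.inl 0) = Sum.inl 1) (hw : d.word (Sum.inl 0) = [.dot]) (ha : d.aValue ≠ 1) :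
    IsConcat (simple (0 : Fin (n + 1))) (d.splitLoop M)
      (d.withLoops (loopOf [.dot, .dot, .odot, .odot] ::ₘ M)) := by
  have h' := hd.partner_partner (Sum.inl 0)
  have hw' := hd.word_partner (Sum.inl 0)
  rw [h] at h' hw'
  have hs : ∀ p, (d.splitLoop M).partner p = d.partner p := fun _ => rfl
  have key : ∀ p, p ≠ Sum.inl 0 → p ≠ Sum.inl 1 →
      Trace (simple (0 : Fin (n + 1))) (d.splitLoop M) (Sum.inr p) (d.partner p) (d.word p) := by
    intro p h0 h1
    have hwp : (d.splitLoop M).word p = d.word p := by simp [splitLoop, h0, h1]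
    rw [← hwp]
    refine trace_of_partner (i := 0) (by omega) (hs p) fun x hx => ⟨fun e => h1 ?_, fun e => h0 ?_⟩
    · obtain rfl : x = 0 := Fin.ext e
      rw [← hd.partner_partner p, hx, h]
    · obtain rfl : x = 1 := Fin.ext (by simpa using e)
      rw [← hd.partner_partner p, hx, h']
  have hloop : LoopTrace (simple (0 : Fin (n + 1))) (d.splitLoop M) 0 0
      [.dot, .odot, .odot, .dot] := by
    have := LoopTrace.start (a := simple (0 : Fin (n + 1))) (b := d.splitLoop M) (m := 0) (j := 1)
      (l := 0) (by simp [simple]) h' (Fin.zero_le _) (Fin.zero_le _)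
    have e : (simple (0 : Fin (n + 1))).word (Sum.inr 0) ++ (d.splitLoop M).word (Sum.inl 1) =
      [.dot, .odot, .odot, .dot] := by simp [simple, splitLoop]
    rwa [e] at this
  have hzero : ∀ m x w, LoopTrace (simple (0 : Fin (n + 1))) (d.splitLoop M) m x w → m = 0 := by
    intro m x w ht
    induction ht with
    | start ha _ hj _ =>
      have := simple_inr_ends (i := 0) (by omega) ha
      rw [Fin.le_def] at hj
      exact Fin.ext (by rw [Fin.val_zero]; omega)
    | step _ _ _ _ _ _ ih => exact ih
  refine ⟨fun x => ?_, fun x => key _ (by simp) (by simp),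
    ⟨{0}, fun _ => [.dot, .odot, .odot, .dot], fun m => ?_, fun m hm => ?_, ?_⟩,
    fun h => absurd h ha⟩
  · by_cases h0 : x = 0
    · subst h0
      have := Trace.top (a := simple (0 : Fin (n + 1))) (b := d.splitLoop M) (p := Sum.inl 0)
        (i := 1) (by simp [simple])
      have e : (simple (0 : Fin (n + 1))).word (Sum.inl 0) = d.word (Sum.inl 0) := by
        rw [hw]; simp [simple]
      rw [e, ← h] at this
      exact this
    by_cases h1 : x = 1
    · subst h1
      have := Trace.top (a := simple (0 : Fin (n + 1))) (b := d.splitLoop M) (p := Sum.inl 1)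
        (i := 0) (by simp [simple])
      have e : (simple (0 : Fin (n + 1))).word (Sum.inl 1) = d.word (Sum.inl 1) := by
        rw [hw', hw]; simp [simple]
      rw [e, ← h'] at this
      exact this
    · have h0' : x.val ≠ 0 := fun e => h0 (Fin.ext e)
      have h1' : x.val ≠ 0 + 1 := fun e => h1 (Fin.ext (by simpa using e))
      have := Trace.down (simple_inl_of_ne (i := 0) (by omega) h0' h1')
        (key (Sum.inl x) (by simpa using h0) (by simpa using h1))
      rwa [simple_word_of_ne (i := 0) (by omega) (by simpa using h0) (by simpa using h1'),
        List.nil_append] at this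
  · rw [Finset.mem_singleton]
    refine ⟨?_, fun ⟨w, hw⟩ => hzero _ _ _ hw⟩
    rintro rfl
    exact ⟨_, hloop⟩
  · rw [Finset.mem_singleton] at hm
    subst hm
    exact hloop
  · have : loopOf [.dot, .dot, .odot, .odot] = loopOf [.dot, .odot, .odot, .dot] :=
      Quotient.sound (Or.inl ⟨1, rfl⟩)
    rw [this]
    simp [PreDiagram.withLoops, splitLoop, simple, ← Multiset.singleton_add, add_comm]

/-- The additional open circles can be taken to the right wall, since nothing closed is to the right
of them. -/
theorem splitLoop_isLR {d : PreDiagram (n + 2)} (hd : d.IsLR) (h0 : d.propCount = 0)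
    (h : d.partner (Sum.inl 0) = Sum.inl 1) (hw : d.word (Sum.inl 0) = [.dot]) (ha : d.aValue ≠ 1)
    (hopen : ∀ x y, x ≠ 0 → d.partner (Sum.inl x) = Sum.inl y → x < y →
      ∀ l ∈ d.word (Sum.inl x), l.isOpen = true) {M : Multiset LoopWord}
    (hM : ∀ L ∈ M, L ∈ d.loops) : (d.splitLoop M).IsLR := by
  have hpp := hd.partner_partner
  have h' := hpp (Sum.inl 0)
  have hw' := hd.word_partner (Sum.inl 0)
  rw [h] at h' hw'
  rw [hw] at hw'
  have w0 : (d.splitLoop M).word (Sum.inl 0) = [.dot, .odot, .odot] := by simp [splitLoop]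
  have w1 : (d.splitLoop M).word (Sum.inl 1) = [.odot, .odot, .dot] := by simp [splitLoop]
  have w2 : ∀ p, p ≠ Sum.inl 0 → p ≠ Sum.inl 1 → (d.splitLoop M).word p = d.word p := by
    intro p q0 q1
    simp [splitLoop, q0, q1]
  -- in an undammed diagram, the edge `{0, 1}` is exposed to the right wall below the other edges
  have hR : ∀ p, p = Sum.inl 0 ∨ p = Sum.inl 1 → d.Exposed posR p := by
    intro p hp q
    have hq : posR (d.partner q) < n + 2 ∨ ¬ posR q < n + 2 := by
      rcases q with q | q
      · obtain ⟨y, hy⟩ := not_isProp_inl.1 (not_isProp_of_propCount hpp h0 (Sum.inl q))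
        rw [hy]
        left
        simp only [posR]
        omega
      · right
        simp only [posR]
        omega
    rcases hp with rfl | rfl
    · rw [h]
      have e0 : posR (Sum.inl 0 : Node (n + 2)) = n + 2 - 1 - 0 := rfl
      have e1 : posR (Sum.inl 1 : Node (n + 2)) = n + 2 - 1 - 1 := rfl
      omega
    · rw [h']
      have e0 : posR (Sum.inl 0 : Node (n + 2)) = n + 2 - 1 - 0 := rfl
      have e1 : posR (Sum.inl 1 : Node (n + 2)) = n + 2 - 1 - 1 := rfl
      omega
  refine ⟨hpp, hd.partner_ne, hd.planar, fun p => ?_, fun p l hl hlc => ?_, fun p l hl hlc => ?_,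
    fun _ => ?_, hd.south_sorted, fun h0 L hL => hd.loops_undammed h0 L (hM L hL),
    fun h1 => absurd h0 h1, hd.vert_nil, fun h1 => absurd h1 ha, fun h1 => absurd h1 ha,
    fun h1 => ?_⟩
  · by_cases p0 : p = Sum.inl 0
    · subst p0
      have : (d.splitLoop M).partner (Sum.inl 0) = Sum.inl 1 := h
      rw [this, w0, w1]
      rfl
    by_cases p1 : p = Sum.inl 1
    · subst p1
      have : (d.splitLoop M).partner (Sum.inl 1) = Sum.inl 0 := h'
      rw [this, w0, w1]
      rfl
    · have : (d.splitLoop M).partner p = d.partner p := rfl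
      rw [this, w2 p p0 p1, w2, hd.word_partner]
      · intro e
        apply p1
        rw [← hpp p, e, h]
      · intro e
        apply p0
        rw [← hpp p, e, h']
  · by_cases p0 : p = Sum.inl 0
    · subst p0
      exact hd.closed_exposed _ .dot (by rw [hw]; simp) rfl
    by_cases p1 : p = Sum.inl 1
    · subst p1
      exact hd.closed_exposed _ .dot (by rw [hw']; simp) rfl
    · rw [w2 p p0 p1] at hl
      exact hd.closed_exposed p l hl hlc
  · by_cases p0 : p = Sum.inl 0
    · exact hR p (Or.inl p0)
    by_cases p1 : p = Sum.inl 1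
    · exact hR p (Or.inr p1)
    · rw [w2 p p0 p1] at hl
      exact hd.open_exposed p l hl hlc
  · have hs := northWord_sorted_iff.1 (hd.north_sorted h0)
    have hne : ∀ x y : Fin (n + 2), x ≠ 0 → d.partner (Sum.inl x) = Sum.inl y → x < y → x ≠ 1 := by
      rintro x y hx hxy hlt rfl
      rw [h'] at hxy
      simp only [Sum.inl.injEq] at hxy
      rw [← hxy] at hlt
      exact absurd hlt (Fin.not_lt_zero _)
    rw [northWord_sorted_iff]
    refine ⟨fun i j hij hlt => ?_, fun i i' j j' hi hj hii hjj hij x hx y hy hxo => ?_⟩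
    · by_cases i0 : i = 0
      · subst i0
        rw [w0]
        simp [ClosedBeforeOpen, Deco.isOpen, Deco.isClosed]
      · rw [w2 _ (by simpa using i0) (by simpa using hne i j i0 hij hlt)]
        exact hs.1 i j hij hlt
    · have j0 : j ≠ 0 := by
        rintro rfl
        exact absurd hij (Fin.not_lt_zero _)
      rw [w2 _ (by simpa using j0) (by simpa using hne j j' j0 hj hjj)] at hy
      exact hopen j j' j0 hj hjj y hy
  · have h2 : d.aValue = 0 := h1
    have := two_mul_aValue_add hpp hd.partner_ne
    omega

theorem splitLoop_taut (hn : 2 ≤ n) {d : PreDiagram (n + 2)} (hd : d.Taut)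
    (h : d.partner (Sum.inl 0) = Sum.inl 1) (ha : d.aValue ≠ 1) (h0 : d.propCount = 0)
    {M : Multiset LoopWord} (hM : ∀ L ∈ M, L ∈ d.loops) (hlr : (d.splitLoop M).IsLR) :
    (d.splitLoop M).Taut := by
  have hpp := hd.isLR.partner_partner
  have h' := hpp (Sum.inl 0)
  rw [h] at h'
  have hwalk : Walk (zone (Sum.inl 0 : Node (n + 2))) [.dot, .odot, .odot]
      (zone (Sum.inl 1 : Node (n + 2))) := by
    have z0 : zone (Sum.inl 0 : Node (n + 2)) = .L := rfl
    have z1 : zone (Sum.inl 1 : Node (n + 2)) = .M := by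
      simp [zone, column]; omega
    rw [z0, z1]
    exact .dotL (.odotM (.odotR (.nil _)))
  refine ⟨hlr, fun p hp => ?_, fun _ p hp => ?_, fun h1 => absurd h1 ha, fun L hL =>
    hd.loops L (hM L hL)⟩
  · by_cases p0 : p = Sum.inl 0
    · subst p0
      have : (d.splitLoop M).partner (Sum.inl 0) = Sum.inl 1 := h
      rw [this]
      simp only [splitLoop, if_true]
      exact ⟨hwalk, by decide, by decide⟩
    by_cases p1 : p = Sum.inl 1
    · subst p1
      have e1 : (d.splitLoop M).partner (Sum.inl 1) = Sum.inl 0 := h'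
      have e2 : (d.splitLoop M).word (Sum.inl 1) = [.odot, .odot, .dot] := by simp [splitLoop]
      rw [e1, e2]
      exact ⟨hwalk.reverse, by decide, by decide⟩
    · have : (d.splitLoop M).word p = d.word p := by simp [splitLoop, p0, p1]
      rw [this]
      exact hd.nonprop p hp
  · exact absurd hp (not_isProp_of_propCount hpp h0 p)

/-- A taut diagram is a product of simple diagrams. The loops are split off one by one by a simple
diagram at the left wall. -/
theorem Taut.isProduct (hn : 2 ≤ n) : ∀ (m : ℕ) {c : PreDiagram (n + 2)}, c.Taut →
    c.loops.card = m → c.IsProduct := by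
  intro m
  induction m with
  | zero =>
    intro c hc hm
    obtain ⟨a, ha, h1, h2, h3⟩ := hc.exists_reduced hn _ le_rfl
    have hl : a.loops = 0 := by rw [ha.loops]; exact Multiset.card_eq_zero.1 hm
    exact ha.red.isProduct ((ha.taut.clean hn h1 h2 h3 hl).isProduct hn (n + 2) le_rfl
      fun p hp => by rcases p with p | p <;> simp at hp <;> omega)
  | succ m ih =>
    intro c hc hm
    obtain ⟨a, ha, hf, hf', h3⟩ := hc.exists_reduced hn _ le_rfl
    refine ha.red.isProduct ?_
    rw [← ha.loops] at hm
    have hlr := ha.taut.isLR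
    have hpp := hlr.partner_partner
    have h0 := ha.taut.propCount_eq_zero fun e => by rw [e] at hm; simp at hm
    have h1 := not_isProp_of_propCount hpp h0
    have hav : a.aValue ≠ 1 := by
      have := two_mul_aValue_add hpp hlr.partner_ne
      omega
    obtain ⟨L, hL⟩ := Multiset.exists_mem_of_ne_zero (s := a.loops) fun e => by
      rw [e] at hm; simp at hm
    obtain ⟨M, hM⟩ := Multiset.exists_cons_of_mem hL
    have hMl : ∀ L' ∈ M, L' ∈ a.loops := fun L' h => by rw [hM]; exact Multiset.mem_cons_of_mem h
    have hMs : ∀ u, ClosedBeforeOpen u → ∀ L' ∈ loopOf u ::ₘ M,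
        ∃ u, L' = loopOf u ∧ ClosedBeforeOpen u := by
      intro u hu L' hL'
      rcases Multiset.mem_cons.1 hL' with rfl | hL'
      · exact ⟨u, rfl, hu⟩
      · exact hlr.loops_undammed h0 L' (hMl L' hL')
    have hLw := ha.taut.loops L hL
    subst hLw
    obtain ⟨y, hy⟩ := not_isProp_inl.1 (h1 (Sum.inl 0))
    have hy1 := hf _ _ hy
    obtain rfl : y = 1 := Fin.ext (by simp at hy1 ⊢; omega)
    -- away from the left wall, only open circles are left in the north face
    have hword : ∀ (i : ℕ) (hi : i + 1 < n + 2),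
        a.partner (Sum.inl ⟨i, by omega⟩) = Sum.inl ⟨i + 1, hi⟩ →
        a.word (Sum.inl ⟨i, by omega⟩) = mark n i := by
      classical
      intro i hi hcup
      have := Finset.sum_eq_zero_iff.1 h3 (Sum.inl ⟨i, by omega⟩) (Finset.mem_univ _)
      rw [surplus, if_neg (h1 _)] at this
      exact ha.taut.word_eq_mark hn hi hcup (by omega) (by omega)
    have hw : a.word (Sum.inl 0) = [.dot] := hword 0 (by omega) hy
    have hlrb := splitLoop_isLR hlr h0 hy hw hav (fun x y hx hxy hlt l hl => by
      have := hf _ _ hxy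
      obtain ⟨x, hx'⟩ := x
      obtain ⟨y, hy'⟩ := y
      simp only [Fin.lt_def] at this hlt
      obtain rfl : y = x + 1 := by omega
      rw [hword x hy' hxy] at hl
      rcases mem_mark_iff hl with ⟨h, _⟩ | ⟨_, rfl⟩
      · exact absurd (Fin.ext h) hx
      · rfl) hMl
    have hb : (a.splitLoop M).IsProduct := ih (splitLoop_taut hn ha.taut hy hav h0 hMl hlrb) (by
      rw [hM, Multiset.card_cons] at hm
      exact Nat.succ_injective hm)
    -- the loop `••∘∘` arising from the product is rewritten to `▲∘∘` and then to `▲△`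
    have c1 := hb.simple_mul (hlr.withLoops h0 (hMs [.dot, .dot, .odot, .odot] (by
      simp [ClosedBeforeOpen, Deco.isOpen, Deco.isClosed]))) (splitLoop_isConcat hlr hy hw hav)
    have c2 : (a.withLoops (loopOf [.tri, .odot, .odot] ::ₘ M)).IsProduct :=
      isProduct_of_loopReduces c1 (hlr.withLoops h0 (hMs _ (by
        simp [ClosedBeforeOpen, Deco.isOpen, Deco.isClosed])))
        (Or.inr ⟨⟨rfl, rfl, rfl⟩, _, _, M, ⟨[], [.odot, .odot], _, _, .dot_dot, rfl, rfl⟩, rfl,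
          rfl⟩)
    exact isProduct_of_loopReduces c2 hlr
      (Or.inr ⟨⟨rfl, rfl, rfl⟩, _, _, M, ⟨[.tri], [], _, _, .odot_odot, rfl, rfl⟩, rfl, hM⟩)

end loops

end PreDiagram

/-! ### Splitting triangles into circles -/

/-- The word in circles that a decoration stands for. -/
def Deco.split : Deco → List Deco
  | .dot => [.dot]
  | .tri => [.dot, .dot]
  | .odot => [.odot]
  | .otri => [.odot, .odot]

/-- The word obtained by splitting all triangles into pairs of circles. -/
def expand (u : List Deco) : List Deco := u.flatMap Deco.split

/-- The decoration is a triangle. -/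
def Deco.isTri : Deco → Bool
  | .dot => false
  | .tri => true
  | .odot => false
  | .otri => true

theorem expand_append (u v : List Deco) : expand (u ++ v) = expand u ++ expand v :=
  List.flatMap_append

theorem expand_reverse (u : List Deco) : expand u.reverse = (expand u).reverse := by
  induction u with
  | nil => rfl
  | cons a u ih =>
    rw [List.reverse_cons, expand_append, ih, show a :: u = [a] ++ u from rfl, expand_append,
      List.reverse_append]
    congr 1
    cases a <;> rfl

theorem expand_eq_self {u : List Deco} (h : u.countP Deco.isTri = 0) : expand u = u := by
  induction u with
  | nil => rfl
  | cons a u ih =>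
    rw [List.countP_cons] at h
    rw [show a :: u = [a] ++ u from rfl, expand_append, ih (by omega)]
    cases a <;> first | rfl | simp [Deco.isTri] at h

/-- `v` arises from `u` by splitting one triangle. -/
def SplitsTo (u v : List Deco) : Prop :=
  ∃ x t y, Deco.isTri t = true ∧ u = x ++ t :: y ∧ v = x ++ (t.split ++ y)

theorem exists_splitsTo {u : List Deco} (h : u.countP Deco.isTri ≠ 0) : ∃ v, SplitsTo u v := by
  rw [← Nat.pos_iff_ne_zero, List.countP_pos_iff] at h
  obtain ⟨t, ht, h⟩ := h
  obtain ⟨x, y, rfl⟩ := List.append_of_mem ht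
  exact ⟨_, x, t, y, h, rfl, rfl⟩

namespace SplitsTo

variable {u v : List Deco}

theorem reduces (h : SplitsTo u v) : Reduces v 1 u := by
  obtain ⟨x, t, y, ht, rfl, rfl⟩ := h
  refine ⟨x, y, t.split, [t], ?_, by simp, by simp⟩
  cases t
  · simp [Deco.isTri] at ht
  · exact .dot_dot
  · simp [Deco.isTri] at ht
  · exact .odot_odot

theorem reverse (h : SplitsTo u v) : SplitsTo u.reverse v.reverse := by
  obtain ⟨x, t, y, ht, rfl, rfl⟩ := h
  refine ⟨y.reverse, t, x.reverse, ht, by simp, ?_⟩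
  cases t <;> simp [Deco.split]

theorem expand_eq (h : SplitsTo u v) : expand v = expand u := by
  obtain ⟨x, t, y, ht, rfl, rfl⟩ := h
  rw [show t :: y = [t] ++ y from rfl]
  simp only [expand_append]
  cases t <;> rfl

theorem countP_lt (h : SplitsTo u v) : v.countP Deco.isTri < u.countP Deco.isTri := by
  obtain ⟨x, t, y, ht, rfl, rfl⟩ := h
  cases t <;> simp [Deco.isTri] at ht <;> simp [Deco.split, Deco.isTri, List.countP_cons]

theorem mem (h : SplitsTo u v) {l : Deco} (hl : l ∈ v) : ∃ l' ∈ u, l'.isClosed = l.isClosed := by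
  obtain ⟨x, t, y, ht, rfl, rfl⟩ := h
  simp only [List.mem_append] at hl
  rcases hl with hl | hl | hl
  · exact ⟨l, by simp [hl], rfl⟩
  · refine ⟨t, by simp, ?_⟩
    cases t <;> simp [Deco.split] at hl <;> subst hl <;> rfl
  · exact ⟨l, by simp [hl], rfl⟩

theorem sorted (h : SplitsTo u v) (hu : ClosedBeforeOpen u) : ClosedBeforeOpen v := by
  obtain ⟨x, t, y, ht, rfl, rfl⟩ := h
  have hs : ∀ l ∈ t.split, l.isOpen = t.isOpen := by
    cases t <;> simp [Deco.split, Deco.isOpen, Deco.isClosed]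
  rw [ClosedBeforeOpen, List.pairwise_append] at hu ⊢
  rw [List.pairwise_cons] at hu
  rw [List.pairwise_append]
  obtain ⟨h1, ⟨h2, h3⟩, h4⟩ := hu
  refine ⟨h1, ⟨?_, h3, ?_⟩, ?_⟩
  · cases t <;> simp [Deco.split]
  · intro a ha b hb
    rw [hs a ha]
    exact h2 b hb
  · intro a ha b hb
    rcases List.mem_append.1 hb with hb | hb
    · rw [hs b hb]
      exact h4 a ha t (by simp)
    · exact h4 a ha b (by simp [hb])

/-- Restricted to one type, the word changes in the same way or not at all. -/
theorem filter (h : SplitsTo u v) {f : Deco → Bool} (hf : f = Deco.isClosed ∨ f = Deco.isOpen) :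
    v.filter f = u.filter f ∨ SplitsTo (u.filter f) (v.filter f) := by
  obtain ⟨x, t, y, ht, rfl, rfl⟩ := h
  have hs : ∀ l ∈ t.split, f l = f t := by
    rcases hf with rfl | rfl <;> cases t <;> simp [Deco.split, Deco.isOpen, Deco.isClosed]
  rcases hft : f t with _ | _
  · left
    have : t.split.filter f = [] := List.filter_eq_nil_iff.2 fun l hl => by rw [hs l hl, hft]; simp
    simp [List.filter_append, this, hft]
  · right
    have : t.split.filter f = t.split := List.filter_eq_self.2 fun l hl => by rw [hs l hl, hft]
    exact ⟨x.filter f, t, y.filter f, ht, by simp [hft], by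
      simp [List.filter_append, this]⟩

end SplitsTo

namespace PreDiagram

section expansion

variable {n : ℕ}

/-- The diagram `d` with other decorations on its edges. -/
def reword (d : PreDiagram (n + 2)) (W : Node (n + 2) → List Deco) (V : List Deco) :
    PreDiagram (n + 2) where
  partner := d.partner
  word := W
  loops := d.loops
  vert := V

theorem reword_north_sorted {d : PreDiagram (n + 2)} {W : Node (n + 2) → List Deco}
    {V : List Deco} (hd : ClosedBeforeOpen d.northWord)
    (hw : ∀ p, ∀ l ∈ W p, ∃ l' ∈ d.word p, l'.isClosed = l.isClosed)
    (hs : ∀ p, ClosedBeforeOpen (d.word p) → ClosedBeforeOpen (W p)) :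
    ClosedBeforeOpen (d.reword W V).northWord := by
  rw [northWord_sorted_iff] at hd ⊢
  refine ⟨fun i j hij hlt => hs _ (hd.1 i j hij hlt),
    fun i i' j j' hi hj hii hjj hij x hx y hy hxo => ?_⟩
  obtain ⟨x', hx', ex⟩ := hw _ x hx
  obtain ⟨y', hy', ey⟩ := hw _ y hy
  have := hd.2 i i' j j' hi hj hii hjj hij x' hx' y' hy'
  simp only [Deco.isOpen] at this hxo ⊢
  rw [ex, ey] at this
  exact this hxo

theorem IsLR.reword {d : PreDiagram (n + 2)} (hd : d.IsLR) {W : Node (n + 2) → List Deco}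
    {V : List Deco} (hrev : ∀ p, W (d.partner p) = (W p).reverse)
    (hw : ∀ p, ∀ l ∈ W p, ∃ l' ∈ d.word p, l'.isClosed = l.isClosed)
    (hs : d.propCount = 0 → ∀ p, ClosedBeforeOpen (d.word p) → ClosedBeforeOpen (W p))
    (hv : d.aValue ≠ 1 → V = [])
    (hvl : d.aValue = 1 → ∀ i j, d.partner (Sum.inl i) = Sum.inr j →
      d.Exposed posL (Sum.inl i) → W (Sum.inl i) = V.filter Deco.isClosed)
    (hvr : d.aValue = 1 → ∀ i j, d.partner (Sum.inl i) = Sum.inr j →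
      d.Exposed posR (Sum.inl i) → W (Sum.inl i) = V.filter Deco.isOpen) :
    (d.reword W V).IsLR where
  partner_partner := hd.partner_partner
  partner_ne := hd.partner_ne
  planar := hd.planar
  word_partner := hrev
  closed_exposed p x hx hxc := by
    obtain ⟨y, hy, e⟩ := hw p x hx
    exact hd.closed_exposed p y hy (by rw [e, hxc])
  open_exposed p x hx hxc := by
    obtain ⟨y, hy, e⟩ := hw p x hx
    exact hd.open_exposed p y hy (by rw [Deco.isOpen, e]; exact hxc)
  north_sorted h0 := reword_north_sorted (hd.north_sorted h0) hw (hs h0)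
  south_sorted h0 := by
    rw [← northWord_flip]
    exact reword_north_sorted (d := d.flip) (W := fun p => W p.swap) (V := V.reverse)
      (by rw [northWord_flip]; exact hd.south_sorted h0) (fun p => hw p.swap)
      (fun p => hs h0 p.swap)
  loops_undammed := hd.loops_undammed
  loops_dammed := hd.loops_dammed
  vert_nil := hv
  vert_left := hvl
  vert_right := hvr
  undecorated h0 := by
    obtain ⟨h1, h2⟩ := hd.undecorated h0
    refine ⟨fun p => ?_, h2⟩
    rw [List.eq_nil_iff_forall_not_mem]
    intro l hl
    obtain ⟨l', hl', _⟩ := hw p l hl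
    rw [h1 p] at hl'
    simp at hl'

/-- `e` arises from `d` by splitting some triangles, and `d` is a product of simple diagrams if `e`
is. -/
structure Expands (d e : PreDiagram (n + 2)) : Prop where
  isLR : e.IsLR
  partner : e.partner = d.partner
  loops : e.loops = d.loops
  word : ∀ p, expand (e.word p) = expand (d.word p)
  vert : expand e.vert = expand d.vert
  isProduct : e.IsProduct → d.IsProduct

theorem isProduct_of_edgeReduces {d e : PreDiagram (n + 2)} (hd : d.IsProduct) (he : e.IsLR)
    (h : d.EdgeReduces 1 e) : e.IsProduct := by
  obtain ⟨hdl, l, hl⟩ := hd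
  refine ⟨he, l, ?_⟩
  rw [← hl]
  have := RingQuot.mkAlgHom_rel ℤ[X] (Rel.edge (⟨d, hdl⟩ : LRDiagram n) ⟨e, he⟩ 1 h)
  rw [one_smul] at this
  exact this.symm

/-- The number of triangles on the edges, with multiplicities. -/
def triCount (d : PreDiagram (n + 2)) : ℕ :=
  ∑ p, (d.word p).countP Deco.isTri + d.vert.countP Deco.isTri

/-- A triangle on an edge whose decorations do not belong to the vertical sequence can be split. -/
theorem IsLR.split_word {d : PreDiagram (n + 2)} (hd : d.IsLR) {p : Node (n + 2)}
    (hp : ¬ (d.aValue = 1 ∧ d.IsProp p)) (h : (d.word p).countP Deco.isTri ≠ 0) :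
    ∃ e, Expands d e ∧ e.triCount < d.triCount := by
  classical
  obtain ⟨v, hv⟩ := exists_splitsTo h
  have hpp := hd.partner_partner
  have hne := hd.partner_ne p
  have hcases : ∀ q, q = p ∨ q = d.partner p ∨ (q ≠ p ∧ q ≠ d.partner p) := by tauto
  let W : Node (n + 2) → List Deco := fun q =>
    if q = p then v else if q = d.partner p then v.reverse else d.word q
  have w1 : W p = v := if_pos rfl
  have w2 : W (d.partner p) = v.reverse := by simp [W, hne]
  have w3 : ∀ q, q ≠ p → q ≠ d.partner p → W q = d.word q := fun q h1 h2 => by simp [W, h1, h2]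
  have hW : ∀ q, W q = d.word q ∨ SplitsTo (d.word q) (W q) := by
    intro q
    rcases hcases q with rfl | rfl | ⟨h1, h2⟩
    · rw [w1]; exact Or.inr hv
    · rw [w2, hd.word_partner]; exact Or.inr hv.reverse
    · exact Or.inl (w3 q h1 h2)
  have hprop : d.aValue = 1 → ∀ q, d.IsProp q → W q = d.word q := by
    intro h1 q hq
    rcases hcases q with rfl | rfl | ⟨h2, h3⟩
    · exact absurd ⟨h1, hq⟩ hp
    · exact absurd ⟨h1, (isProp_partner hpp p).1 hq⟩ hp
    · exact w3 q h2 h3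
  have he : (d.reword W d.vert).IsLR := by
    refine hd.reword (fun q => ?_) (fun q l hl => ?_) (fun _ q hq => ?_) hd.vert_nil
      (fun h1 i j hij hx => ?_) (fun h1 i j hij hx => ?_)
    · rcases hcases q with rfl | rfl | ⟨h1, h2⟩
      · rw [w1, w2]
      · rw [hpp, w1, w2, List.reverse_reverse]
      · rw [w3 q h1 h2, w3, hd.word_partner]
        · exact fun e => h2 (by rw [← e, hpp])
        · exact fun e => h1 (by rw [← hpp q, e, hpp])
    · rcases hW q with e | e
      · rw [e] at hl
        exact ⟨l, hl, rfl⟩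
      · exact e.mem hl
    · rcases hW q with e | e
      · rwa [e]
      · exact e.sorted hq
    · rw [hprop h1 _ (isProp_inl.2 ⟨j, hij⟩)]
      exact hd.vert_left h1 i j hij hx
    · rw [hprop h1 _ (isProp_inl.2 ⟨j, hij⟩)]
      exact hd.vert_right h1 i j hij hx
  refine ⟨d.reword W d.vert, ⟨he, rfl, rfl, fun q => ?_, rfl, fun h => ?_⟩, ?_⟩
  · rcases hW q with e | e
    · exact congrArg expand e
    · exact e.expand_eq
  · refine isProduct_of_edgeReduces h hd (.edge p hp ?_ (fun q h1 h2 => (w3 q h1 h2).symm) rfl rfl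
      rfl)
    show Reduces (W p) 1 (d.word p)
    rw [w1]
    exact hv.reduces
  · refine Nat.add_lt_add_right (Finset.sum_lt_sum (fun q _ => ?_) ⟨p, Finset.mem_univ _, ?_⟩) _
    · show (W q).countP _ ≤ _
      rcases hW q with e | e
      · rw [e]
      · exact e.countP_lt.le
    · show (W p).countP _ < _
      rw [w1]
      exact hv.countP_lt

/-- If there are several propagating edges, none of them can touch both walls. -/
theorem IsLR.not_exposed_prop {d : PreDiagram (n + 2)} (hd : d.IsLR) (h1 : 1 < d.propCount)
    {x : Fin (n + 2)} (hx : d.IsProp (Sum.inl x)) (hL : d.Exposed posL (Sum.inl x))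
    (hR : d.Exposed posR (Sum.inl x)) : False := by
  classical
  rw [propCount_eq] at h1
  obtain ⟨z, hz, hzx⟩ := Finset.exists_mem_ne h1 x
  simp only [Finset.mem_filter, Finset.mem_univ, true_and] at hz
  rcases lt_or_gt_of_ne hzx with h | h
  · exact hd.not_isProp_of_exposed h hL (Or.inl hx) hz
  · refine hd.mirror.not_isProp_of_exposed (x := x.rev) (z := z.rev) (Fin.rev_lt_rev.2 h) ?_
      (Or.inl ?_) ?_
    · rw [exposed_mirror.1, mirrorNode_inl, Fin.rev_rev]
      exact hR
    · rwa [isProp_mirror, mirrorNode_inl, Fin.rev_rev]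
    · rwa [isProp_mirror, mirrorNode_inl, Fin.rev_rev]

/-- A triangle in the vertical sequence can be split. The words of the propagating edges are changed
accordingly: the closed letters belong to the edge exposed to the left wall, the open ones to the
edge exposed to the right wall. -/
theorem IsLR.split_vert (hn : 2 ≤ n) {d : PreDiagram (n + 2)} (hd : d.IsLR) (h1 : d.aValue = 1)
    (h : d.vert.countP Deco.isTri ≠ 0) : ∃ e, Expands d e ∧ e.triCount < d.triCount := by
  classical
  obtain ⟨V, hV⟩ := exists_splitsTo h
  have hpp := hd.partner_partner
  have hpc : 1 < d.propCount := by
    have := two_mul_aValue_add hpp hd.partner_ne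
    omega
  -- the word, read from the north face, that the vertical sequence `v` gives to the edge at `p`
  let G : List Deco → Node (n + 2) → List Deco := fun v p =>
    if d.Exposed posL p then v.filter Deco.isClosed
    else if d.Exposed posR p then v.filter Deco.isOpen else []
  have hG : ∀ v p, G v (d.partner p) = G v p := by
    intro v p
    have he : ∀ pos, d.Exposed pos (d.partner p) ↔ d.Exposed pos p := fun pos =>
      ⟨fun h => by simpa [hpp] using h.partner hpp, fun h => h.partner hpp⟩
    simp only [G, he]
  have hGd : ∀ x, d.IsProp (Sum.inl x) → d.word (Sum.inl x) = G d.vert (Sum.inl x) := by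
    intro x hx
    obtain ⟨j, hj⟩ := isProp_inl.1 hx
    simp only [G]
    split_ifs with hL hR
    · exact hd.vert_left h1 x j hj hL
    · exact hd.vert_right h1 x j hj hR
    · exact hd.word_eq_nil hL hR
  have hGV : ∀ p, G V p = G d.vert p ∨ SplitsTo (G d.vert p) (G V p) := by
    intro p
    simp only [G]
    split_ifs with hL hR
    · exact hV.filter (Or.inl rfl)
    · exact hV.filter (Or.inr rfl)
    · exact Or.inl rfl
  let W : Node (n + 2) → List Deco := fun p =>
    if d.IsProp p then if p.isLeft = true then G V p else (G V p).reverse else d.word p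
  have w1 : ∀ p, ¬ d.IsProp p → W p = d.word p := fun p hp => if_neg hp
  have w2 : ∀ x, d.IsProp (Sum.inl x) → W (Sum.inl x) = G V (Sum.inl x) := fun x hx => by
    simp [W, hx]
  have w3 : ∀ x, d.IsProp (Sum.inr x) → W (Sum.inr x) = (G V (Sum.inr x)).reverse := fun x hx => by
    simp [W, hx]
  have hW : ∀ q, W q = d.word q ∨ SplitsTo (d.word q) (W q) := by
    intro q
    by_cases hq : d.IsProp q
    · rcases q with x | x
      · rw [w2 x hq, hGd x hq]
        exact hGV _
      · obtain ⟨j, hj⟩ := isProp_inr.1 hq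
        have hj' := hpp (Sum.inr x)
        have e1 := hG V (Sum.inr x)
        have e2 := hd.word_partner (Sum.inl j)
        rw [hj] at hj' e1
        rw [hj', hGd j (isProp_inl.2 ⟨x, hj'⟩)] at e2
        rw [w3 x hq, ← e1, e2]
        rcases hGV (Sum.inl j) with e | e
        · exact Or.inl (by rw [e])
        · exact Or.inr e.reverse
    · exact Or.inl (w1 q hq)
  have he : (d.reword W V).IsLR := by
    refine hd.reword (fun q => ?_) (fun q l hl => ?_) (fun h0 => by omega) (fun h => absurd h1 h)
      (fun _ i j hij hx => ?_) (fun _ i j hij hx => ?_)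
    · by_cases hq : d.IsProp q
      · have hq' := (isProp_partner hpp q).2 hq
        rcases q with x | x
        · obtain ⟨j, hj⟩ := isProp_inl.1 hq
          have e1 := hG V (Sum.inl x)
          rw [hj] at hq' e1 ⊢
          rw [w2 x hq, w3 j hq', e1]
        · obtain ⟨j, hj⟩ := isProp_inr.1 hq
          have e1 := hG V (Sum.inr x)
          rw [hj] at hq' e1 ⊢
          rw [w3 x hq, w2 j hq', e1, List.reverse_reverse]
      · rw [w1 q hq, w1 _ (by rwa [isProp_partner hpp]), hd.word_partner]
    · rcases hW q with e | e
      · rw [e] at hl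
        exact ⟨l, hl, rfl⟩
      · exact e.mem hl
    · rw [w2 i (isProp_inl.2 ⟨j, hij⟩)]
      simp [G, hx]
    · have hi := isProp_inl.2 ⟨j, hij⟩
      have : ¬ d.Exposed posL (Sum.inl i) := fun hL => hd.not_exposed_prop hpc hi hL hx
      rw [w2 i hi]
      simp [G, hx, this]
  refine ⟨d.reword W V, ⟨he, rfl, rfl, fun q => ?_, hV.expand_eq, fun h => ?_⟩, ?_⟩
  · rcases hW q with e | e
    · exact congrArg expand e
    · exact e.expand_eq
  · exact isProduct_of_edgeReduces h hd (.vert h1 hV.reduces (fun q hq => (w1 q hq).symm) rfl rfl)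
  · refine Nat.add_lt_add_of_le_of_lt (Finset.sum_le_sum fun q _ => ?_) hV.countP_lt
    show (W q).countP _ ≤ _
    rcases hW q with e | e
    · rw [e]
    · exact e.countP_lt.le

/-- All triangles can be split. -/
theorem IsLR.exists_expands (hn : 2 ≤ n) : ∀ (m : ℕ) {d : PreDiagram (n + 2)}, d.IsLR →
    d.triCount ≤ m → ∃ e, Expands d e ∧ (∀ p, e.word p = expand (d.word p)) ∧
      e.vert = expand d.vert := by
  have hzero : ∀ d : PreDiagram (n + 2), d.IsLR → d.triCount = 0 →
      ∃ e, Expands d e ∧ (∀ p, e.word p = expand (d.word p)) ∧ e.vert = expand d.vert := by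
    intro d hd h0
    rw [triCount, Nat.add_eq_zero_iff, Finset.sum_eq_zero_iff] at h0
    exact ⟨d, ⟨hd, rfl, rfl, fun _ => rfl, rfl, id⟩,
      fun p => (expand_eq_self (h0.1 p (Finset.mem_univ p))).symm, (expand_eq_self h0.2).symm⟩
  intro m
  induction m with
  | zero => exact fun hd hm => hzero _ hd (by omega)
  | succ m ih =>
    intro d hd hm
    by_cases h0 : d.triCount = 0
    · exact hzero d hd h0
    have : ∃ e, Expands d e ∧ e.triCount < d.triCount := by
      by_cases hv : d.aValue = 1 ∧ d.vert.countP Deco.isTri ≠ 0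
      · exact hd.split_vert hn hv.1 hv.2
      by_contra hcon
      apply h0
      have hv0 : d.vert.countP Deco.isTri = 0 := by
        by_cases h1 : d.aValue = 1
        · by_contra h2
          exact hv ⟨h1, h2⟩
        · rw [hd.vert_nil h1]; rfl
      rw [triCount, hv0, Nat.add_zero, Finset.sum_eq_zero_iff]
      intro p _
      by_contra hp
      by_cases hp' : d.aValue = 1 ∧ d.IsProp p
      · -- the decorations on the edge at `p` occur in the vertical sequence
        have key : ∀ x, d.IsProp (Sum.inl x) → (d.word (Sum.inl x)).countP Deco.isTri = 0 := by
          intro x hx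
          obtain ⟨j, hj⟩ := isProp_inl.1 hx
          by_cases hL : d.Exposed posL (Sum.inl x)
          · rw [hd.vert_left hp'.1 x j hj hL]
            exact Nat.le_zero.1 (hv0 ▸ List.filter_sublist.countP_le)
          by_cases hR : d.Exposed posR (Sum.inl x)
          · rw [hd.vert_right hp'.1 x j hj hR]
            exact Nat.le_zero.1 (hv0 ▸ List.filter_sublist.countP_le)
          · rw [hd.word_eq_nil hL hR]; rfl
        rcases p with x | x
        · exact hp (key x hp'.2)
        · obtain ⟨j, hj⟩ := isProp_inr.1 hp'.2
          have e1 := hd.partner_partner (Sum.inr x)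
          have e2 := hd.word_partner (Sum.inl j)
          rw [hj] at e1
          rw [e1] at e2
          rw [e2, List.countP_reverse] at hp
          exact hp (key j (isProp_inl.2 ⟨x, e1⟩))
      · exact hcon (hd.split_word hp' hp)
    obtain ⟨e, he, hlt⟩ := this
    obtain ⟨f, hf, hw, hv⟩ := ih he.isLR (by omega)
    exact ⟨f, ⟨hf.isLR, hf.partner.trans he.partner, hf.loops.trans he.loops,
      fun p => (hf.word p).trans (he.word p), hf.vert.trans he.vert,
      fun h => he.isProduct (hf.isProduct h)⟩, fun p => (hw p).trans (he.word p),
      hv.trans he.vert⟩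

end expansion

end PreDiagram

/-! ### Walks of admissible words -/

theorem Walk.of_isTri {m : List Deco} (h : ∀ x ∈ m, x.isTri = true) : Walk .M (expand m) .M := by
  induction m with
  | nil => exact .nil _
  | cons a m ih =>
    have ih := ih fun x hx => h x (by simp [hx])
    have ha := h a (by simp)
    rw [show a :: m = [a] ++ m from rfl, expand_append]
    cases a
    · simp [Deco.isTri] at ha
    · exact .dotM (.dotL ih)
    · simp [Deco.isTri] at ha
    · exact .odotM (.odotR ih)

theorem isTri_of_not_mem {m : List Deco} (h1 : Deco.dot ∉ m) (h2 : Deco.odot ∉ m) :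
    ∀ x ∈ m, x.isTri = true := by
  intro x hx
  cases x
  · exact absurd hx h1
  · rfl
  · exact absurd hx h2
  · rfl

/-- A sorted word that is a basis element of the decoration algebra has at most one letter of each
type. -/
theorem ClosedBeforeOpen.exists_append {u : List Deco} (h : ClosedBeforeOpen u)
    (h' : Alternating u) : ∃ A B, u = A ++ B ∧ (A = [] ∨ A = [.dot] ∨ A = [.tri]) ∧
      (B = [] ∨ B = [.odot] ∨ B = [.otri]) := by
  have key : ∀ u, ClosedBeforeOpen u → Alternating u → (∀ x ∈ u, x.isOpen = true) →
      u = [] ∨ u = [.odot] ∨ u = [.otri] := by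
    intro u h h' ho
    rcases u with _ | ⟨a, _ | ⟨b, u⟩⟩
    · exact Or.inl rfl
    · have := ho a (by simp)
      cases a <;> simp [Deco.isOpen, Deco.isClosed] at this ⊢
    · have h1 := ho a (by simp)
      have h2 := ho b (by simp)
      rw [Alternating, List.isChain_cons_cons] at h'
      cases a <;> cases b <;> simp [Deco.isOpen, Deco.isClosed] at h1 h2 h'
  rcases u with _ | ⟨a, u⟩
  · exact ⟨[], [], rfl, Or.inl rfl, Or.inl rfl⟩
  by_cases ha : a.isOpen = true
  · refine ⟨[], a :: u, rfl, Or.inl rfl, key _ h h' ?_⟩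
    rw [ClosedBeforeOpen, List.pairwise_cons] at h
    intro x hx
    rcases List.mem_cons.1 hx with rfl | hx
    · exact ha
    · exact h.1 x hx ha
  · have hA : [a] = [Deco.dot] ∨ [a] = [Deco.tri] := by
      cases a <;> simp [Deco.isOpen, Deco.isClosed] at ha ⊢
    refine ⟨[a], u, rfl, Or.inr hA, ?_⟩
    rw [ClosedBeforeOpen, List.pairwise_cons] at h
    have h'' : Alternating u := h'.tail
    refine key u h.2 h'' ?_
    rcases u with _ | ⟨b, u⟩
    · simp
    · rw [Alternating, List.isChain_cons_cons] at h'
      have hb : b.isOpen = true := by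
        have := h'.1
        cases a <;> cases b <;> simp [Deco.isOpen, Deco.isClosed] at ha this ⊢
      have h2 := h.2
      rw [List.pairwise_cons] at h2
      intro x hx
      rcases List.mem_cons.1 hx with rfl | hx
      · exact hb
      · exact h2.1 x hx hb

namespace PreDiagram

section admissible

variable {n : ℕ}

theorem IsLR.north_word_sorted {d : PreDiagram (n + 2)} (hd : d.IsLR) {x y : Fin (n + 2)}
    (h : d.partner (Sum.inl x) = Sum.inl y) (hxy : x < y) :
    ClosedBeforeOpen (d.word (Sum.inl x)) := by
  by_cases h0 : d.propCount = 0
  · exact (northWord_sorted_iff.1 (hd.north_sorted h0)).1 x y h hxy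
  · rw [PreDiagram.propCount_eq_zero] at h0
    push Not at h0
    obtain ⟨z, hz⟩ := h0
    have hp : ¬ d.IsProp (Sum.inl x) := not_isProp_inl.2 ⟨y, h⟩
    by_cases hL : d.Exposed posL (Sum.inl x)
    · have hR : ¬ d.Exposed posR (Sum.inl x) := fun hR => hd.not_exposed_both hz hp hL hR
      refine closedBeforeOpen_of_uniform (c := true) fun l hl => ?_
      by_contra hc
      exact hR (hd.open_exposed _ l hl (by simpa [Deco.isOpen] using hc))
    · refine closedBeforeOpen_of_uniform (c := false) fun l hl => ?_
      by_contra hc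
      exact hL (hd.closed_exposed _ l hl (by simpa using hc))

theorem IsLR.word_sorted {d : PreDiagram (n + 2)} (hd : d.IsLR) {p : Node (n + 2)}
    (hp : ¬ d.IsProp p) (hlt : (p.elim id id).val < ((d.partner p).elim id id).val) :
    ClosedBeforeOpen (d.word p) := by
  rcases p with x | x
  · obtain ⟨y, hy⟩ := not_isProp_inl.1 hp
    rw [hy] at hlt
    exact hd.north_word_sorted hy hlt
  · obtain ⟨y, hy⟩ := not_isProp_inr.1 hp
    rw [hy] at hlt
    refine hd.flip.north_word_sorted (x := x) (y := y) ?_ hlt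
    simp [PreDiagram.flip, hy]

/-- The consequence of the axioms for the non-propagating edges: such an edge carries exactly one
circle of the type of `s`, in first position, if it starts at a corner at the end `s`, and none if
it is not at a corner. -/
def CircleCondition (d : PreDiagram (n + 2)) (s : Side) : Prop :=
  (∀ p, Corner s p → ¬ d.IsProp p → ∃ w, d.word p = s.circ :: w ∧ s.circ ∉ w) ∧
  ∀ p, ¬ d.IsProp p → ¬ d.AtCorner s p → s.circ ∉ d.word p

theorem NonPropCondition.circleCondition {d : PreDiagram (n + 2)} {s : Side}
    (h : d.NonPropCondition s) : d.CircleCondition s :=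
  ⟨fun p hc hp => ⟨[], h.1 p hc hp, by simp⟩, h.2⟩

theorem circleCondition_of_isAdmissible {d : LRDiagram n} (hd : IsAdmissible d) (s : Side) :
    d.1.CircleCondition s := by
  have hpp := d.2.partner_partner
  by_cases h0 : d.1.aValue = 0
  · have : ∀ p, d.1.IsProp p := fun p => by
      by_contra hp
      exact aValue_ne_zero hpp d.2.partner_ne hp h0
    exact ⟨fun p _ hp => absurd (this p) hp, fun p hp => absurd (this p) hp⟩
  by_cases h1 : d.1.aValue = 1
  · exact (hd.oneCap h1 s).1.circleCondition
  rcases hpc : d.1.propCount with _ | _ | m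
  · obtain ⟨h2, h3⟩ := hd.undammed hpc s
    exact ⟨fun p hp _ => h2 p hp, fun p _ => h3 p⟩
  · exact ((hd.oneProp hpc).1 s).circleCondition
  · obtain ⟨-, h3, h4⟩ := hd.manyProp (by omega) (by omega) s
    refine ⟨fun p hc hp => ⟨[], ?_, by simp⟩, fun p _ => h4 p⟩
    rcases hc with rfl | rfl
    · refine (h3 fun e => hp ?_).1
      rw [isProp_inl]
      exact ⟨_, e⟩
    · refine (h3 fun e => hp ?_).2
      have := hpp (Sum.inl (s.idx 0))
      rw [e] at this
      rw [isProp_inr]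
      exact ⟨_, this⟩

theorem corner_left {p : Node (n + 2)} : Corner .left p ↔ (p.elim id id).val = 0 := by
  have e : (Side.left.idx 0 : Fin (n + 2)) = 0 := rfl
  rcases p with x | x <;>
    simp only [Corner, e, Sum.inl.injEq, Sum.inr.injEq, reduceCtorEq, or_false, false_or,
      Fin.ext_iff, Fin.val_zero, Sum.elim_inl, Sum.elim_inr, id]

theorem corner_right {p : Node (n + 2)} : Corner .right p ↔ (p.elim id id).val = n + 1 := by
  have e : (Side.right.idx 0 : Fin (n + 2)) = Fin.last (n + 1) := Fin.rev_zero _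
  rcases p with x | x <;>
    simp only [Corner, e, Sum.inl.injEq, Sum.inr.injEq, reduceCtorEq, or_false, false_or,
      Fin.ext_iff, Fin.val_last, Sum.elim_inl, Sum.elim_inr, id]

theorem zone_of_ne {p : Node (n + 2)} (h0 : (p.elim id id).val ≠ 0)
    (h1 : (p.elim id id).val ≠ n + 1) : zone p = .M := by
  simp only [zone, column, if_neg h0, if_neg h1]

theorem zone_left {p : Node (n + 2)} (h0 : (p.elim id id).val = 0) : zone p = .L := by
  simp only [zone, column, if_pos h0]

theorem zone_right {p : Node (n + 2)} (h1 : (p.elim id id).val = n + 1) : zone p = .R := by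
  simp only [zone, column, h1]
  rw [if_neg (by omega), if_pos trivial]

/-- The walk along a non-propagating edge, read from its left end. -/
theorem walk_nonprop_left {d : PreDiagram (n + 2)} (hd : d.IsLR)
    (halt : ∀ p, ¬ d.IsProp p → Alternating (d.word p)) (hcirc : ∀ s, d.CircleCondition s)
    {p : Node (n + 2)} (hp : ¬ d.IsProp p)
    (hlt : (p.elim id id).val < ((d.partner p).elim id id).val) :
    Walk (zone p) (expand (d.word p)) (zone (d.partner p)) ∧
      (expand (d.word p)).count .dot ≤ 2 ∧ (expand (d.word p)).count .odot ≤ 2 := by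
  have hpp := hd.partner_partner
  have hp' : ¬ d.IsProp (d.partner p) := by rwa [isProp_partner hpp]
  obtain ⟨A, B, hw, hA, hB⟩ := (hd.word_sorted hp hlt).exists_append (halt p hp)
  have hy : ((d.partner p).elim id id).val < n + 2 := Fin.is_lt _
  -- the closed letter accounts for the left end, the open letter for the right end of the edge
  have h1 : Walk (zone p) (expand A) .M := by
    by_cases h0 : (p.elim id id).val = 0
    · obtain ⟨w, hw', -⟩ := (hcirc .left).1 p (corner_left.2 h0) hp
      rw [zone_left h0]
      rw [hw] at hw'
      rcases hA with rfl | rfl | rfl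
      · rcases hB with rfl | rfl | rfl <;> simp [Side.circ] at hw'
      · exact .dotL (.nil _)
      · simp [Side.circ] at hw'
    · have hn : ¬ d.AtCorner .left p := by
        rintro (h | h) <;> rw [corner_left] at h <;> omega
      have := (hcirc .left).2 p hp hn
      rw [zone_of_ne h0 (by omega)]
      rw [hw] at this
      rcases hA with rfl | rfl | rfl
      · exact .nil _
      · simp [Side.circ] at this
      · exact .dotM (.dotL (.nil _))
  have h2 : Walk .M (expand B) (zone (d.partner p)) := by
    by_cases h0 : ((d.partner p).elim id id).val = n + 1
    · obtain ⟨w, hw', -⟩ := (hcirc .right).1 _ (corner_right.2 h0) hp'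
      rw [zone_right h0]
      rw [hd.word_partner, hw, List.reverse_append] at hw'
      rcases hB with rfl | rfl | rfl
      · rcases hA with rfl | rfl | rfl <;> simp [Side.circ] at hw'
      · exact .odotM (.nil _)
      · simp [Side.circ] at hw'
    · have hn : ¬ d.AtCorner .right p := by
        rintro (h | h) <;> rw [corner_right] at h <;> omega
      have := (hcirc .right).2 p hp hn
      rw [zone_of_ne (by omega) h0]
      rw [hw] at this
      rcases hB with rfl | rfl | rfl
      · exact .nil _
      · simp [Side.circ] at this
      · exact .odotM (.odotR (.nil _))
  rw [hw, expand_append]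
  refine ⟨h1.append h2, ?_, ?_⟩ <;>
    rcases hA with rfl | rfl | rfl <;> rcases hB with rfl | rfl | rfl <;> decide

theorem walk_nonprop {d : PreDiagram (n + 2)} (hd : d.IsLR)
    (halt : ∀ p, ¬ d.IsProp p → Alternating (d.word p)) (hcirc : ∀ s, d.CircleCondition s)
    {p : Node (n + 2)} (hp : ¬ d.IsProp p) :
    Walk (zone p) (expand (d.word p)) (zone (d.partner p)) ∧
      (expand (d.word p)).count .dot ≤ 2 ∧ (expand (d.word p)).count .odot ≤ 2 := by
  have hpp := hd.partner_partner
  have hne : (p.elim id id).val ≠ ((d.partner p).elim id id).val := by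
    intro e
    apply hd.partner_ne p
    rcases p with x | x
    · obtain ⟨y, hy⟩ := not_isProp_inl.1 hp
      rw [hy] at e ⊢
      rw [show y = x from Fin.ext e.symm]
    · obtain ⟨y, hy⟩ := not_isProp_inr.1 hp
      rw [hy] at e ⊢
      rw [show y = x from Fin.ext e.symm]
  rcases lt_or_gt_of_ne hne with hlt | hlt
  · exact walk_nonprop_left hd halt hcirc hp hlt
  · obtain ⟨h1, h2, h3⟩ := walk_nonprop_left hd halt hcirc (p := d.partner p)
      (by rwa [isProp_partner hpp]) (by rwa [hpp])
    rw [hpp, hd.word_partner, expand_reverse] at h1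
    rw [hd.word_partner, expand_reverse, List.count_reverse] at h2 h3
    refine ⟨?_, h2, h3⟩
    have := h1.reverse
    rwa [List.reverse_reverse] at this

theorem walk_cornerMark (p : Node (n + 2)) :
    Walk (zone p) (expand (cornerMark (p.elim id id))) .M := by
  by_cases h0 : (p.elim id id).val = 0
  · have : p.elim id id = 0 := Fin.ext h0
    rw [zone_left h0, this]
    exact .dotL (.nil _)
  · have h0' : p.elim id id ≠ 0 := fun e => h0 (by rw [e]; rfl)
    by_cases h1 : (p.elim id id).val = n + 1
    · have h1' : p.elim id id = Fin.last (n + 1) := Fin.ext h1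
      rw [zone_right h1, cornerMark, if_neg h0', if_pos h1']
      exact .odotR (.nil _)
    · have h1' : p.elim id id ≠ Fin.last (n + 1) := fun e => h1 (by rw [e]; rfl)
      rw [zone_of_ne h0 h1, cornerMark, if_neg h0', if_neg h1']
      exact .nil _

theorem walk_vertical (s : Side) {p q : Node (n + 2)} (hp : p.elim id id = s.idx 0)
    (hq : q.elim id id = s.idx 0) {w : List Deco} (hw : w = [] ∨ w = [s.trig]) :
    Walk (zone p) (expand w) (zone q) := by
  have hz : zone p = zone q := by rw [zone, zone, hp, hq]
  rw [← hz]
  rcases hw with rfl | rfl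
  · exact .nil _
  · cases s
    · have : zone p = .L := zone_left (by rw [hp]; rfl)
      rw [this]
      exact .dotL (.dotM (.nil _))
    · have : zone p = .R := zone_right (by rw [hp]; simp [Side.idx])
      rw [this]
      exact .odotR (.odotM (.nil _))

/-- The walks along the propagating edges, if there are several of them and the `a`-value is greater
than `1`. -/
theorem walk_manyProp {d : PreDiagram (n + 2)} (hd : d.IsLR) (h : ∀ s, d.ManyPropAxiom s)
    {i j : Fin (n + 2)} (hij : d.partner (Sum.inl i) = Sum.inr j) :
    Walk (zone (Sum.inl i : Node (n + 2))) (expand (d.word (Sum.inl i)))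
      (zone (Sum.inr j : Node (n + 2))) := by
  have hji := hd.partner_partner (Sum.inl i)
  have hrev := hd.word_partner (Sum.inl i)
  rw [hij] at hji hrev
  have hidx : ∀ s : Side, s.idx 0 = (0 : Fin (n + 2)) ∨ s.idx 0 = Fin.last (n + 1) := by
    rintro (_ | _)
    · exact Or.inl rfl
    · exact Or.inr (by simp [Side.idx])
  -- the word at an end of the edge that is a corner, unless the edge is vertical
  have hi : ∀ s : Side, i = s.idx 0 → ¬ j = s.idx 0 → d.word (Sum.inl i) = [s.circ] := by
    intro s h1 h2
    subst h1
    refine ((h s).2.1 fun e => h2 ?_).1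
    rw [hij] at e
    simpa using e
  have hj : ∀ s : Side, j = s.idx 0 → ¬ i = s.idx 0 → d.word (Sum.inl i) = [s.circ] := by
    intro s h1 h2
    subst h1
    have := ((h s).2.1 fun e => h2 ?_).2
    · rw [this] at hrev
      rw [← List.reverse_reverse (d.word (Sum.inl i)), ← hrev]
      rfl
    · have := hd.partner_partner (Sum.inl (s.idx 0))
      rw [e, hji] at this
      simpa using this
  by_cases hv : ∃ s : Side, i = s.idx 0 ∧ j = s.idx 0
  · obtain ⟨s, h1, h2⟩ := hv
    subst h1 h2
    exact walk_vertical s rfl rfl ((h s).1 hij)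
  -- exactly one end is a corner, or none
  by_cases hc : ∃ s : Side, i = s.idx 0 ∨ j = s.idx 0
  · obtain ⟨s, hs⟩ := hc
    have hword : d.word (Sum.inl i) = [s.circ] := by
      by_cases h1 : i = s.idx 0
      · exact hi s h1 fun h2 => hv ⟨s, h1, h2⟩
      · exact hj s (hs.resolve_left h1) h1
    have hcirc : ∀ s', d.word (Sum.inl i) = [s'.circ] → s' = s := by
      intro s' e
      rw [hword] at e
      cases s <;> cases s' <;> simp [Side.circ] at e ⊢
    have hother : ∀ s', i = s'.idx 0 ∨ j = s'.idx 0 → s' = s := by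
      intro s' hs'
      apply hcirc
      by_cases h1 : i = s'.idx 0
      · exact hi s' h1 fun h2 => hv ⟨s', h1, h2⟩
      · exact hj s' (hs'.resolve_left h1) h1
    have hmid : ∀ x : Fin (n + 2), (∀ s : Side, x ≠ s.idx 0) → x.val ≠ 0 ∧ x.val ≠ n + 1 := by
      intro x hx
      exact ⟨fun e => hx .left (Fin.ext e), fun e => hx .right (Fin.ext (by simp [Side.idx, e]))⟩
    have hwL : Walk (zone (Sum.inl (s.idx 0) : Node (n + 2))) (expand [s.circ]) .M := by
      have := walk_cornerMark (Sum.inl (s.idx 0) : Node (n + 2))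
      cases s
      · exact this
      · have e : cornerMark (Side.right.idx 0 : Fin (n + 2)) = [.odot] := by
          simp [cornerMark, Side.idx, ← Fin.val_inj]
        rwa [Sum.elim_inl, id, e] at this
    have hz : zone (Sum.inr (s.idx 0) : Node (n + 2)) =
      zone (Sum.inl (s.idx 0) : Node (n + 2)) := rfl
    rw [hword]
    by_cases h1 : i = s.idx 0
    · have hjm := hmid j fun s' e => by
        have := hother s' (Or.inr e)
        subst this
        exact hv ⟨_, h1, e⟩
      rw [zone_of_ne (p := Sum.inr j) hjm.1 hjm.2, h1]
      exact hwL
    · have him := hmid i fun s' e => by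
        have := hother s' (Or.inl e)
        subst this
        exact h1 e
      rw [zone_of_ne (p := Sum.inl i) him.1 him.2, hs.resolve_left h1, hz]
      have := hwL.reverse
      rw [← expand_reverse] at this
      exact this
  · push Not at hc
    have hn : ∀ s : Side, s.circ ∉ d.word (Sum.inl i) := by
      intro s
      apply (h s).2.2
      rintro (h1 | h1)
      · rcases h1 with h1 | h1
        · exact (hc s).1 (by simpa using h1)
        · simp at h1
      · rw [hij] at h1
        rcases h1 with h1 | h1
        · simp at h1
        · exact (hc s).2 (by simpa using h1)
    have hmid : ∀ x : Fin (n + 2), (∀ s : Side, x ≠ s.idx 0) →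
        zone (Sum.inl x : Node (n + 2)) = .M := by
      intro x hx
      exact zone_of_ne (fun e => hx .left (Fin.ext e))
        (fun e => hx .right (Fin.ext (by simpa [Side.idx] using e)))
    have hz : zone (Sum.inr j : Node (n + 2)) = zone (Sum.inl j : Node (n + 2)) := rfl
    rw [hz, hmid i fun s => (hc s).1, hmid j fun s => (hc s).2]
    exact Walk.of_isTri (isTri_of_not_mem (hn .left) (hn .right))

/-- The walks along the propagating edges, if the `a`-value is neither `0` nor `1`. -/
theorem walk_prop {d : LRDiagram n} (hd : IsAdmissible d) (h0 : d.1.aValue ≠ 0)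
    (h1 : d.1.aValue ≠ 1) {i j : Fin (n + 2)} (hij : d.1.partner (Sum.inl i) = Sum.inr j) :
    Walk (zone (Sum.inl i : Node (n + 2))) (expand (d.1.word (Sum.inl i)))
      (zone (Sum.inr j : Node (n + 2))) := by
  have hpc : d.1.propCount ≠ 0 := fun e =>
    PreDiagram.propCount_eq_zero.1 e i (isProp_inl.2 ⟨j, hij⟩)
  by_cases h2 : d.1.propCount = 1
  · rcases (hd.oneProp h2).2 i j hij with ⟨m, hw, hm⟩ | ⟨s, hi, hj, hw⟩
    · rw [hw, expand_append, expand_append]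
      refine ((walk_cornerMark (Sum.inl i)).append (Walk.of_isTri fun x hx => ?_)).append ?_
      · rcases hm x hx with rfl | rfl <;> rfl
      · have := (walk_cornerMark (Sum.inr j : Node (n + 2))).reverse
        rw [← expand_reverse] at this
        have e : (cornerMark j).reverse = cornerMark j := by
          unfold cornerMark; split_ifs <;> rfl
        rwa [Sum.elim_inr, id, e] at this
    · exact walk_vertical s (p := Sum.inl i) (q := Sum.inr j) hi hj hw
  · exact walk_manyProp d.2 (hd.manyProp (by omega) (by omega)) hij

end admissible

/-! ### Admissible diagrams with one non-propagating edge in each face -/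

section oneCap

variable {n : ℕ}

/-- If the `a`-value is `1`, there is only one non-propagating edge in the north face. -/
theorem IsLR.eq_of_not_isProp {d : PreDiagram (n + 2)} (hd : d.IsLR) (h1 : d.aValue = 1)
    {x y z : Fin (n + 2)} (h : d.partner (Sum.inl x) = Sum.inl y) (hxy : x < y)
    (hz : ¬ d.IsProp (Sum.inl z)) : z = x ∨ z = y := by
  obtain ⟨w, hw⟩ := not_isProp_inl.1 hz
  have hw' := hd.partner_partner (Sum.inl z)
  have hx' := hd.partner_partner (Sum.inl x)
  rw [hw] at hw'
  rw [h] at hx'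
  have hne : z ≠ w := fun e => hd.partner_ne (Sum.inl z) (by rw [hw, e])
  by_contra hcon
  push Not at hcon
  rcases lt_or_gt_of_ne hne with hlt | hlt
  · exact aValue_ne_one_of_two hw h hlt hxy hcon.1 h1
  · refine aValue_ne_one_of_two hw' h hlt hxy ?_ h1
    rintro rfl
    rw [h] at hw'
    simp only [Sum.inl.injEq] at hw'
    exact hcon.2 hw'.symm

/-- If the `a`-value is `1`, the non-propagating edges join neighbouring nodes. -/
theorem IsLR.exists_cup {d : PreDiagram (n + 2)} (hd : d.IsLR) (h1 : d.aValue = 1) :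
    ∃ (i : ℕ) (hi : i < n + 1),
      d.partner (Sum.inl ⟨i, by omega⟩) = Sum.inl ⟨i + 1, by omega⟩ := by
  classical
  have h2 : d.aValue ≠ 0 := by omega
  rw [aValue] at h2
  obtain ⟨⟨i, hi⟩, hx⟩ := Finset.card_ne_zero.1 h2
  simp only [Finset.mem_filter, Finset.mem_univ, true_and] at hx
  obtain ⟨⟨y, hy⟩, hxy, hlt⟩ := hx
  simp only [Fin.lt_def] at hlt
  refine ⟨i, by omega, ?_⟩
  by_cases e : y = i + 1
  · subst e; exact hxy
  exfalso
  by_cases hp : d.IsProp (Sum.inl ⟨i + 1, by omega⟩)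
  · obtain ⟨z, hz⟩ := isProp_inl.1 hp
    have := hd.planar (Sum.inl ⟨i, hi⟩) (Sum.inl ⟨i + 1, by omega⟩)
    rw [hxy, hz] at this
    simp only [posL] at this
    omega
  · have := hd.eq_of_not_isProp h1 hxy hlt hp
    simp only [Fin.mk.injEq] at this
    omega

theorem flip_partner_inl {d : PreDiagram (n + 2)} {x y : Fin (n + 2)}
    (h : d.partner (Sum.inr x) = Sum.inr y) : d.flip.partner (Sum.inl x) = Sum.inl y := by
  simp [PreDiagram.flip, h]

theorem count_filter_isClosed (v : List Deco) :
    (v.filter Deco.isClosed).count .dot = v.count .dot :=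
  List.count_filter rfl

/-- The closed circles in the vertical sequence of a diagram of `a`-value `1`, where the
non-propagating edges start at `i` and `j`: there is one at the beginning if `i` is at the left
wall, one at the end if `j` is, and no other. The exception is that both edges are at the left wall
and there is at most a single triangle. -/
theorem OneCapAxiom.vert_spec (hn : 2 ≤ n) {d : PreDiagram (n + 2)} (hd : d.IsLR)
    (h1 : d.aValue = 1) (hax : d.OneCapAxiom .left) {i j : ℕ} (hi : i < n + 1) (hj : j < n + 1)
    (cup : d.partner (Sum.inl ⟨i, by omega⟩) = Sum.inl ⟨i + 1, by omega⟩)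
    (cap : d.partner (Sum.inr ⟨j, by omega⟩) = Sum.inr ⟨j + 1, by omega⟩) :
    (i = 0 ∧ j = 0 ∧ (d.vert = [] ∨ d.vert = [.tri])) ∨
    (d.vert.count .dot = (if i = 0 then 1 else 0) + (if j = 0 then 1 else 0) ∧
      (i = 0 → ∃ v, d.vert = .dot :: v) ∧ (j = 0 → ∃ v, d.vert = v ++ [.dot])) := by
  have hpp := hd.partner_partner
  have hpc : d.propCount ≠ 0 := by
    have := two_mul_aValue_add hpp hd.partner_ne
    omega
  -- the non-propagating edges are `{i, i + 1}` and `{j, j + 1}` only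
  have hN : ∀ z, ¬ d.IsProp (Sum.inl z) → z.val = i ∨ z.val = i + 1 := by
    intro z hz
    have := hd.eq_of_not_isProp h1 cup (by simp) hz
    simpa only [← Fin.val_inj] using this
  have hS : ∀ z, ¬ d.IsProp (Sum.inr z) → z.val = j ∨ z.val = j + 1 := by
    intro z hz
    have := hd.flip.eq_of_not_isProp (by rw [aValue_flip hpp hd.partner_ne, h1])
      (flip_partner_inl cap) (by simp) (z := z) (by rwa [isProp_flip])
    simpa only [← Fin.val_inj] using this
  have hi0 : d.IsProp (Sum.inl 0) → i ≠ 0 := by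
    rintro h rfl
    exact not_isProp_inl.2 ⟨_, cup⟩ h
  have hj0 : d.IsProp (Sum.inr 0) → j ≠ 0 := by
    rintro h rfl
    exact not_isProp_inr.2 ⟨_, cap⟩ h
  have hi1 : ∀ y, d.partner (Sum.inl 0) = Sum.inl y → i = 0 := by
    intro y hy
    have := hN 0 (not_isProp_inl.2 ⟨y, hy⟩)
    simp only [Fin.val_zero] at this
    omega
  have hj1 : ∀ y, d.partner (Sum.inr 0) = Sum.inr y → j = 0 := by
    intro y hy
    have := hS 0 (not_isProp_inr.2 ⟨y, hy⟩)
    simp only [Fin.val_zero] at this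
    omega
  have h2v : (2 : Fin (n + 2)).val = 2 := by
    show 2 % (n + 2) = 2
    exact Nat.mod_eq_of_lt (by omega)
  have h2p : i = 0 → d.IsProp (Sum.inl 2) := by
    intro h0
    by_contra hp
    have := hN 2 hp
    omega
  have hE0 : d.Exposed posL (Sum.inl 0) := by
    intro q
    have : posL (Sum.inl 0 : Node (n + 2)) = 0 := rfl
    omega
  have hE2 : d.partner (Sum.inl 0) = Sum.inl 1 → d.Exposed posL (Sum.inl 2) := by
    intro h q
    have h' := hpp (Sum.inl 0)
    rw [h] at h'
    have e2 : posL (Sum.inl 2 : Node (n + 2)) = 2 := h2v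
    rintro ⟨q1, q2, q3, q4⟩
    rw [e2] at q1 q3
    rcases q with q | q
    · simp only [posL] at q1
      have hq : q = 0 ∨ q = 1 := by
        rcases Nat.lt_or_ge q.val 1 with h | h
        · exact Or.inl (Fin.ext (by simp only [Fin.val_zero]; omega))
        · exact Or.inr (Fin.ext (by simp; omega))
      rcases hq with rfl | rfl
      · rw [h] at q3
        simp [posL] at q3
      · rw [h'] at q3
        simp [posL] at q3
    · simp only [posL] at q1
      omega
  have hword : ∀ x, d.IsProp (Sum.inl x) → d.Exposed posL (Sum.inl x) →
      d.word (Sum.inl x) = d.vert.filter Deco.isClosed := by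
    intro x hx he
    obtain ⟨y, hy⟩ := isProp_inl.1 hx
    exact hd.vert_left h1 x y hy he
  rw [← count_filter_isClosed]
  rcases hax with ⟨h, hw⟩ | ⟨h, h', hw, ho⟩ | ⟨m, h, h', hw, ht, hb⟩ | ⟨m, h, h', hw, ht⟩ |
    ⟨m, h, h', hw, hb⟩ <;> simp only [Side.idx, Side.trig, Side.circ] at *
  · have hp : d.IsProp (Sum.inl 0) := isProp_inl.2 ⟨_, h⟩
    have hp' : d.IsProp (Sum.inr 0) := by
      have := hpp (Sum.inl 0)
      rw [h] at this
      exact isProp_inr.2 ⟨_, this⟩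
    right
    refine ⟨?_, fun e => absurd e (hi0 hp), fun e => absurd e (hj0 hp')⟩
    rw [if_neg (hi0 hp), if_neg (hj0 hp'), ← hword 0 hp hE0, List.count_eq_zero]
    intro hx
    have := hw _ hx
    simp at this
  · left
    have e1 := hi1 _ h
    refine ⟨e1, hj1 _ h', ?_⟩
    have hf : d.vert.filter Deco.isClosed = d.vert := by
      rw [List.filter_eq_self]
      intro l hl
      by_contra hlc
      obtain ⟨x, hx, hxe⟩ := exists_exposed (c := d.mirror) (by rwa [propCount_mirror])
      rw [exposed_mirror.1] at hxe
      rw [isProp_mirror] at hx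
      obtain ⟨y, hy⟩ := isProp_inl.1 hx
      have := hd.vert_right h1 _ y hy hxe
      have hl' : l ∈ d.word (Sum.inl x.rev) := by
        rw [this, List.mem_filter]
        exact ⟨hl, by simpa [Deco.isOpen] using hlc⟩
      exact hlc (ho _ l hl')
    rw [hword 2 (h2p e1) (hE2 h), hf] at hw
    exact hw
  · have e1 := hi1 _ h
    have e2 := hj1 _ h'
    right
    rw [← hword 2 (h2p e1) (hE2 h), hw, e1, e2]
    exact ⟨by simp [List.count_replicate], fun _ => List.head?_eq_some_iff.1 ht,
      fun _ => List.getLast?_eq_some_iff.1 hb⟩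
  · have e1 := hi1 _ h
    have hp : d.IsProp (Sum.inr 0) := by
      have := hpp (Sum.inl 2)
      rw [h'] at this
      exact isProp_inr.2 ⟨_, this⟩
    right
    rw [← hword 2 (h2p e1) (hE2 h), hw, e1, if_neg (hj0 hp)]
    exact ⟨by simp [List.count_replicate], fun _ => List.head?_eq_some_iff.1 ht,
      fun e => absurd e (hj0 hp)⟩
  · have e2 := hj1 _ h
    have hp : d.IsProp (Sum.inl 0) := isProp_inl.2 ⟨_, h'⟩
    right
    rw [← hword 0 hp hE0, hw, e2, if_neg (hi0 hp)]
    exact ⟨by simp [List.count_replicate], fun e => absurd e (hi0 hp),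
      fun _ => List.getLast?_eq_some_iff.1 hb⟩

/-- The axiom for the right side is the one for the left side of the mirror image. -/
theorem OneCapAxiom.mirror {d : PreDiagram (n + 2)} (h : d.OneCapAxiom .right) :
    d.mirror.OneCapAxiom .left := by
  have hr : ∀ x : Fin (n + 2), Side.right.idx x = x.rev := fun _ => rfl
  rcases h with ⟨h, hw⟩ | ⟨h, h', hw, ho⟩ | ⟨m, h, h', hw, ht, hb⟩ | ⟨m, h, h', hw, ht⟩ |
    ⟨m, h, h', hw, hb⟩ <;> rw [hr] at *
  · refine .vertical ?_ ?_
    · simp only [PreDiagram.mirror, Side.idx, mirrorNode_inl, h, mirrorNode_inr, Fin.rev_rev]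
    · intro x hx
      simp only [PreDiagram.mirror, Side.idx, mirrorNode_inl, List.mem_map] at hx
      obtain ⟨y, hy, rfl⟩ := hx
      rw [hw y hy]
      rfl
  · rw [hr] at h h'
    refine .plain ?_ ?_ ?_ ?_
    · simp only [PreDiagram.mirror, Side.idx, mirrorNode_inl, h, Fin.rev_rev]
    · simp only [PreDiagram.mirror, Side.idx, mirrorNode_inr, h', Fin.rev_rev]
    · simp only [PreDiagram.mirror, Side.idx, mirrorNode_inl]
      rcases hw with hw | hw <;> rw [hw]
      · exact Or.inl rfl
      · exact Or.inr rfl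
    · intro p x hx
      simp only [PreDiagram.mirror, List.mem_map] at hx
      obtain ⟨y, hy, rfl⟩ := hx
      have := ho _ y hy
      cases y <;> simp [Deco.isClosed, Side.circ, Deco.mirror] at this ⊢
  · rw [hr] at h h'
    refine .both m ?_ ?_ ?_ ?_ ?_
    · simp only [PreDiagram.mirror, Side.idx, mirrorNode_inl, h, Fin.rev_rev]
    · simp only [PreDiagram.mirror, Side.idx, mirrorNode_inr, h', Fin.rev_rev]
    · simp only [PreDiagram.mirror, Side.idx, mirrorNode_inl, hw]
      simp [Side.circ, Side.trig, Deco.mirror]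
    · simp [PreDiagram.mirror, ht, Side.circ, Deco.mirror]
    · simp [PreDiagram.mirror, hb, Side.circ, Deco.mirror]
  · rw [hr] at h h'
    refine .top m ?_ ?_ ?_ ?_
    · simp only [PreDiagram.mirror, Side.idx, mirrorNode_inl, h, Fin.rev_rev]
    · simp only [PreDiagram.mirror, Side.idx, mirrorNode_inl, h', mirrorNode_inr, Fin.rev_rev]
    · simp only [PreDiagram.mirror, Side.idx, mirrorNode_inl, hw]
      simp [Side.circ, Side.trig, Deco.mirror]
    · simp [PreDiagram.mirror, ht, Side.circ, Deco.mirror]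
  · rw [hr] at h h'
    refine .bottom m ?_ ?_ ?_ ?_
    · simp only [PreDiagram.mirror, Side.idx, mirrorNode_inr, h, Fin.rev_rev]
    · simp only [PreDiagram.mirror, Side.idx, mirrorNode_inl, h', mirrorNode_inr, Fin.rev_rev]
    · simp only [PreDiagram.mirror, Side.idx, mirrorNode_inl, hw]
      simp [Side.circ, Side.trig, Deco.mirror]
    · simp [PreDiagram.mirror, hb, Side.circ, Deco.mirror]

/-- A prefix and a suffix of a word that together are not longer than the word do not overlap. -/
theorem exists_middle {v P Q v1 v2 : List Deco} (h1 : v = P ++ v1) (h2 : v = v2 ++ Q)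
    (hl : P.length + Q.length ≤ v.length) : ∃ m, v = P ++ m ++ Q := by
  rw [h1] at h2
  rcases List.append_eq_append_iff.1 h2 with ⟨a, rfl, rfl⟩ | ⟨a, rfl, rfl⟩
  · exact ⟨a, by rw [h1, List.append_assoc]⟩
  · rw [h1] at hl
    simp only [List.length_append] at hl
    have : a = [] := List.length_eq_zero_iff.1 (by omega)
    subst this
    exact ⟨[], by simpa using h1⟩

theorem count_dot_mark (i : ℕ) : (mark n i).count .dot = if i = 0 then 1 else 0 := by
  unfold mark
  split_ifs <;> rfl

theorem count_odot_mark (hn : n ≠ 0) (i : ℕ) : (mark n i).count .odot = if i = n then 1 else 0 := by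
  unfold mark
  by_cases h0 : i = 0
  · subst h0
    rw [if_pos rfl, if_neg hn.symm]
    rfl
  · rw [if_neg h0]
    split_ifs <;> rfl

theorem count_add_count (v : List Deco) : v.count .dot + v.count .odot ≤ v.length := by
  induction v with
  | nil => simp
  | cons a v ih =>
    cases a <;> simp <;> omega

theorem walk_expand_mark (i : ℕ) : Walk (column n i) (expand (mark n i)) .M := by
  unfold column mark
  split_ifs
  · exact .dotL (.nil _)
  · exact .odotR (.nil _)
  · exact .nil _

/-- The walk of the vertical sequence of an admissible diagram of `a`-value `1`: the sequence
consists of the mark of the north edge, triangles, and the mark of the south edge. -/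
theorem walk_vert (hn : 2 ≤ n) {d : PreDiagram (n + 2)} (hd : d.IsLR)
    (h1 : d.aValue = 1) (hL : d.OneCapAxiom .left) (hR : d.OneCapAxiom .right) {i j : ℕ}
    (hi : i < n + 1) (hj : j < n + 1)
    (cup : d.partner (Sum.inl ⟨i, by omega⟩) = Sum.inl ⟨i + 1, by omega⟩)
    (cap : d.partner (Sum.inr ⟨j, by omega⟩) = Sum.inr ⟨j + 1, by omega⟩) :
    Walk (column n i) (expand d.vert) (column n j) := by
  have hpp := hd.partner_partner
  have cup' := hpp (Sum.inl ⟨i, by omega⟩)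
  have cap' := hpp (Sum.inr ⟨j, by omega⟩)
  rw [cup] at cup'
  rw [cap] at cap'
  have hr : ∀ (x : ℕ) (hx : x < n + 1), (⟨n - x, by omega⟩ : Fin (n + 2)).rev = ⟨x + 1, by omega⟩ ∧
      (⟨n - x + 1, by omega⟩ : Fin (n + 2)).rev = ⟨x, by omega⟩ := by
    intro x hx
    constructor <;> ext <;> simp [Fin.val_rev] <;> omega
  have mcup : d.mirror.partner (Sum.inl ⟨n - i, by omega⟩) = Sum.inl ⟨n - i + 1, by omega⟩ := by
    simp only [PreDiagram.mirror, mirrorNode_inl]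
    rw [(hr i hi).1, cup', mirrorNode_inl, ← (hr i hi).2, Fin.rev_rev]
  have mcap : d.mirror.partner (Sum.inr ⟨n - j, by omega⟩) = Sum.inr ⟨n - j + 1, by omega⟩ := by
    simp only [PreDiagram.mirror, mirrorNode_inr]
    rw [(hr j hj).1, cap', mirrorNode_inr, ← (hr j hj).2, Fin.rev_rev]
  have hvm : d.mirror.vert = d.vert.map Deco.mirror := rfl
  have hvm' : d.vert = d.mirror.vert.map Deco.mirror := by rw [hvm, map_mirror_mirror]
  rcases hL.vert_spec hn hd h1 hi hj cup cap with ⟨rfl, rfl, hv⟩ | ⟨l1, l2, l3⟩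
  · have : column n 0 = .L := rfl
    rw [this]
    rcases hv with hv | hv <;> rw [hv]
    · exact .nil _
    · exact .dotL (.dotM (.nil _))
  rcases hR.mirror.vert_spec hn hd.mirror (by rw [aValue_mirror hpp hd.partner_ne, h1])
    (by omega) (by omega) mcup mcap with ⟨e1, e2, hv⟩ | ⟨r1, r2, r3⟩
  · obtain rfl : i = n := by omega
    obtain rfl : j = i := by omega
    have : column j j = .R := by
      rw [column, if_neg (by omega), if_pos rfl]
    rw [this, hvm']
    rcases hv with hv | hv <;> rw [hv]
    · exact .nil _
    · exact .odotR (.odotM (.nil _))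
  have hni : ∀ x, x < n + 1 → (n - x = 0 ↔ x = n) := fun x hx => by omega
  rw [hvm, count_map_mirror] at r1
  simp only [hni i hi, hni j hj] at r1 r2 r3
  have hP : ∃ v1, d.vert = mark n i ++ v1 := by
    unfold mark
    split_ifs with h0 hin
    · exact l2 h0
    · obtain ⟨v, hv⟩ := r2 hin
      exact ⟨v.map Deco.mirror, by rw [hvm', hv]; rfl⟩
    · exact ⟨_, rfl⟩
  have hQ : ∃ v2, d.vert = v2 ++ mark n j := by
    unfold mark
    split_ifs with h0 hjn
    · exact l3 h0
    · obtain ⟨v, hv⟩ := r3 hjn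
      exact ⟨v.map Deco.mirror, by rw [hvm', hv, List.map_append]; rfl⟩
    · exact ⟨_, (List.append_nil _).symm⟩
  obtain ⟨v1, hv1⟩ := hP
  obtain ⟨v2, hv2⟩ := hQ
  have hlen : ∀ x, (mark n x).length = (mark n x).count .dot + (mark n x).count .odot := by
    intro x
    unfold mark
    split_ifs <;> rfl
  have ci := count_dot_mark (n := n) i
  have cj := count_dot_mark (n := n) j
  have oi := count_odot_mark (n := n) (by omega) i
  have oj := count_odot_mark (n := n) (by omega) j
  -- all circles of the vertical sequence belong to the two marks, which do not overlap
  rw [← ci, ← cj] at l1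
  rw [← oi, ← oj] at r1
  have r1 : d.vert.count .odot = (mark n i).count .odot + (mark n j).count .odot := r1
  obtain ⟨m, hm⟩ := exists_middle hv1 hv2 (by
    have := count_add_count d.vert
    rw [hlen i, hlen j]
    omega)
  rw [hm, List.count_append, List.count_append] at l1 r1
  rw [hm, expand_append, expand_append]
  refine ((walk_expand_mark i).append (Walk.of_isTri (isTri_of_not_mem ?_ ?_))).append ?_
  · exact List.count_eq_zero.1 (by omega)
  · exact List.count_eq_zero.1 (by omega)
  · have := (walk_expand_mark (n := n) j).reverse
    rwa [← expand_reverse, mark_reverse] at this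

end oneCap

/-! ### Admissible diagrams are products of simple diagrams -/

/-- The expansion of an admissible diagram is taut, apart from the identity diagram. -/
theorem isProduct_of_isAdmissible {n : ℕ} (hn : 2 ≤ n) {d : LRDiagram n} (hd : IsAdmissible d) :
    d.1.IsProduct := by
  have hlr := d.2
  have hpp := hlr.partner_partner
  by_cases h0 : d.1.aValue = 0
  · -- an undecorated diagram without loops
    have hp : ∀ p, d.1.IsProp p := fun p => by
      by_contra hp
      exact aValue_ne_zero hpp hlr.partner_ne hp h0
    obtain ⟨hw, hl⟩ := hlr.undecorated h0
    refine Clean.isProduct hn (n + 2) le_rfl ⟨hpp, hlr.partner_ne, hlr.planar, fun x y h => ?_,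
      fun x y h => ?_, fun p _ => hw p, hlr.vert_nil (by omega), ?_, ?_, ?_⟩ ?_
    · exact absurd (hp _) (not_isProp_inl.2 ⟨_, h⟩)
    · exact absurd (hp _) (not_isProp_inr.2 ⟨_, h⟩)
    · rw [Multiset.eq_zero_iff_forall_notMem]
      intro L hL
      have := loopOf_perm ((hd.loops L hL).symm.trans (hl L hL))
      simp at this
    · exact ⟨fun _ => hp _, fun _ => hp _⟩
    · exact ⟨fun _ => hp _, fun _ => hp _⟩
    · intro p h
      rcases p with p | p <;> simp at h <;> omega
  obtain ⟨e, he, hw, hv⟩ := hlr.exists_expands hn _ le_rfl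
  have hprop : ∀ p, e.IsProp p ↔ d.1.IsProp p := fun p => by rw [IsProp, IsProp, he.partner]
  have hav : e.aValue = d.1.aValue := by simp only [aValue, he.partner]
  refine he.isProduct (Taut.isProduct hn _ (c := e) ⟨he.isLR, fun p hp => ?_, fun h1 p hp => ?_,
    fun h1 => ?_, fun L hL => ?_⟩ rfl)
  · rw [hprop] at hp
    rw [hw, he.partner]
    exact walk_nonprop hlr (fun p hp => hd.reduced.1 p fun h => hp h.2)
      (circleCondition_of_isAdmissible hd) hp
  · rw [hprop] at hp
    rw [hav] at h1
    rw [hw, he.partner]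
    rcases p with x | x
    · obtain ⟨y, hy⟩ := isProp_inl.1 hp
      rw [hy]
      exact walk_prop hd h0 h1 hy
    · obtain ⟨y, hy⟩ := isProp_inr.1 hp
      have hy' := hpp (Sum.inr x)
      have hrev := hlr.word_partner (Sum.inr x)
      rw [hy] at hy' hrev
      have := (walk_prop hd h0 h1 hy').reverse
      rw [← expand_reverse, hrev, List.reverse_reverse] at this
      rwa [hy]
  · rw [hav] at h1
    obtain ⟨i, hi, cup⟩ := hlr.exists_cup h1
    obtain ⟨j, hj, cap⟩ := hlr.flip.exists_cup (by rw [aValue_flip hpp hlr.partner_ne, h1])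
    have cap' : d.1.partner (Sum.inr ⟨j, by omega⟩) = Sum.inr ⟨j + 1, by omega⟩ := by
      simp only [PreDiagram.flip, Sum.swap_inl] at cap
      rw [← Sum.swap_swap (d.1.partner _), cap, Sum.swap_inl]
    refine ⟨i, j, hi, hj, by rw [he.partner]; exact cup, by rw [he.partner]; exact cap', ?_⟩
    rw [hv]
    exact walk_vert hn hlr h1 (hd.oneCap h1 .left).2 (hd.oneCap h1 .right).2 hi hj cup cap'
  · rw [he.loops] at hL
    exact hd.loops L hL

end PreDiagram

end AffineCDiagram

theorem mainTheorem2 (n : ℕ) (hn : 2 ≤ n) (d : AffineCDiagram.LRDiagram n)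
    (hd : AffineCDiagram.IsAdmissible d) :
    (∃ l : List (Fin (n + 1)),
      AffineCDiagram.diagram d =
        (l.map fun i => AffineCDiagram.diagram (AffineCDiagram.LRDiagram.simple i)).prod) ∧
    AffineCDiagram.diagram d ∈ AffineCDiagram.simpleAlgebra n := by
  obtain ⟨_, l, hl⟩ := AffineCDiagram.PreDiagram.isProduct_of_isAdmissible hn hd
  replace hl : AffineCDiagram.diagram d =
      (l.map fun i => AffineCDiagram.diagram (AffineCDiagram.LRDiagram.simple i)).prod := hl
  refine ⟨⟨l, hl⟩, ?_⟩
  rw [hl]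
  refine Subalgebra.list_prod_mem _ fun x hx => ?_
  obtain ⟨i, -, rfl⟩ := List.mem_map.1 hx
  exact Algebra.subset_adjoin ⟨i, rfl⟩
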